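/- **Notation.** Let $\mathcal H=\{\xi\in\mathbb C:\operatorname{Re}\xi>0\}$ and, for $T>0$, $Q_T=\{\xi: 0<\operatorname{Re}\xi<4T,\ |\operatorname{Im}\xi|<4T\}$. *Models.* A model consists of finitely many (at least one) pairwise disjoint, simply connected, unbounded domains $\Omega_1,\dots,\Omega_N\subset\mathbb C$ and conformal bijections $\tau_j:\Omega_j\to\mathcal H$ such that $\varphi_j=\tau_j^{-1}$ satisfies $|\varphi_j(\xi)|\to\infty$ as $|\xi|\to\infty$, $\xi\in\mathcal H$. Its model function is $f=e^{\tau_j}$ on $\Omega_j$. Its Julia set $\mathcal J_f$ is the set of $z$ with $|z|>1$ all of whose iterates $f^n(z)$, $n\ge1$, are defined and satisfy $|f^n(z)|>1$. *Class $\mathcal B$.* This is the class of transcendental entire functions $f$ for which the closure $S(f)$ of the set of critical values and finite asymptotic values is bounded; $\mathcal J_f$ is the usual Julia set. *Tracts.* A tract of $f$ at level $R\ge 1$ is a connected component $\Omega$ of $\{|f|>R\}$. An associated conformal map is a conformal bijection $\varphi:\mathcal H\to\Omega$ with $f(\varphi(\xi))=R e^{\xi}$; if every tract at level $R$ has one,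 the tracts at level $R$ are called logarithmic. A tract with associated map $\varphi$ is called Hölder with exponent $\alpha\in(0,1]$ if 1. there is $M\in(0,\infty)$ such that, for all large $T$, $|\varphi(\xi)|\le M|\varphi(\xi')|$ for all $\xi,\xi'\in Q_T\setminus Q_{T/8}$; and 2. there are $H$ and $T_0\ge1$ such that, for every $T\ge T_0$, the map $g(z)=\varphi(Tz)$ satisfies $|g(z_1)-g(z_2)|\le H|g'(1)||z_1-z_2|^\alpha$ for all $z_1,z_2\in Q_1$. We say that $f$ has finitely many Hölder tracts with exponent $\alpha$ if, for some $R\ge1$, $f$ has only finitely many tracts at level $R$, and all of them are Hölder with exponent $\alpha$. *Spectrum.* For a conformal map $\varphi:\mathcal H\to\Omega$ put $\varphi_T(z)=\varphi(Tz)/|\varphi(T)|$, $$\beta_{h}(r,t)=\frac{\log\int_{1\le|y|\le2}|h'(r+iy)|^t\,dy}{\log(1/r)},\qquad \beta_{\infty}(t)=\limsup_{T\to\infty}\beta_{\varphi_T}(1/T,t),$$ $b_\infty(t)=\beta_\infty(t)-t+1$ and $\Theta=\inf\{t>0:b_\infty(t)=0\}$. For $f$, let $\beta_{\infty,f}$ and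 $\Theta_f$ be the maxima of $\beta_\infty$ and $\Theta$ over its finitely many tracts, and $b_{\infty,f}(t)=\beta_{\infty,f}(t)-t+1$. For a model these are computed from $\varphi_1,\dots,\varphi_N$. For $f\in\mathcal B$ they are computed at a level $R\ge 1$ at which there are finitely many tracts, all logarithmic, from associated maps. The function $f$ has negative spectrum if $b_{\infty,f}(t)<0$ for all $t>\Theta_f$. *Hyperbolic dimension.* $\operatorname{HypDim}(f)$ is the Hausdorff dimension of $\{z\in\mathcal J_f:\liminf_{n\to\infty}|f^n(z)|<\infty\}$. **Proposition.** Let $f$ be a model function or a function of class $\mathcal B$, and suppose that $f$ has finitely many Hölder tracts with exponent $\alpha\in(0,1]$. Then $f$ has negative spectrum and $$1\le\Theta_f\le\operatorname{HypDim}(f)\le2 .$$ If moreover $\alpha>1/2$, then $\Theta_f<2$. For $f\in\mathcal B$ all this holds for every level $R\ge1$ at which there are finitely many tracts, all logarithmic, and for every choice of the associated maps. -/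

import Mathlib

noncomputable section

namespace Tract

open Filter Topology Set

/-- The right half plane `{Re ξ > 0}`. -/
def halfPlane : Set ℂ := {ξ | 0 < ξ.re}

/-- The rectangle `Q_T`. -/
def rect (T : ℝ) : Set ℂ := {ξ | 0 < ξ.re ∧ ξ.re < 4 * T ∧ -(4 * T) < ξ.im ∧ ξ.im < 4 * T}

/-! ### Tracts -/

/-- The tracts of `f` at level `R`: the connected components of `{|f| > R}`. -/
def tracts (f : ℂ → ℂ) (R : ℝ) : Set (Set ℂ) :=
  {Ω | ∃ z, R < ‖f z‖ ∧ Ω = connectedComponentIn {w | R < ‖f w‖} z}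

/-- `φ` maps the half plane conformally onto `Ω`, and `f = R exp ∘ φ⁻¹` on `Ω`. -/
structure IsTractMap (f : ℂ → ℂ) (R : ℝ) (Ω : Set ℂ) (φ : ℂ → ℂ) : Prop where
  holo : DifferentiableOn ℂ φ halfPlane
  bij : BijOn φ halfPlane Ω
  eq_exp : ∀ ξ ∈ halfPlane, f (φ ξ) = R * Complex.exp ξ

/-- `Ω₁, …, Ω_N` enumerates without repetition all tracts of `f` at level `R`, and `φ₁, …, φ_N` are
associated conformal maps of the half plane onto them. -/
structure IsTractSystem (f : ℂ → ℂ) (R : ℝ) {N : ℕ} (Ω : Fin N → Set ℂ) (φ : Fin N → ℂ → ℂ) :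
    Prop where
  inj : Function.Injective Ω
  range_eq : range Ω = tracts f R
  isTractMap : ∀ j, IsTractMap f R (Ω j) (φ j)

/-- `|φ ξ| ≤ M |φ ξ'|` for all `ξ, ξ' ∈ Q_T \ Q_{T/8}` and all large `T`. -/
def HasBoundedOscillation (φ : ℂ → ℂ) : Prop :=
  ∃ M : ℝ, 0 < M ∧ ∃ T₁ : ℝ, 1 ≤ T₁ ∧ ∀ T ≥ T₁, ∀ ξ ∈ rect T \ rect (T / 8),
    ∀ ξ' ∈ rect T \ rect (T / 8), ‖φ ξ‖ ≤ M * ‖φ ξ'‖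

/-- The map `g` on `Q_1` is `(H, α)`-Hölder, in the form that is scale invariant in the range. -/
def IsHolderOnRect (H α : ℝ) (g : ℂ → ℂ) : Prop :=
  ∀ z₁ ∈ rect 1, ∀ z₂ ∈ rect 1, ‖g z₁ - g z₂‖ ≤ H * ‖deriv g 1‖ * ‖z₁ - z₂‖ ^ α

/-- The tract with conformal map `φ` is `(H, α)`-Hölder. -/
def IsHolderTract (H α : ℝ) (φ : ℂ → ℂ) : Prop :=
  HasBoundedOscillation φ ∧
    ∃ T₀ : ℝ, 1 ≤ T₀ ∧ ∀ T ≥ T₀, IsHolderOnRect H α (fun z => φ ((T : ℂ) * z))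

/-- `f` has finitely many Hölder tracts with exponent `α`: at some level `R ≥ 1` there are finitely
many tracts, and all of them are Hölder with exponent `α`. -/
def HasHolderTracts (f : ℂ → ℂ) (α : ℝ) : Prop :=
  ∃ R : ℝ, 1 ≤ R ∧ (tracts f R).Finite ∧
    ∀ Ω ∈ tracts f R, ∃ φ : ℂ → ℂ, IsTractMap f R Ω φ ∧ ∃ H : ℝ, IsHolderTract H α φ

/-! ### Integral means spectrum at infinity -/

/-- The rescaled map `φ_T = φ(T ·) / |φ(T)|`. -/
def rescale (φ : ℂ → ℂ) (T : ℝ) : ℂ → ℂ := fun z => φ ((T : ℂ) * z) / (‖φ (T : ℂ)‖ : ℂ)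

/-- The integral means `β_h(r, t)`, taken over `[-2, -1] ∪ [1, 2]`. -/
def integralMeans (h : ℂ → ℂ) (r t : ℝ) : ℝ :=
  Real.log (∫ y in Icc (-2 : ℝ) (-1) ∪ Icc (1 : ℝ) 2, ‖deriv h (r + y * Complex.I)‖ ^ t) /
    Real.log (1 / r)

/-- `β_∞(t)` of a single tract. -/
def betaInf (φ : ℂ → ℂ) (t : ℝ) : ℝ :=
  limsup (fun T : ℝ => integralMeans (rescale φ T) (1 / T) t) atTop

/-- `b_∞(t) = β_∞(t) - t + 1` of a single tract. -/
def bInf (φ : ℂ → ℂ) (t : ℝ) : ℝ := betaInf φ t - t + 1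

/-- `Θ` of a single tract. -/
def theta (φ : ℂ → ℂ) : ℝ := sInf {t : ℝ | 0 < t ∧ bInf φ t = 0}

variable {N : ℕ}

/-- `β_∞(t)` of finitely many tracts: the maximum over the tracts. -/
def betaInfMax (φ : Fin N → ℂ → ℂ) (t : ℝ) : ℝ := ⨆ j, betaInf (φ j) t

/-- `b_∞(t) = β_∞(t) - t + 1` of finitely many tracts. -/
def bInfMax (φ : Fin N → ℂ → ℂ) (t : ℝ) : ℝ := betaInfMax φ t - t + 1

/-- `Θ` of finitely many tracts: the maximum over the tracts. -/
def thetaMax (φ : Fin N → ℂ → ℂ) : ℝ := ⨆ j, theta (φ j)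

/-- Negative spectrum: `b_∞ < 0` to the right of `Θ`. -/
def HasNegativeSpectrum (φ : Fin N → ℂ → ℂ) : Prop := ∀ t > thetaMax φ, bInfMax φ t < 0

/-! ### Models -/

/-- A model: finitely many pairwise disjoint simply connected unbounded domains `Ω_j` with conformal
maps `τ_j` onto the half plane, whose inverses extend continuously to infinity. -/
structure Model where
  N : ℕ
  N_pos : 0 < N
  Ω : Fin N → Set ℂ
  τ : Fin N → ℂ → ℂ
  isOpen : ∀ j, IsOpen (Ω j)
  simplyConnected : ∀ j, SimplyConnectedSpace (Ω j)
  unbounded : ∀ j, ¬ Bornology.IsBounded (Ω j)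
  disjoint : Pairwise fun i j => Disjoint (Ω i) (Ω j)
  holo : ∀ j, DifferentiableOn ℂ (τ j) (Ω j)
  bij : ∀ j, BijOn (τ j) (Ω j) halfPlane
  tendsto_infty : ∀ j, Tendsto (Function.invFunOn (τ j) (Ω j))
    (Bornology.cobounded ℂ ⊓ 𝓟 halfPlane) (Bornology.cobounded ℂ)

/-- The inverse `φ_j` of `τ_j`. -/
def Model.φ (m : Model) (j : Fin m.N) : ℂ → ℂ := Function.invFunOn (m.τ j) (m.Ω j)

open Classical in
/-- The model function `exp ∘ τ` on `⋃ Ω_j`. Outside its domain it has the value `0`, which lies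
neither in `{|z| > 1}` nor in any `{|z| > R}`, `R ≥ 1`, so that tracts and Julia set below are those
of the partially defined function. -/
def Model.toFun (m : Model) (z : ℂ) : ℂ :=
  if h : ∃ j, z ∈ m.Ω j then Complex.exp (m.τ h.choose z) else 0

/-- The Julia set of a model: the points of `{|z| > 1}` all of whose iterates are defined and lie in
`{|z| > 1}`. -/
def Model.julia (m : Model) : Set ℂ := {z | ∀ n : ℕ, 1 < ‖m.toFun^[n] z‖}

/-! ### Entire functions -/

/-- The set of critical values. -/
def criticalValues (f : ℂ → ℂ) : Set ℂ := f '' {z | deriv f z = 0}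

/-- The set of finite asymptotic values. -/
def asymptoticValues (f : ℂ → ℂ) : Set ℂ :=
  {a | ∃ γ : ℝ → ℂ, ContinuousOn γ (Ici 0) ∧ Tendsto γ atTop (Bornology.cobounded ℂ) ∧
    Tendsto (fun s => f (γ s)) atTop (𝓝 a)}

/-- The singular set `S(f)`. -/
def singularSet (f : ℂ → ℂ) : Set ℂ := closure (criticalValues f ∪ asymptoticValues f)

/-- The Eremenko–Lyubich class: transcendental entire functions with bounded singular set. -/
structure ClassB (f : ℂ → ℂ) : Prop where
  entire : Differentiable ℂ f
  transcendental : ¬ ∃ p : Polynomial ℂ, ∀ z, f z = p.eval z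
  bounded : Bornology.IsBounded (singularSet f)

/-- The iterates of `f` form a normal family on `U`: every sequence of iterates has a subsequence
that converges locally uniformly on `U`, to a finite function or to `∞`. -/
def IteratesNormalOn (f : ℂ → ℂ) (U : Set ℂ) : Prop :=
  ∀ u : ℕ → ℕ, StrictMono u → ∃ v : ℕ → ℕ, StrictMono v ∧
    ((∃ g : ℂ → ℂ, TendstoLocallyUniformlyOn (fun k => f^[u (v k)]) g atTop U) ∨
      ∀ K ⊆ U, IsCompact K → ∀ C : ℝ, ∀ᶠ k in atTop, ∀ z ∈ K, C < ‖f^[u (v k)] z‖)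

/-- The Julia set of an entire function: the points without a disk around them on which the
iterates form a normal family. -/
def julia (f : ℂ → ℂ) : Set ℂ := {z | ¬ ∃ ε > 0, IteratesNormalOn f (Metric.ball z ε)}

/-! ### Hyperbolic dimension -/

/-- The radial part of `J`: the points with `liminf |fⁿ(z)| < ∞`. -/
def radial (f : ℂ → ℂ) (J : Set ℂ) : Set ℂ := {z ∈ J | liminf (fun n : ℕ => ‖f^[n] z‖ₑ) atTop < ⊤}

/-- The hyperbolic dimension of a model. -/
def Model.hypDim (m : Model) : ENNReal := dimH (radial m.toFun m.julia)

/-- The hyperbolic dimension of an entire function. -/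
def hypDim (f : ℂ → ℂ) : ENNReal := dimH (radial f (julia f))

end Tract

end

noncomputable section
namespace Tract
open Filter Topology Set Metric

/-! ### Univalent functions -/

section Univalent

variable {f : ℂ → ℂ} {U : Set ℂ}

/-! The analytic input is a distortion estimate: a univalent `φ` on the half plane satisfies
`|φ''/φ'| ≤ koebeConst / Re ξ`. A crude constant suffices, and it is obtained from the Schwarz lemma
and a square root transformation.

Spectrum. Let `D T y = |φ_T'(1/T + iy)|`. The Hölder condition and Cauchy's estimate give `D ≤ A
T^(1-α)`. A two constants argument gives `∫ D ≥ c`: if the image of `1 + i[T, 2T]` were short, the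
increments of `φ` would be small well inside the half plane too, against distortion
(`RegularTract.exists_le_integral`). Hence `β(t) ≤ t(1-α)` for all `t > 0` and `β(t) ≥ -(1-α)(1-t)`
for `t ≤ 1`, while Hölder's inequality makes `β` convex. So `b(t) = β(t) - t + 1` is at least
`α(1-t)` on `(0,1]` and at most `1 - αt`. By convexity it is positive before its first zero `Θ ∈ [1,
1/α]` and negative after it (`spectrum_zero`). This gives the negative spectrum, `1 ≤ Θ`, and `Θ <
2` when `α > 1/2`.

Dimension. If `t < Θ`, then `b(t) > 0`, so for arbitrarily large `T` the integral of `|φ'(1+iy)|^t`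
over `T ≤ |y| ≤ 2T` is at least `T^ε |φ(T)|^t`. In logarithmic coordinates `f` has the inverse
branches `η ↦ log φ(η - log R + i y_k)` with `y_k ∈ 2πqℤ`. With `s = log |φ(T)|`, they map a disk of
fixed radius about `s` into itself, contract by `O(1/s)`, and have derivative at least a constant
times `s^(-koebeConst) |φ'(1 + i y_k)| / |φ(T)|`. Since `s = O(log T)`, all losses are powers of
`log T` and `T^ε` beats them. A pigeonhole over level sets then selects `N` branches with a common
lower Lipschitz constant `a` and `N a^t ≥ 1` (`RegularTract.exists_large_deriv`). The limit set of
this system has dimension at least `t`; its orbits are bounded, stay in `{|z| > 1}`, and are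
expanded, which puts them in the Julia set (`SeparatedIFS.exists_invariant`).

Levels. Conformal maps of nested tracts differ by a translation (`IsTractMap.exists_shift`), so
Hölder tracts at one level yield the estimates collected in `RegularTract` at every other level. -/

theorem nhds_le_map_nhds_of_injOn (hU : IsOpen U) (hf : DifferentiableOn ℂ f U) (hi : InjOn f U)
    {z : ℂ} (hz : z ∈ U) : 𝓝 (f z) ≤ map f (𝓝 z) := by
  rcases (hf.analyticAt (hU.mem_nhds hz)).eventually_constant_or_nhds_le_map_nhds with h | h
  · exfalso
    have h1 : ∀ᶠ w in 𝓝[≠] z, f w = f z ∧ w ∈ U :=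
      (h.and (hU.mem_nhds hz)).filter_mono nhdsWithin_le_nhds
    obtain ⟨w, ⟨hw, hwU⟩, hne⟩ := (h1.and self_mem_nhdsWithin).exists
    exact hne (hi hwU hz hw)
  · exact h

theorem isOpen_image_of_injOn (hU : IsOpen U) (hf : DifferentiableOn ℂ f U) (hi : InjOn f U) :
    IsOpen (f '' U) := by
  rw [isOpen_iff_mem_nhds]
  rintro _ ⟨z, hz, rfl⟩
  exact nhds_le_map_nhds_of_injOn hU hf hi hz (image_mem_map (hU.mem_nhds hz))

theorem continuousAt_of_leftInvOn {g : ℂ → ℂ} (hU : IsOpen U) (hf : DifferentiableOn ℂ f U)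
    (hg : LeftInvOn g f U) {z : ℂ} (hz : z ∈ U) : ContinuousAt g (f z) := by
  rw [ContinuousAt, hg hz]
  intro W hW
  have := nhds_le_map_nhds_of_injOn hU hf hg.injOn hz
    (image_mem_map (inter_mem hW (hU.mem_nhds hz)))
  rw [mem_map]
  refine mem_of_superset this ?_
  rintro _ ⟨w, ⟨hw, hwU⟩, rfl⟩
  simpa [hg hwU] using hw

/-- A left inverse of a univalent function is holomorphic on the image. -/
theorem differentiableAt_of_leftInvOn {g : ℂ → ℂ} (hU : IsOpen U) (hf : DifferentiableOn ℂ f U)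
    (hg : LeftInvOn g f U) {z : ℂ} (hz : z ∈ U) : DifferentiableAt ℂ g (f z) := by
  have hi := hg.injOn
  have hfan := hf.analyticAt (hU.mem_nhds hz)
  -- Zeros of `f'` are isolated, since otherwise `f` would be constant on a disk.
  have hd : ∀ᶠ w in 𝓝[≠] z, deriv f w ≠ 0 := by
    rcases hfan.deriv.eventually_eq_zero_or_eventually_ne_zero with h | h
    · exfalso
      obtain ⟨ε, hε, hball⟩ := Metric.eventually_nhds_iff_ball.1 (h.and (hU.mem_nhds hz))
      have hc : ∀ w ∈ ball z ε, f w = f z := by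
        intro w hw
        exact (convex_ball z ε).is_const_of_fderivWithin_eq_zero (𝕜 := ℂ)
          (hf.mono fun x hx => (hball x hx).2)
          (fun x hx => by
            rw [fderivWithin_of_isOpen isOpen_ball hx]
            ext
            simpa using (hball x hx).1) hw (mem_ball_self hε)
      have hw : z + (ε / 2 : ℝ) ∈ ball z ε := by
        simp [abs_of_pos hε, hε]
      have := hi (hball _ hw).2 hz (hc _ hw)
      have h0 : ((ε / 2 : ℝ) : ℂ) = 0 := by simpa using this
      rw [Complex.ofReal_eq_zero] at h0
      linarith
    · exact h
  -- The inverse is continuous at `f z` and holomorphic on a punctured neighbourhood, so the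
  -- singularity is removable. That `f' z ≠ 0` is not needed here; it is a consequence.
  refine AnalyticAt.differentiableAt
    (Complex.analyticAt_of_differentiable_on_punctured_nhds_of_continuousAt ?_
      (continuousAt_of_leftInvOn hU hf hg hz))
  have h2 : ∀ᶠ w in 𝓝 z, w ∈ U ∧ (w ≠ z → deriv f w ≠ 0) :=
    (hU.eventually_mem hz).and (eventually_nhdsWithin_iff.1 hd)
  have h3 := nhds_le_map_nhds_of_injOn hU hf hi hz (image_mem_map h2)
  rw [eventually_nhdsWithin_iff]
  filter_upwards [h3]
  rintro _ ⟨w, ⟨hwU, hw⟩, rfl⟩ hne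
  have hwz : w ≠ z := fun h => hne (by simp [h])
  have hwd := hf.differentiableAt (hU.mem_nhds hwU)
  refine (HasDerivAt.of_local_left_inverse (f := f) (continuousAt_of_leftInvOn hU hf hg hwU)
    (f' := deriv f w) (by rw [hg hwU]; exact hwd.hasDerivAt) (hw hwz) ?_).differentiableAt
  filter_upwards [(isOpen_image_of_injOn hU hf hi).mem_nhds (mem_image_of_mem f hwU)]
  rintro _ ⟨x, hx, rfl⟩
  rw [hg hx]

theorem differentiableOn_of_leftInvOn {g : ℂ → ℂ} (hU : IsOpen U) (hf : DifferentiableOn ℂ f U)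
    (hg : LeftInvOn g f U) : DifferentiableOn ℂ g (f '' U) := by
  rintro _ ⟨z, hz, rfl⟩
  exact (differentiableAt_of_leftInvOn hU hf hg hz).differentiableWithinAt

theorem deriv_mul_deriv_of_leftInvOn {g : ℂ → ℂ} (hU : IsOpen U) (hf : DifferentiableOn ℂ f U)
    (hg : LeftInvOn g f U) {z : ℂ} (hz : z ∈ U) : deriv g (f z) * deriv f z = 1 := by
  have h1 := (differentiableAt_of_leftInvOn hU hf hg hz).hasDerivAt.comp z
    (hf.differentiableAt (hU.mem_nhds hz)).hasDerivAt
  refine h1.unique ((hasDerivAt_id z).congr_of_eventuallyEq ?_)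
  filter_upwards [hU.mem_nhds hz] with w hw using hg hw

/-- The chain rule for the holomorphic inverse makes `f' z` a factor of `1`. -/
theorem deriv_ne_zero_of_injOn (hU : IsOpen U) (hf : DifferentiableOn ℂ f U) (hi : InjOn f U)
    {z : ℂ} (hz : z ∈ U) : deriv f z ≠ 0 := fun h => by
  have := deriv_mul_deriv_of_leftInvOn hU hf hi.leftInvOn_invFunOn hz
  simp [h] at this

end Univalent

/-- A nonvanishing holomorphic function on a disk has a holomorphic logarithm. -/
theorem exists_log_on_ball {F : ℂ → ℂ} {c : ℂ} {r : ℝ} (hr : 0 < r)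
    (hF : DifferentiableOn ℂ F (ball c r)) (h0 : ∀ z ∈ ball c r, F z ≠ 0) :
    ∃ l : ℂ → ℂ, l c = Complex.log (F c) ∧
      ∀ z ∈ ball c r, HasDerivAt l (deriv F z / F z) z ∧ Complex.exp (l z) = F z := by
  have hd : DifferentiableOn ℂ (fun z => deriv F z / F z) (ball c r) :=
    (hF.deriv isOpen_ball).div hF h0
  obtain ⟨l, hlc, hl⟩ := hd.isExactOn_ball.with_val_at c (Complex.log (F c))
  refine ⟨l, hlc, fun z hz => ⟨hl z hz, ?_⟩⟩
  have hder : ∀ x ∈ ball c r, HasDerivAt (fun z => F z * Complex.exp (-l z)) 0 x := by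
    intro x hx
    have h1 := (hF.differentiableAt (isOpen_ball.mem_nhds hx)).hasDerivAt.mul
      ((hl x hx).neg.cexp)
    have h2 : deriv F x * Complex.exp ((-l) x) +
        F x * (Complex.exp ((-l) x) * -(deriv F x / F x)) = 0 := by
      rw [mul_neg, mul_neg, mul_left_comm, mul_div_cancel₀ _ (h0 x hx), mul_comm, add_neg_cancel]
    rw [h2] at h1
    exact h1
  have hconst := (convex_ball c r).is_const_of_fderivWithin_eq_zero (𝕜 := ℂ)
    (f := fun z => F z * Complex.exp (-l z))
    (fun x hx => (hder x hx).differentiableAt.differentiableWithinAt)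
    (fun x hx => by
      rw [fderivWithin_of_isOpen isOpen_ball hx]
      ext
      simpa using (hder x hx).deriv) hz (mem_ball_self hr)
  have hc : F c * Complex.exp (-l c) = 1 := by
    rw [hlc, Complex.exp_neg, Complex.exp_log (h0 c (mem_ball_self hr))]
    exact mul_inv_cancel₀ (h0 c (mem_ball_self hr))
  simp only [hc] at hconst
  rw [Complex.exp_neg] at hconst
  field_simp at hconst
  exact hconst.symm

/-- A normalized univalent function omits a value of modulus less than `2`. -/
theorem exists_omitted_value {h : ℂ → ℂ} (hd : DifferentiableOn ℂ h (ball 0 1))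
    (hi : InjOn h (ball 0 1)) (h0 : h 0 = 0) (h1 : deriv h 0 = 1) :
    ∃ w, ‖w‖ < 2 ∧ w ∉ h '' ball 0 1 ∧ ∀ v, ‖v‖ < ‖w‖ → v ∈ h '' ball 0 1 := by
  -- If the image covered the disk of radius 2, the inverse would map that disk into the unit disk,
  -- and Schwarz would give `|g'(0)| ≤ 1/2` although `g'(0) = 1`.
  obtain ⟨w₀, hw₀, hw₀'⟩ : ∃ w, ‖w‖ < 2 ∧ w ∉ h '' ball 0 1 := by
    by_contra! hcon
    have hg := hi.leftInvOn_invFunOn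
    set g := Function.invFunOn h (ball 0 1)
    have hsub : ball (0 : ℂ) 2 ⊆ h '' ball 0 1 := fun w hw => hcon w (by simpa using hw)
    have hgd := (differentiableOn_of_leftInvOn isOpen_ball hd hg).mono hsub
    have hg0 : g 0 = 0 := by
      have := hg (mem_ball_self (x := (0 : ℂ)) one_pos)
      rwa [h0] at this
    have hmaps : MapsTo g (ball 0 2) (closedBall (g 0) 1) := by
      intro w hw
      obtain ⟨z, hz, rfl⟩ := hsub hw
      rw [hg0, hg hz]
      exact ball_subset_closedBall hz
    have hS := Complex.norm_deriv_le_div_of_mapsTo_ball hgd hmaps two_pos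
    have h2 := deriv_mul_deriv_of_leftInvOn isOpen_ball hd hg (mem_ball_self (x := (0 : ℂ)) one_pos)
    rw [h0, h1, mul_one] at h2
    rw [h2] at hS
    norm_num at hS
  have hcl : IsClosed (h '' ball 0 1)ᶜ := (isOpen_image_of_injOn isOpen_ball hd hi).isClosed_compl
  obtain ⟨w, hw, hmin⟩ := hcl.exists_infDist_eq_dist ⟨w₀, hw₀'⟩ (0 : ℂ)
  rw [dist_zero_left] at hmin
  refine ⟨w, ?_, hw, fun v hv => ?_⟩
  · rw [← hmin]
    exact (infDist_le_dist_of_mem hw₀').trans_lt (by simpa using hw₀)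
  · by_contra hv'
    have := infDist_le_dist_of_mem (x := (0 : ℂ)) (show v ∈ (h '' ball 0 1)ᶜ from hv')
    rw [dist_zero_left, hmin] at this
    linarith

/-- A weak growth theorem for normalized univalent functions. -/
theorem norm_le_of_univalent {h : ℂ → ℂ} (hd : DifferentiableOn ℂ h (ball 0 1))
    (hi : InjOn h (ball 0 1)) (h0 : h 0 = 0) (h1 : deriv h 0 = 1) {z : ℂ} (hz : ‖z‖ ≤ 1 / 12) :
    ‖h z‖ ≤ 16 := by
  have mem0 : (0 : ℂ) ∈ ball (0 : ℂ) 1 := mem_ball_self one_pos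
  obtain ⟨w, hw2, hw, hmin⟩ := exists_omitted_value hd hi h0 h1
  have hw0 : w ≠ 0 := fun hcon => hw ⟨0, mem0, h0.trans hcon.symm⟩
  have hwpos : 0 < ‖w‖ := norm_pos_iff.2 hw0
  have hFd : DifferentiableOn ℂ (fun z => 1 - h z / w) (ball 0 1) := (hd.div_const w).const_sub 1
  have hF0 : ∀ z ∈ ball (0 : ℂ) 1, 1 - h z / w ≠ 0 := by
    intro z hz hcon
    refine hw ⟨z, hz, ?_⟩
    rw [sub_eq_zero, eq_div_iff hw0] at hcon
    rw [← hcon, one_mul]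
  obtain ⟨l, hl0, hl⟩ := exists_log_on_ball one_pos hFd hF0
  -- The square root of `1 - h/w` with `k 0 = 1`. On the preimage of the disk `|v| < |w|` it has
  -- positive real part; this will keep it away from `-1` everywhere.
  set k : ℂ → ℂ := fun z => Complex.exp (l z / 2) with hk
  have hkd : DifferentiableOn ℂ k (ball 0 1) := fun z hz =>
    (((hl z hz).1.div_const 2).cexp).differentiableAt.differentiableWithinAt
  have hk2 : ∀ z ∈ ball (0 : ℂ) 1, k z ^ 2 = 1 - h z / w := by
    intro z hz
    rw [hk, ← Complex.exp_nat_mul, ← (hl z hz).2]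
    congr 1
    push_cast
    ring
  have hk0 : k 0 = 1 := by simp [hk, hl0, h0]
  have hg := hi.leftInvOn_invFunOn
  set g := Function.invFunOn h (ball 0 1)
  have hsub : ball (0 : ℂ) ‖w‖ ⊆ h '' ball 0 1 := fun v hv => hmin v (by simpa using hv)
  have hgc : ContinuousOn g (ball 0 ‖w‖) :=
    ((differentiableOn_of_leftInvOn isOpen_ball hd hg).mono hsub).continuousOn
  have hgm : MapsTo g (ball 0 ‖w‖) (ball 0 1) := by
    intro v hv
    obtain ⟨z, hz, rfl⟩ := hsub hv
    rwa [hg hz]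
  have hpos : ∀ v ∈ ball (0 : ℂ) ‖w‖, 0 < (k (g v)).re := by
    have hcont : ContinuousOn (fun v => (k (g v)).re) (ball 0 ‖w‖) :=
      Complex.continuous_re.comp_continuousOn (hkd.continuousOn.comp hgc hgm)
    have hne : ∀ v ∈ ball (0 : ℂ) ‖w‖, (k (g v)).re ≠ 0 := by
      intro v hv hre
      have h2 := hk2 _ (hgm hv)
      obtain ⟨z, hz, rfl⟩ := hsub hv
      rw [hg hz] at h2 hre
      have h3 : ‖h z / w‖ < 1 := by
        rw [norm_div, div_lt_one hwpos]
        simpa using hv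
      have h4 := congrArg Complex.re h2
      simp only [pow_two, Complex.mul_re, hre, Complex.sub_re, Complex.one_re] at h4
      have h5 := Complex.re_le_norm (h z / w)
      nlinarith [mul_self_nonneg (k z).im]
    intro v hv
    by_contra! hle
    have h0m : (0 : ℂ) ∈ ball (0 : ℂ) ‖w‖ := mem_ball_self hwpos
    have hg0 : g 0 = 0 := by
      have := hg mem0
      rwa [h0] at this
    obtain ⟨u, hu, hu0⟩ := (convex_ball (0 : ℂ) ‖w‖).isPreconnected.intermediate_value hv h0m hcont
      ⟨hle, by simp [hg0, hk0]⟩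
    exact hne u hu hu0
  -- If `k z` were this close to `-1`, then `|1 - k²| ≤ (2/5)(2 + 2/5) < 1`, so `h z` would lie in
  -- the disk `|v| < |w|`, where `Re k > 0`.
  have homit : ∀ z ∈ ball (0 : ℂ) 1, 2 / 5 ≤ ‖k z + 1‖ := by
    intro z hz
    by_contra! hlt
    have h2 : h z = w * (1 - k z ^ 2) := by
      rw [hk2 z hz]
      field_simp
      ring
    have h3 : ‖1 - k z ^ 2‖ < 1 := by
      have : 1 - k z ^ 2 = (k z + 1) * (2 - (k z + 1)) := by ring
      rw [this, norm_mul]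
      have h5 : ‖2 - (k z + 1)‖ ≤ 2 + ‖k z + 1‖ := (norm_sub_le _ _).trans (by simp)
      nlinarith [norm_nonneg (k z + 1), norm_nonneg (2 - (k z + 1))]
    have h4 : h z ∈ ball (0 : ℂ) ‖w‖ := by
      rw [mem_ball_zero_iff, h2, norm_mul]
      nlinarith
    have h6 := hpos _ h4
    rw [hg hz] at h6
    have h7 := Complex.re_le_norm (k z + 1)
    simp at h7
    linarith
  have hne1 : ∀ z ∈ ball (0 : ℂ) 1, k z + 1 ≠ 0 := fun z hz hcon => by
    have := homit z hz
    rw [hcon, norm_zero] at this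
    norm_num at this
  -- As `m = 1 - 2/(k+1)`, it is bounded by `1 + 5 = 6`, and Schwarz gives `|m z| ≤ 6|z| ≤ 1/2`.
  -- Solving for `h` yields `h = -4wm/(1-m)²`, hence the bound `4 · 2 · (1/2) / (1/4) = 16`.
  set m : ℂ → ℂ := fun z => (k z - 1) / (k z + 1) with hm
  have hmd : DifferentiableOn ℂ m (ball 0 1) := (hkd.sub_const 1).div (hkd.add_const 1) hne1
  have hm0 : m 0 = 0 := by simp [hm, hk0]
  have hmaps : MapsTo m (ball 0 1) (closedBall (m 0) 6) := by
    intro z hz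
    rw [hm0, mem_closedBall_zero_iff]
    have : m z = 1 - 2 / (k z + 1) := by
      have := hne1 z hz
      simp only [hm]
      field_simp
      ring
    rw [this]
    refine (norm_sub_le _ _).trans ?_
    rw [norm_div, norm_one]
    have h2 : ‖(2 : ℂ)‖ / ‖k z + 1‖ ≤ 5 := by
      rw [Complex.norm_ofNat, div_le_iff₀ (by linarith [homit z hz])]
      linarith [homit z hz]
    linarith
  have hz1 : z ∈ ball (0 : ℂ) 1 := by
    rw [mem_ball_zero_iff]
    linarith
  have hmz : ‖m z‖ ≤ 1 / 2 := by
    have := Complex.dist_le_div_mul_dist_of_mapsTo_ball hmd hmaps hz1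
    rw [hm0, dist_zero_right, dist_zero_right] at this
    linarith
  have hform : h z * (1 - m z) ^ 2 = -4 * w * m z := by
    have h2 : h z = w * (1 - k z ^ 2) := by
      rw [hk2 z hz1]
      field_simp
      ring
    have := hne1 z hz1
    rw [h2]
    simp only [hm]
    field_simp
    ring
  have hlow : 1 / 2 ≤ ‖1 - m z‖ := by
    have := norm_sub_norm_le (1 : ℂ) (m z)
    rw [norm_one] at this
    linarith
  have hnorm := congrArg norm hform
  rw [norm_mul, norm_pow, norm_mul, norm_mul, norm_neg, Complex.norm_ofNat] at hnorm
  have h8 : ‖h z‖ * (1 / 4) ≤ ‖h z‖ * ‖1 - m z‖ ^ 2 :=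
    mul_le_mul_of_nonneg_left (by nlinarith) (norm_nonneg _)
  nlinarith [norm_nonneg (m z), norm_nonneg w]

/-- The constant in the distortion theorem below. -/
def koebeConst : ℝ := 4608

theorem koebeConst_pos : 0 < koebeConst := by norm_num [koebeConst]

/-- A weak form of the Bieberbach inequality for the second coefficient. -/
theorem norm_deriv_deriv_le_of_injOn_ball {f : ℂ → ℂ} {c : ℂ} {r : ℝ} (hr : 0 < r)
    (hd : DifferentiableOn ℂ f (ball c r)) (hi : InjOn f (ball c r)) :
    ‖deriv (deriv f) c‖ * r ≤ koebeConst * ‖deriv f c‖ := by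
  have hc : c ∈ ball c r := mem_ball_self hr
  have hne := deriv_ne_zero_of_injOn isOpen_ball hd hi hc
  have hrc : (r : ℂ) ≠ 0 := by exact_mod_cast hr.ne'
  set A : ℂ := (r * deriv f c)⁻¹ with hA
  have hA0 : A ≠ 0 := inv_ne_zero (mul_ne_zero hrc hne)
  set h : ℂ → ℂ := fun z => A * (f (c + r * z) - f c) with hh
  have hmem : ∀ z ∈ ball (0 : ℂ) 1, c + r * z ∈ ball c r := by
    intro z hz
    rw [mem_ball_zero_iff] at hz
    simp only [mem_ball, dist_self_add_left, norm_mul, Complex.norm_real, Real.norm_eq_abs,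
      abs_of_pos hr]
    nlinarith
  have hin : ∀ z, HasDerivAt (fun z : ℂ => c + r * z) r z := fun z => by
    simpa using ((hasDerivAt_id z).const_mul (r : ℂ)).const_add c
  have hder : ∀ z ∈ ball (0 : ℂ) 1, HasDerivAt h (A * (deriv f (c + r * z) * r)) z := by
    intro z hz
    exact (((hd.differentiableAt (isOpen_ball.mem_nhds (hmem z hz))).hasDerivAt.comp z
      (hin z)).sub_const _).const_mul A
  have m0 : (0 : ℂ) ∈ ball (0 : ℂ) 1 := mem_ball_self one_pos
  have hhd : DifferentiableOn ℂ h (ball 0 1) := fun z hz =>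
    (hder z hz).differentiableAt.differentiableWithinAt
  have hhi : InjOn h (ball 0 1) := by
    intro z hz z' hz' heq
    have h1 := mul_left_cancel₀ hA0 heq
    have h2 := hi (hmem z hz) (hmem z' hz') (sub_left_injective h1)
    exact mul_left_cancel₀ hrc (add_left_cancel h2)
  have h1 : deriv h 0 = 1 := by
    rw [(hder 0 m0).deriv, hA]
    simp only [mul_zero, add_zero]
    field_simp
  have hbound : ∀ z ∈ sphere (0 : ℂ) (1 / 12), ‖h z‖ ≤ 16 := fun z hz =>
    norm_le_of_univalent hhd hhi (by simp [hh]) h1 (by simpa using (mem_sphere_zero_iff_norm.1 hz).le)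
  have hcl : DiffContOnCl ℂ h (ball 0 (1 / 12)) :=
    (hhd.mono (closedBall_subset_ball (by norm_num))).diffContOnCl_ball Subset.rfl
  -- Cauchy's estimate on the circle of radius `1/12` gives `2! · 16 · 12² = 4608`.
  have hC := Complex.norm_iteratedDeriv_le_of_forall_mem_sphere_norm_le 2 (by norm_num) hcl hbound
  rw [iteratedDeriv_succ, iteratedDeriv_one] at hC
  have h2 : deriv (deriv h) 0 = A * (deriv (deriv f) c * r * r) := by
    have heq : deriv h =ᶠ[𝓝 0] fun z => A * (deriv f (c + r * z) * r) := by
      filter_upwards [isOpen_ball.mem_nhds m0] with z hz using (hder z hz).deriv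
    rw [heq.deriv_eq]
    have hdd : HasDerivAt (deriv f) (deriv (deriv f) c) (c + r * 0) := by
      simpa using ((hd.deriv isOpen_ball).differentiableAt (isOpen_ball.mem_nhds hc)).hasDerivAt
    exact (((hdd.comp 0 (hin 0)).mul_const _).const_mul A).deriv
  rw [h2, hA, norm_mul, norm_inv, norm_mul, norm_mul, norm_mul, Complex.norm_real,
    Real.norm_eq_abs, abs_of_pos hr] at hC
  have hnp : 0 < ‖deriv f c‖ := norm_pos_iff.2 hne
  have : (r * ‖deriv f c‖)⁻¹ * (‖deriv (deriv f) c‖ * r * r) =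
      ‖deriv (deriv f) c‖ * r / ‖deriv f c‖ := by field_simp
  rw [this, div_le_iff₀ hnp] at hC
  refine hC.trans (le_of_eq ?_)
  norm_num [koebeConst, Nat.factorial]

end Tract
end
noncomputable section
namespace Tract
open Filter Topology Set Metric

/-! ### Distortion -/

/-- Gronwall's inequality for the derivative of `f` along a curve. -/
theorem norm_deriv_le_exp_of_curve {f : ℂ → ℂ} {U : Set ℂ} (hU : IsOpen U)
    (hd : DifferentiableOn ℂ f U) {γ γ' : ℝ → ℂ} {K : ℝ}
    (hγ : ∀ u ∈ Icc (0 : ℝ) 1, HasDerivAt γ (γ' u) u) (hγU : ∀ u ∈ Icc (0 : ℝ) 1, γ u ∈ U)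
    (hK : ∀ u ∈ Icc (0 : ℝ) 1, ‖deriv (deriv f) (γ u)‖ * ‖γ' u‖ ≤ K * ‖deriv f (γ u)‖) :
    ‖deriv f (γ 1)‖ ≤ Real.exp K * ‖deriv f (γ 0)‖ := by
  have hder : ∀ u ∈ Icc (0 : ℝ) 1,
      HasDerivAt (fun u => deriv f (γ u)) (deriv (deriv f) (γ u) * γ' u) u := fun u hu =>
    (((hd.deriv hU).differentiableAt (hU.mem_nhds (hγU u hu))).hasDerivAt.comp_of_eq u
      (hγ u hu) rfl)
  have := norm_le_gronwallBound_of_norm_deriv_right_le (f := fun u => deriv f (γ u))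
    (δ := ‖deriv f (γ 0)‖) (K := K) (ε := 0) (a := 0) (b := 1)
    (fun u hu => (hder u hu).continuousAt.continuousWithinAt)
    (fun u hu => (hder u (Ico_subset_Icc_self hu)).hasDerivWithinAt) le_rfl
    (fun u hu => by simpa using hK u (Ico_subset_Icc_self hu)) 1 (right_mem_Icc.2 zero_le_one)
  rw [gronwallBound_ε0] at this
  simpa [mul_comm] using this

theorem norm_deriv_deriv_le_of_ball_subset {f : ℂ → ℂ} {U : Set ℂ}
    (hd : DifferentiableOn ℂ f U) (hi : InjOn f U) {z : ℂ} {m : ℝ} (hm : 0 < m)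
    (hz : ball z m ⊆ U) : ‖deriv (deriv f) z‖ ≤ koebeConst / m * ‖deriv f z‖ := by
  have := norm_deriv_deriv_le_of_injOn_ball hm (hd.mono hz) (hi.mono hz)
  rw [div_mul_eq_mul_div, le_div_iff₀ hm]
  exact this

/-- Along the segment `|f''/f'|` is at most `koebeConst / m`; Gronwall integrates this bound. -/
theorem norm_deriv_le_exp_mul {f : ℂ → ℂ} {U : Set ℂ} (hU : IsOpen U)
    (hd : DifferentiableOn ℂ f U) (hi : InjOn f U) {z w : ℂ} {m : ℝ} (hm : 0 < m)
    (h : ∀ p ∈ segment ℝ z w, ball p m ⊆ U) :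
    ‖deriv f w‖ ≤ Real.exp (koebeConst / m * ‖w - z‖) * ‖deriv f z‖ := by
  have hseg : ∀ u ∈ Icc (0 : ℝ) 1, z + u * (w - z) ∈ segment ℝ z w := by
    intro u hu
    rw [segment_eq_image']
    exact ⟨u, hu, by simp⟩
  have := norm_deriv_le_exp_of_curve hU hd (γ := fun u : ℝ => z + u * (w - z))
    (γ' := fun _ => w - z) (K := koebeConst / m * ‖w - z‖)
    (fun u _ => by
      have h1 : HasDerivAt (fun u : ℝ => (u : ℂ)) 1 u := Complex.ofRealCLM.hasDerivAt
      simpa using (h1.mul_const (w - z)).const_add z)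
    (fun u hu => h _ (hseg u hu) (mem_ball_self hm))
    (fun u hu => by
      have := norm_deriv_deriv_le_of_ball_subset hd hi hm (h _ (hseg u hu))
      calc _ ≤ koebeConst / m * ‖deriv f (z + u * (w - z))‖ * ‖w - z‖ := by gcongr
        _ = _ := by ring)
  simpa using this

/-- On a small concentric disk, a univalent function is close to its linear part. -/
theorem norm_sub_sub_le_of_injOn_ball {f : ℂ → ℂ} {c : ℂ} {r : ℝ} (hr : 0 < r)
    (hd : DifferentiableOn ℂ f (ball c r)) (hi : InjOn f (ball c r)) {z w : ℂ}
    (hz : z ∈ closedBall c (r / (8 * koebeConst))) (hw : w ∈ closedBall c (r / (8 * koebeConst))) :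
    ‖f z - f w - deriv f c * (z - w)‖ ≤ ‖deriv f c‖ / 2 * ‖z - w‖ := by
  have hK := koebeConst_pos
  have hsmall : r / (8 * koebeConst) ≤ r / 2 :=
    div_le_div_of_nonneg_left hr.le two_pos (by norm_num [koebeConst])
  have hball : ∀ p ∈ closedBall c (r / (8 * koebeConst)), ball p (r / 2) ⊆ ball c r := by
    intro p hp
    refine ball_subset_ball' ?_
    linarith [mem_closedBall.1 hp]
  have hsub : closedBall c (r / (8 * koebeConst)) ⊆ ball c r :=
    fun p hp => hball p hp (mem_ball_self (by linarith))
  have hcm : c ∈ closedBall c (r / (8 * koebeConst)) := mem_closedBall_self (by positivity)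
  have hconv := convex_closedBall c (r / (8 * koebeConst))
  have hr2 : 0 < r / 2 := by linarith
  -- The radius `r / (8 * koebeConst)` is chosen so that `f'` at most doubles, and then `f'`
  -- deviates from `f' c` by at most `(2 koebeConst / r) · 2|f' c| · r / (8 koebeConst) = |f' c| /
  -- 2`.
  have h1 : ∀ p ∈ closedBall c (r / (8 * koebeConst)), ‖deriv f p‖ ≤ 2 * ‖deriv f c‖ := by
    intro p hp
    have h := norm_deriv_le_exp_mul isOpen_ball hd hi hr2
      (fun q hq => hball q (hconv.segment_subset hcm hp hq))
    refine h.trans (mul_le_mul_of_nonneg_right ?_ (norm_nonneg _))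
    have h2 : koebeConst / (r / 2) * ‖p - c‖ ≤ 1 / 4 := by
      rw [mem_closedBall, dist_eq_norm] at hp
      calc _ ≤ koebeConst / (r / 2) * (r / (8 * koebeConst)) := by gcongr
        _ = 1 / 4 := by field_simp; norm_num
    have h3 : Real.exp (1 / 4) ≤ 2 := by
      have := Real.exp_bound_div_one_sub_of_interval (x := 1 / 4) (by norm_num) (by norm_num)
      linarith
    exact (Real.exp_le_exp.2 h2).trans h3
  have h2 : ∀ p ∈ closedBall c (r / (8 * koebeConst)),
      ‖deriv f p - deriv f c‖ ≤ ‖deriv f c‖ / 2 := by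
    intro p hp
    have h := hconv.norm_image_sub_le_of_norm_deriv_le (f := deriv f)
      (C := koebeConst / (r / 2) * (2 * ‖deriv f c‖))
      (fun x hx => (hd.deriv isOpen_ball).differentiableAt (isOpen_ball.mem_nhds (hsub hx)))
      (fun x hx => (norm_deriv_deriv_le_of_ball_subset hd hi hr2 (hball x hx)).trans
        (mul_le_mul_of_nonneg_left (h1 x hx) (by positivity))) hcm hp
    rw [mem_closedBall, dist_eq_norm] at hp
    calc _ ≤ koebeConst / (r / 2) * (2 * ‖deriv f c‖) * ‖p - c‖ := h
      _ ≤ koebeConst / (r / 2) * (2 * ‖deriv f c‖) * (r / (8 * koebeConst)) := by gcongr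
      _ = ‖deriv f c‖ / 2 := by field_simp; ring
  have hder : ∀ p ∈ closedBall c (r / (8 * koebeConst)),
      HasDerivAt (fun z => f z - deriv f c * z) (deriv f p - deriv f c) p := by
    intro p hp
    have h := (hd.differentiableAt (isOpen_ball.mem_nhds (hsub hp))).hasDerivAt.sub
      ((hasDerivAt_id p).const_mul (deriv f c))
    rw [mul_one] at h
    exact h
  have h3 := hconv.norm_image_sub_le_of_norm_deriv_le (f := fun z => f z - deriv f c * z)
    (fun p hp => (hder p hp).differentiableAt)
    (fun p hp => by rw [(hder p hp).deriv]; exact h2 p hp) hw hz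
  have h4 : f z - f w - deriv f c * (z - w) = f z - deriv f c * z - (f w - deriv f c * w) := by ring
  rw [h4]
  exact h3

theorem le_norm_sub_of_injOn_ball {f : ℂ → ℂ} {c : ℂ} {r : ℝ} (hr : 0 < r)
    (hd : DifferentiableOn ℂ f (ball c r)) (hi : InjOn f (ball c r)) {z w : ℂ}
    (hz : z ∈ closedBall c (r / (8 * koebeConst))) (hw : w ∈ closedBall c (r / (8 * koebeConst))) :
    ‖deriv f c‖ / 2 * ‖z - w‖ ≤ ‖f z - f w‖ := by
  have h := norm_sub_sub_le_of_injOn_ball hr hd hi hz hw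
  have h1 := norm_sub_norm_le (deriv f c * (z - w)) (f z - f w)
  rw [norm_sub_rev (deriv f c * (z - w)), norm_mul] at h1
  linarith

theorem norm_sub_le_of_injOn_ball {f : ℂ → ℂ} {c : ℂ} {r : ℝ} (hr : 0 < r)
    (hd : DifferentiableOn ℂ f (ball c r)) (hi : InjOn f (ball c r)) {z w : ℂ}
    (hz : z ∈ closedBall c (r / (8 * koebeConst))) (hw : w ∈ closedBall c (r / (8 * koebeConst))) :
    ‖f z - f w‖ ≤ 2 * ‖deriv f c‖ * ‖z - w‖ := by
  have h := norm_sub_sub_le_of_injOn_ball hr hd hi hz hw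
  have h1 := norm_sub_norm_le (f z - f w) (deriv f c * (z - w))
  rw [norm_mul] at h1
  nlinarith [norm_nonneg (deriv f c), norm_nonneg (z - w),
    mul_nonneg (norm_nonneg (deriv f c)) (norm_nonneg (z - w))]

/-! ### Distortion in the half plane. -/

theorem isOpen_halfPlane : IsOpen halfPlane := isOpen_lt continuous_const Complex.continuous_re

theorem ball_subset_halfPlane {z : ℂ} {m : ℝ} (hm : m ≤ z.re) : ball z m ⊆ halfPlane := by
  intro w hw
  rw [mem_ball, dist_eq_norm] at hw
  have := (Complex.abs_re_le_norm (w - z)).trans_lt hw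
  rw [Complex.sub_re, abs_lt] at this
  show 0 < w.re
  linarith

theorem norm_deriv_le_exp_mul_of_le_re {f : ℂ → ℂ} (hd : DifferentiableOn ℂ f halfPlane)
    (hi : InjOn f halfPlane) {z w : ℂ} {m : ℝ} (hm : 0 < m) (hz : m ≤ z.re) (hw : m ≤ w.re) :
    ‖deriv f w‖ ≤ Real.exp (koebeConst / m * ‖w - z‖) * ‖deriv f z‖ := by
  refine norm_deriv_le_exp_mul isOpen_halfPlane hd hi hm fun p hp => ball_subset_halfPlane ?_
  have hconv : Convex ℝ {p : ℂ | m ≤ p.re} := convex_halfSpace_re_ge m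
  exact hconv.segment_subset hz hw hp

/-- The distortion of a univalent function along horizontal lines. -/
theorem norm_deriv_le_rpow_mul {f : ℂ → ℂ} (hd : DifferentiableOn ℂ f halfPlane)
    (hi : InjOn f halfPlane) {x s y : ℝ} (hx : 0 < x) (hs : 0 < s) :
    ‖deriv f (x + y * Complex.I)‖ ≤
      Real.exp (koebeConst * |Real.log (x / s)|) * ‖deriv f (s + y * Complex.I)‖ := by
  set l := Real.log (x / s) with hl
  -- The curve `s exp(ul) + iy` has `|γ'| = |l| Re γ`, so the bound `koebeConst / Re γ` on
  -- `|f''/f'|` integrates to `koebeConst |log (x/s)|`: the loss is a power of `x/s`.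
  have key := norm_deriv_le_exp_of_curve isOpen_halfPlane hd
    (γ := fun u : ℝ => ((s * Real.exp (u * l) : ℝ) : ℂ) + y * Complex.I)
    (γ' := fun u => ((s * (Real.exp (u * l) * l) : ℝ) : ℂ)) (K := koebeConst * |l|)
    (fun u _ => by
      have h1 : HasDerivAt (fun u : ℝ => s * Real.exp (u * l)) (s * (Real.exp (u * l) * l)) u := by
        simpa using (((hasDerivAt_id u).mul_const l).exp).const_mul s
      exact h1.ofReal_comp.add_const _)
    (fun u _ => by
      show 0 < Complex.re _
      simp only [Complex.add_re, Complex.ofReal_re, Complex.mul_re, Complex.I_re, Complex.I_im,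
        Complex.ofReal_im]
      have := mul_pos hs (Real.exp_pos (u * l))
      linarith)
    (fun u _ => by
      have hpos := mul_pos hs (Real.exp_pos (u * l))
      have := norm_deriv_deriv_le_of_ball_subset hd hi (m := s * Real.exp (u * l)) hpos
        (ball_subset_halfPlane (z := ((s * Real.exp (u * l) : ℝ) : ℂ) + y * Complex.I)
          (by simp [-Complex.ofReal_mul]))
      rw [Complex.norm_real, Real.norm_eq_abs, ← mul_assoc, abs_mul, abs_of_pos hpos]
      calc _ ≤ koebeConst / (s * Real.exp (u * l)) *
            ‖deriv f (((s * Real.exp (u * l) : ℝ) : ℂ) + y * Complex.I)‖ *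
            (s * Real.exp (u * l) * |l|) := by gcongr
        _ = _ := by field_simp)
  have h1 : s * Real.exp (1 * l) = x := by
    rw [one_mul, hl, Real.exp_log (div_pos hx hs)]
    field_simp
  have h0 : s * Real.exp (0 * l) = s := by simp
  simp only [h1, h0] at key
  exact key

end Tract
end
noncomputable section
namespace Tract
open Filter Topology Set Metric

/-! ### Regularity of Hölder tracts -/

/-- The estimates on the conformal map of a Hölder tract that are used below. They are stated on
`{Re ξ ≥ x}` in order to be independent of the level. -/
structure RegularTract (φ : ℂ → ℂ) (α x C T₁ : ℝ) : Prop where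
  holo : DifferentiableOn ℂ φ halfPlane
  inj : InjOn φ halfPlane
  one_le_x : 1 ≤ x
  one_le_C : 1 ≤ C
  le_T₁ : 16 * x ≤ T₁
  tendsto : Tendsto (fun T : ℝ => ‖φ T‖) atTop atTop
  norm_pos : ∀ T ≥ T₁, 0 < ‖φ (T : ℂ)‖
  osc : ∀ T ≥ T₁, ∀ ξ : ℂ, x ≤ ξ.re → ξ.re ≤ 3 * T → |ξ.im| ≤ 3 * T →
    (3 * T / 4 ≤ ξ.re ∨ 3 * T / 4 ≤ |ξ.im|) →
    ‖φ ξ‖ ≤ C * ‖φ (T : ℂ)‖ ∧ ‖φ (T : ℂ)‖ ≤ C * ‖φ ξ‖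
  deriv_le : ∀ T ≥ T₁, ∀ y : ℝ, T ≤ |y| → |y| ≤ 2 * T →
    ‖deriv φ (x + y * Complex.I)‖ * T ^ α ≤ C * ‖φ (T : ℂ)‖
  le_deriv : ∀ T ≥ T₁, ‖φ (T : ℂ)‖ ≤ C * (T * ‖deriv φ (T : ℂ)‖)

/-- The bounds `3T` and `3T/4` leave room for a translation by `|c| ≤ T/8`: `3T + T/8 < 4T` and
`3T/4 - T/8 > T/2`, the size of `Q_{T/8}`. -/
theorem add_mem_rect_diff {T : ℝ} {ξ c : ℂ} (hT : 8 * ‖c‖ ≤ T) (hT0 : 0 < T)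
    (hpos : 0 < (ξ + c).re) (h1 : ξ.re ≤ 3 * T) (h2 : |ξ.im| ≤ 3 * T)
    (h3 : 3 * T / 4 ≤ ξ.re ∨ 3 * T / 4 ≤ |ξ.im|) : ξ + c ∈ rect T \ rect (T / 8) := by
  have hr := abs_le.1 ((Complex.abs_re_le_norm c))
  have hi := abs_le.1 ((Complex.abs_im_le_norm c))
  have h2' := abs_le.1 h2
  simp only [Complex.add_re] at hpos
  simp only [rect, Set.mem_sdiff, mem_ofPred_eq, Complex.add_re, Complex.add_im, not_and, not_lt]
  refine ⟨⟨hpos, by linarith, by linarith, by linarith⟩, fun _ h5 h6 => ?_⟩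
  rcases h3 with h3 | h3
  · linarith
  · rcases le_abs.1 h3 with h | h <;> linarith

theorem add_mem_rect {T : ℝ} {ξ c : ℂ} (hT : 8 * ‖c‖ ≤ T) (hT0 : 0 < T)
    (hpos : 0 < (ξ + c).re) (h1 : ξ.re ≤ 3 * T) (h2 : |ξ.im| ≤ 3 * T) : ξ + c ∈ rect T := by
  have hr := abs_le.1 ((Complex.abs_re_le_norm c))
  have hi := abs_le.1 ((Complex.abs_im_le_norm c))
  have h2' := abs_le.1 h2
  simp only [Complex.add_re] at hpos
  simp only [rect, mem_ofPred_eq, Complex.add_re, Complex.add_im]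
  exact ⟨hpos, by linarith, by linarith, by linarith⟩

/-- The Hölder condition in the original scale. -/
theorem IsHolderOnRect.norm_sub_le {H α T : ℝ} {ψ : ℂ → ℂ} (hT : 0 < T)
    (h : IsHolderOnRect H α (fun z => ψ ((T : ℂ) * z))) {ξ₁ ξ₂ : ℂ} (h₁ : ξ₁ ∈ rect T)
    (h₂ : ξ₂ ∈ rect T) :
    ‖ψ ξ₁ - ψ ξ₂‖ ≤ H * (T * ‖deriv ψ T‖) * (‖ξ₁ - ξ₂‖ / T) ^ α := by
  have hTc : (T : ℂ) ≠ 0 := by exact_mod_cast hT.ne'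
  have hmem : ∀ ξ ∈ rect T, ξ / T ∈ rect 1 := by
    rintro ξ ⟨a, b, c, d⟩
    simp only [rect, mem_ofPred_eq, Complex.div_ofReal_re, Complex.div_ofReal_im]
    refine ⟨div_pos a hT, ?_, ?_, ?_⟩
    · rw [div_lt_iff₀ hT]; linarith
    · rw [lt_div_iff₀ hT]; linarith
    · rw [div_lt_iff₀ hT]; linarith
  have := h _ (hmem _ h₁) _ (hmem _ h₂)
  rw [deriv_comp_mul_left] at this
  simp only [mul_div_cancel₀ _ hTc, mul_one, smul_eq_mul, norm_mul, Complex.norm_real,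
    Real.norm_eq_abs, abs_of_pos hT, ← sub_div, norm_div] at this
  exact this

/-- The Hölder hypothesis concerns `ψ`, possibly from another level, and `φ` is a translate of it
far to the right. Oscillation transfers directly. The bound on `φ'` near `Re ξ = x` is Cauchy's
estimate on unit disks, where the Hölder condition at scale `T` bounds the increments by a multiple
of `|φ(T)| T^(-α)`. The lower bound on `φ'(T)` is the Hölder condition for the points `T + c` and
`1`. -/
theorem exists_regularTract {φ ψ : ℂ → ℂ} {α H x₀ : ℝ} {c : ℂ}
    (hα : 0 < α) (hα1 : α ≤ 1) (hφ : DifferentiableOn ℂ φ halfPlane) (hφi : InjOn φ halfPlane)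
    (hψ : DifferentiableOn ℂ ψ halfPlane)
    (htend : Tendsto (fun T : ℝ => ‖φ T‖) atTop atTop)
    (hpos : ∀ ξ : ℂ, x₀ ≤ ξ.re → 0 < (ξ + c).re)
    (heq : ∀ ξ : ℂ, x₀ ≤ ξ.re → φ ξ = ψ (ξ + c)) (hH : IsHolderTract H α ψ) :
    ∃ x C T₁, RegularTract φ α x C T₁ := by
  obtain ⟨⟨M, hM, T₂, hT₂, hosc⟩, T₀, hT₀, hhol⟩ := hH
  set x : ℝ := max x₀ 1 + 1 with hx
  have hx0 : x₀ ≤ x - 1 := by rw [hx, add_sub_cancel_right]; exact le_max_left _ _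
  have hx1 : 1 ≤ x - 1 := by rw [hx, add_sub_cancel_right]; exact le_max_right _ _
  set B := ‖c‖ with hB
  have hB0 : 0 ≤ B := norm_nonneg c
  set H' := max H 1 with hH'
  have hH'1 : 1 ≤ H' := le_max_right _ _
  set A := H' * (4 * M ^ 2) with hA
  have hA0 : 0 ≤ A := by positivity
  set E := Real.exp (koebeConst / 1 * B) with hE
  obtain ⟨T₃, hT₃⟩ := eventually_atTop.1 (htend.eventually_ge_atTop (2 * ‖ψ 1‖ + 1))
  set C := max (max M 1) (max A (6 * H' * E)) with hC
  set T₁ := max (max T₂ T₀) (max (16 * x + 8 * B) T₃) with hT₁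
  have hTs : ∀ T ≥ T₁, T₂ ≤ T ∧ T₀ ≤ T ∧ 16 * x + 8 * B ≤ T ∧ T₃ ≤ T := fun T hT =>
    ⟨(le_max_left _ _).trans ((le_max_left _ _).trans hT),
      (le_max_right _ _).trans ((le_max_left _ _).trans hT),
      (le_max_left _ _).trans ((le_max_right _ _).trans hT),
      (le_max_right _ _).trans ((le_max_right _ _).trans hT)⟩
  have hoscφ : ∀ T ≥ T₁, ∀ ξ : ℂ, x₀ ≤ ξ.re → ξ.re ≤ 3 * T → |ξ.im| ≤ 3 * T →
      (3 * T / 4 ≤ ξ.re ∨ 3 * T / 4 ≤ |ξ.im|) →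
      ‖φ ξ‖ ≤ M * ‖φ (T : ℂ)‖ ∧ ‖φ (T : ℂ)‖ ≤ M * ‖φ ξ‖ := by
    intro T hT ξ h0 h1 h2 h3
    obtain ⟨ha, -, hb, -⟩ := hTs T hT
    have hTpos : 0 < T := by linarith
    have hTx : x₀ ≤ (T : ℂ).re := by rw [Complex.ofReal_re]; linarith
    have m1 := add_mem_rect_diff (by linarith) hTpos (hpos ξ h0) h1 h2 h3
    have m2 := add_mem_rect_diff (ξ := (T : ℂ)) (T := T) (c := c) (by linarith) hTpos
      (hpos T hTx) (by simp; linarith) (by simp; linarith) (Or.inl (by simp; linarith))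
    rw [heq ξ h0, heq T hTx]
    exact ⟨hosc T ha _ m1 _ m2, hosc T ha _ m2 _ m1⟩
  -- Cauchy's estimate on the circle of radius `T/4` about `T` replaces the normalization `|g'(1)| =
  -- T|ψ'(T)|` by `|φ(T)|`.
  have hDψ : ∀ T ≥ T₁, T * ‖deriv ψ T‖ ≤ 4 * M ^ 2 * ‖φ T‖ := by
    intro T hT
    obtain ⟨ha, -, hb, -⟩ := hTs T hT
    have hTpos : 0 < T := by linarith
    have hTx : x₀ ≤ (T : ℂ).re := by rw [Complex.ofReal_re]; linarith
    have m2 := add_mem_rect_diff (ξ := (T : ℂ)) (T := T) (c := c) (by linarith) hTpos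
      (hpos T hTx) (by simp; linarith) (by simp; linarith) (Or.inl (by simp; linarith))
    have hcl : closedBall (T : ℂ) (T / 4) ⊆ halfPlane :=
      (closedBall_subset_ball (by linarith)).trans
        (ball_subset_halfPlane (z := (T : ℂ)) (m := T) (by simp))
    have hsph : ∀ ξ ∈ sphere (T : ℂ) (T / 4), ‖ψ ξ‖ ≤ M * (M * ‖φ T‖) := by
      intro ξ hξ
      have h1 := abs_le.1 ((Complex.abs_re_le_norm (ξ - T)))
      have h2 := (Complex.abs_im_le_norm (ξ - T))
      rw [mem_sphere, dist_eq_norm] at hξ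
      rw [hξ] at h1 h2
      simp only [Complex.sub_re, Complex.sub_im, Complex.ofReal_re, Complex.ofReal_im,
        sub_zero] at h1 h2
      have m1 := add_mem_rect_diff (ξ := ξ) (T := T) (c := 0) (by simpa using hTpos.le) hTpos
        (by simp; linarith) (by linarith) (by linarith) (Or.inl (by linarith))
      rw [add_zero] at m1
      have m3 := hosc T ha _ m1 _ m2
      rw [← heq T hTx] at m3
      refine m3.trans ?_
      -- Compare a point of nonzero value with itself.
      have hM1 : 1 ≤ M := by
        have := hosc T ha _ m2 _ m2
        rw [← heq T hTx] at this
        have hp : 0 < ‖φ T‖ := by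
          have := hT₃ T (hTs T hT).2.2.2
          have := norm_nonneg (ψ 1)
          linarith
        by_contra! hcon
        nlinarith
      have := norm_nonneg (φ T)
      nlinarith [mul_nonneg hM.le this]
    have := Complex.norm_deriv_le_of_forall_mem_sphere_norm_le (by linarith : 0 < T / 4)
      ((hψ.mono hcl).diffContOnCl_ball Subset.rfl) hsph
    rw [le_div_iff₀ (by linarith)] at this
    nlinarith
  have hholφ : ∀ T ≥ T₁, ∀ ξ₁ ξ₂ : ℂ, x₀ ≤ ξ₁.re → x₀ ≤ ξ₂.re → ξ₁.re ≤ 3 * T → ξ₂.re ≤ 3 * T →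
      |ξ₁.im| ≤ 3 * T → |ξ₂.im| ≤ 3 * T →
      ‖φ ξ₁ - φ ξ₂‖ ≤ A * ‖φ T‖ * (‖ξ₁ - ξ₂‖ / T) ^ α := by
    intro T hT ξ₁ ξ₂ h1 h2 h3 h4 h5 h6
    obtain ⟨-, ha, hb, -⟩ := hTs T hT
    have hTpos : 0 < T := by linarith
    have m1 := add_mem_rect (by linarith) hTpos (hpos ξ₁ h1) h3 h5
    have m2 := add_mem_rect (by linarith) hTpos (hpos ξ₂ h2) h4 h6
    have := (hhol T ha).norm_sub_le hTpos m1 m2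
    rw [← heq _ h1, ← heq _ h2, add_sub_add_right_eq_sub] at this
    refine this.trans ?_
    refine mul_le_mul_of_nonneg_right ?_ (by positivity)
    calc H * (T * ‖deriv ψ T‖) ≤ H' * (T * ‖deriv ψ T‖) :=
          mul_le_mul_of_nonneg_right (le_max_left _ _) (by positivity)
      _ ≤ H' * (4 * M ^ 2 * ‖φ T‖) := mul_le_mul_of_nonneg_left (hDψ T hT) (by linarith)
      _ = _ := by rw [hA]; ring
  have hMC : M ≤ C := (le_max_left _ _).trans (le_max_left _ _)
  have hAC : A ≤ C := (le_max_left _ _).trans (le_max_right _ _)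
  have hEC : 6 * H' * E ≤ C := (le_max_right _ _).trans (le_max_right _ _)
  refine ⟨x, C, T₁, hφ, hφi, by linarith, (le_max_right _ _).trans (le_max_left _ _), ?_, htend,
    ?_, ?_, ?_, ?_⟩
  · linarith [(hTs T₁ le_rfl).2.2.1]
  · intro T hT
    linarith [hT₃ T (hTs T hT).2.2.2, norm_nonneg (ψ 1)]
  · intro T hT ξ h0 h1 h2 h3
    have := hoscφ T hT ξ (by linarith) h1 h2 h3
    exact ⟨this.1.trans (by gcongr), this.2.trans (by gcongr)⟩
  · intro T hT y hy1 hy2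
    obtain ⟨-, -, hb, -⟩ := hTs T hT
    have hTpos : 0 < T := by linarith
    set ξ : ℂ := x + y * Complex.I with hξ
    have hre : ξ.re = x := by simp [hξ]
    have him : ξ.im = y := by simp [hξ]
    have hcl : closedBall ξ 1 ⊆ halfPlane :=
      (closedBall_subset_ball (by linarith)).trans (ball_subset_halfPlane (z := ξ) hre.ge)
    have hsph : ∀ ζ ∈ sphere ξ 1, ‖φ ζ - φ ξ‖ ≤ A * ‖φ T‖ * (1 / T) ^ α := by
      intro ζ hζ
      have h1 := abs_le.1 ((Complex.abs_re_le_norm (ζ - ξ)))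
      have h2 := (Complex.abs_im_le_norm (ζ - ξ))
      rw [mem_sphere, dist_eq_norm] at hζ
      rw [hζ] at h1 h2
      simp only [Complex.sub_re, Complex.sub_im, hre, him] at h1 h2
      have h3 := abs_sub_abs_le_abs_sub ζ.im y
      have := hholφ T hT ζ ξ (by linarith) (by rw [hre]; linarith) (by linarith)
        (by rw [hre]; linarith) (by linarith) (by rw [him]; linarith)
      rwa [hζ] at this
    have := Complex.norm_deriv_le_of_forall_mem_sphere_norm_le one_pos
      (((hφ.sub_const (φ ξ)).mono hcl).diffContOnCl_ball Subset.rfl) hsph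
    rw [deriv_sub_const, div_one] at this
    calc ‖deriv φ ξ‖ * T ^ α ≤ A * ‖φ T‖ * (1 / T) ^ α * T ^ α := by gcongr
      _ = A * ‖φ T‖ := by
        rw [mul_assoc, ← Real.mul_rpow (by positivity) hTpos.le, one_div_mul_cancel hTpos.ne',
          Real.one_rpow, mul_one]
      _ ≤ C * ‖φ T‖ := by gcongr
  · intro T hT
    obtain ⟨-, ha, hb, hc⟩ := hTs T hT
    have hTpos : 0 < T := by linarith
    have hTx : x₀ ≤ (T : ℂ).re := by rw [Complex.ofReal_re]; linarith
    have m1 := add_mem_rect (ξ := (T : ℂ)) (T := T) (c := c) (by linarith) hTpos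
      (hpos T hTx) (by simp; linarith) (by simp; linarith)
    have m2 := add_mem_rect (ξ := (1 : ℂ)) (T := T) (c := 0) (by simpa using hTpos.le) hTpos
      (by simp) (by simp; linarith) (by simp; linarith)
    rw [add_zero] at m2
    have h1 := (hhol T ha).norm_sub_le hTpos m1 m2
    rw [← heq T hTx] at h1
    have h2 : (‖(T : ℂ) + c - 1‖ / T) ^ α ≤ 3 := by
      have h3 : ‖(T : ℂ) + c - 1‖ / T ≤ 3 := by
        rw [div_le_iff₀ hTpos]
        have h4 := norm_sub_le ((T : ℂ) + c) 1
        have h5 := norm_add_le (T : ℂ) c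
        rw [Complex.norm_real, Real.norm_eq_abs, abs_of_pos hTpos] at h5
        rw [norm_one] at h4
        linarith
      calc _ ≤ (3 : ℝ) ^ α := Real.rpow_le_rpow (by positivity) h3 hα.le
        _ ≤ (3 : ℝ) ^ (1 : ℝ) := Real.rpow_le_rpow_of_exponent_le (by norm_num) hα1
        _ = 3 := Real.rpow_one 3
    have h3 := norm_sub_norm_le (φ T) (ψ 1)
    have h4 := hT₃ T hc
    have h5 : H * (T * ‖deriv ψ T‖) * (‖(T : ℂ) + c - 1‖ / T) ^ α ≤
        H' * (T * ‖deriv ψ T‖) * 3 := by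
      refine mul_le_mul (mul_le_mul_of_nonneg_right (le_max_left _ _) (by positivity)) h2
        (by positivity) (by positivity)
    -- The point `T - c` is at bounded distance from `T`, so distortion returns to `φ'(T)` at the
    -- cost of the factor `E`.
    have h6 : deriv ψ T = deriv φ (T - c) := by
      have hre : x₀ < ((T : ℂ) - c).re := by
        have := (abs_le.1 (Complex.abs_re_le_norm c)).2
        simp only [Complex.sub_re, Complex.ofReal_re]
        linarith
      have hev : φ =ᶠ[𝓝 ((T : ℂ) - c)] fun ξ => ψ (ξ + c) := by
        filter_upwards [(isOpen_lt continuous_const Complex.continuous_re).mem_nhds hre]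
          with ξ hξ using heq ξ (le_of_lt hξ)
      rw [hev.deriv_eq, deriv_comp_add_const, sub_add_cancel]
    have h7 := norm_deriv_le_exp_mul_of_le_re hφ hφi one_pos (z := (T : ℂ)) (w := T - c)
      (by simp; linarith)
      (by
        have := (abs_le.1 (Complex.abs_re_le_norm c)).2
        simp only [Complex.sub_re, Complex.ofReal_re]
        linarith)
    rw [← h6, sub_sub_cancel_left, norm_neg] at h7
    have h8 : ‖φ T‖ ≤ 6 * H' * (T * ‖deriv ψ T‖) := by linarith
    calc ‖φ T‖ ≤ 6 * H' * (T * ‖deriv ψ T‖) := h8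
      _ ≤ 6 * H' * (T * (E * ‖deriv φ T‖)) := by gcongr
      _ = 6 * H' * E * (T * ‖deriv φ T‖) := by ring
      _ ≤ C * (T * ‖deriv φ T‖) := by gcongr

end Tract
end
noncomputable section
namespace Tract
open Filter Topology Set Metric

/-! ### Length of the image of a segment -/

/-- A two constants theorem: a function that is small on one side of a square is small at the
center. -/
theorem norm_pow_four_le_of_square {k : ℂ → ℂ} {c : ℂ} {a B l : ℝ} (ha : 0 < a)
    (hd : ∀ u : ℂ, |u.re| ≤ a → |u.im| ≤ a → DifferentiableAt ℂ k (c + u))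
    (hB : ∀ u : ℂ, |u.re| ≤ a → |u.im| ≤ a → ‖k (c + u)‖ ≤ B)
    (hl : ∀ u : ℂ, u.re = -a → |u.im| ≤ a → ‖k (c + u)‖ ≤ l) : ‖k c‖ ^ 4 ≤ l * B ^ 3 := by
  -- The product over the four quarter turns about `c`: on every side of the square one factor is at
  -- most `l` and the others at most `B`, so the maximum principle bounds `P 0 = k(c)⁴`.
  set P : ℂ → ℂ := fun u =>
    k (c + u) * k (c + Complex.I * u) * k (c + -u) * k (c + -(Complex.I * u)) with hP
  set U : Set ℂ := {u | |u.re| < a ∧ |u.im| < a} with hU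
  have hUo : IsOpen U :=
    (isOpen_lt Complex.continuous_re.abs continuous_const).inter
      (isOpen_lt Complex.continuous_im.abs continuous_const)
  have hcl : ∀ u ∈ closure U, |u.re| ≤ a ∧ |u.im| ≤ a := by
    have : IsClosed {u : ℂ | |u.re| ≤ a ∧ |u.im| ≤ a} :=
      (isClosed_le Complex.continuous_re.abs continuous_const).inter
        (isClosed_le Complex.continuous_im.abs continuous_const)
    have hsub : U ⊆ {u : ℂ | |u.re| ≤ a ∧ |u.im| ≤ a} := fun v hv => ⟨hv.1.le, hv.2.le⟩
    exact fun u hu => closure_minimal hsub this hu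
  have hbdd : Bornology.IsBounded U := by
    refine (isBounded_closedBall (x := (0 : ℂ)) (r := 2 * a)).subset fun u hu => ?_
    rw [mem_closedBall_zero_iff]
    have := Complex.norm_le_abs_re_add_abs_im u
    linarith [hu.1, hu.2]
  have hrot : ∀ u : ℂ, |u.re| ≤ a → |u.im| ≤ a →
      |(Complex.I * u).re| ≤ a ∧ |(Complex.I * u).im| ≤ a ∧ |(-u).re| ≤ a ∧ |(-u).im| ≤ a ∧
      |(-(Complex.I * u)).re| ≤ a ∧ |(-(Complex.I * u)).im| ≤ a := by
    intro u h1 h2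
    simp [h1, h2]
  have hPd : ∀ u ∈ closure U, DifferentiableAt ℂ P u := by
    intro u hu
    obtain ⟨h1, h2⟩ := hcl u hu
    obtain ⟨r1, r2, r3, r4, r5, r6⟩ := hrot u h1 h2
    have d1 := (hd u h1 h2).comp u (by fun_prop : DifferentiableAt ℂ (fun u => c + u) u)
    have d2 := (hd _ r1 r2).comp u (by fun_prop : DifferentiableAt ℂ (fun u => c + Complex.I * u) u)
    have d3 := (hd _ r3 r4).comp u (by fun_prop : DifferentiableAt ℂ (fun u => c + -u) u)
    have d4 := (hd _ r5 r6).comp u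
      (by fun_prop : DifferentiableAt ℂ (fun u => c + -(Complex.I * u)) u)
    exact ((d1.mul d2).mul d3).mul d4
  have hPc : DiffContOnCl ℂ P U :=
    ⟨fun u hu => (hPd u (subset_closure hu)).differentiableWithinAt,
      fun u hu => (hPd u hu).continuousAt.continuousWithinAt⟩
  have hB0 : 0 ≤ B := (norm_nonneg _).trans (hB 0 (by simpa using ha.le) (by simpa using ha.le))
  have hl0 : 0 ≤ l :=
    (norm_nonneg _).trans (hl (-a : ℝ) (by simp) (by simpa using ha.le))
  have hfr : ∀ u ∈ frontier U, ‖P u‖ ≤ l * B ^ 3 := by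
    intro u hu
    obtain ⟨h1, h2⟩ := hcl u (frontier_subset_closure hu)
    obtain ⟨r1, r2, r3, r4, r5, r6⟩ := hrot u h1 h2
    have hnot : u ∉ U := fun h => by
      rw [hUo.frontier_eq] at hu
      exact hu.2 h
    have b1 := hB u h1 h2
    have b2 := hB _ r1 r2
    have b3 := hB _ r3 r4
    have b4 := hB _ r5 r6
    have hside : |u.re| = a ∨ |u.im| = a := by
      by_contra! hcon
      exact hnot ⟨lt_of_le_of_ne h1 hcon.1, lt_of_le_of_ne h2 hcon.2⟩
    simp only [hP, norm_mul]
    have key : ∀ p q r s : ℝ, 0 ≤ p → 0 ≤ q → 0 ≤ r → 0 ≤ s → p ≤ l → q ≤ B → r ≤ B → s ≤ B →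
        p * q * r * s ≤ l * B ^ 3 := by
      intro p q r s hp hq hr hs h1 h2 h3 h4
      calc p * q * r * s ≤ l * B * B * B := by gcongr
        _ = l * B ^ 3 := by ring
    rcases hside with h | h <;> rcases (abs_eq ha.le).1 h with h' | h'
    · have := key _ _ _ _ (norm_nonneg _) (norm_nonneg _) (norm_nonneg _) (norm_nonneg _)
        (hl (-u) (by simp [h']) r4) b1 b2 b4
      linarith
    · exact key _ _ _ _ (norm_nonneg _) (norm_nonneg _) (norm_nonneg _) (norm_nonneg _)
        (hl u h' h2) b2 b3 b4
    · have := key _ _ _ _ (norm_nonneg _) (norm_nonneg _) (norm_nonneg _) (norm_nonneg _)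
        (hl (Complex.I * u) (by simp [h']) r2) b1 b3 b4
      linarith
    · have := key _ _ _ _ (norm_nonneg _) (norm_nonneg _) (norm_nonneg _) (norm_nonneg _)
        (hl (-(Complex.I * u)) (by simp [h']) r6) b1 b2 b3
      linarith
  have := Complex.norm_le_of_forall_mem_frontier_norm_le hbdd hPc hfr
    (subset_closure (show (0 : ℂ) ∈ U by simp [hU, ha]))
  simp only [hP, mul_zero, neg_zero, add_zero, norm_mul] at this
  calc ‖k c‖ ^ 4 = ‖k c‖ * ‖k c‖ * ‖k c‖ * ‖k c‖ := by ring
    _ ≤ _ := this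

/-! ### Integrals along vertical lines. -/

theorem line_mem_halfPlane {r : ℝ} (hr : 0 < r) (y : ℝ) : (r + y * Complex.I : ℂ) ∈ halfPlane := by
  show 0 < Complex.re _
  simpa using hr

theorem continuous_deriv_line {φ : ℂ → ℂ} (hφ : DifferentiableOn ℂ φ halfPlane) {r : ℝ}
    (hr : 0 < r) : Continuous fun y : ℝ => deriv φ (r + y * Complex.I) :=
  (hφ.deriv isOpen_halfPlane).continuousOn.comp_continuous (by fun_prop) (line_mem_halfPlane hr)

theorem norm_sub_le_integral_line {φ : ℂ → ℂ} (hφ : DifferentiableOn ℂ φ halfPlane) {r a b : ℝ}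
    (hr : 0 < r) (hab : a ≤ b) :
    ‖φ (r + b * Complex.I) - φ (r + a * Complex.I)‖ ≤
      ∫ y in a..b, ‖deriv φ (r + y * Complex.I)‖ := by
  have hder : ∀ y ∈ uIcc a b, HasDerivAt (fun y : ℝ => φ (r + y * Complex.I))
      (deriv φ (r + y * Complex.I) * Complex.I) y := by
    intro y _
    have h1 : HasDerivAt (fun y : ℝ => (r + y * Complex.I : ℂ)) Complex.I y := by
      have : HasDerivAt (fun y : ℝ => (y : ℂ)) 1 y := Complex.ofRealCLM.hasDerivAt
      simpa using (this.mul_const Complex.I).const_add (r : ℂ)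
    exact (hφ.differentiableAt
      (isOpen_halfPlane.mem_nhds (line_mem_halfPlane hr y))).hasDerivAt.comp_of_eq y h1 rfl
  have hc := continuous_deriv_line hφ hr
  rw [← intervalIntegral.integral_eq_sub_of_hasDerivAt hder
    ((hc.mul continuous_const).intervalIntegrable a b)]
  refine (intervalIntegral.norm_integral_le_integral_norm hab).trans_eq ?_
  simp

namespace RegularTract

variable {φ : ℂ → ℂ} {α x C T₁ : ℝ}

/-- Comparison of the derivatives on `{Re ξ = x}` and `{Re ξ = 1}`. -/
theorem norm_deriv_x_le (h : RegularTract φ α x C T₁) (y : ℝ) :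
    ‖deriv φ (x + y * Complex.I)‖ ≤
      Real.exp (koebeConst * x) * ‖deriv φ ((1 : ℝ) + y * Complex.I)‖ := by
  have hx := h.one_le_x
  have := norm_deriv_le_exp_mul_of_le_re h.holo h.inj one_pos
    (z := (1 : ℝ) + y * Complex.I) (w := x + y * Complex.I) (by simp) (by simpa using hx)
  refine this.trans (mul_le_mul_of_nonneg_right (Real.exp_le_exp.2 ?_) (norm_nonneg _))
  rw [div_one, add_sub_add_right_eq_sub, ← Complex.ofReal_sub, Complex.norm_real,
    Real.norm_eq_abs, abs_of_nonneg (by linarith)]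
  exact mul_le_mul_of_nonneg_left (by linarith) koebeConst_pos.le

/-- Regularity is stated on `Re ξ = x`, the integral means live on `Re ξ = 1`; at equal height the
two points are at bounded hyperbolic distance. -/
theorem norm_deriv_one_le (h : RegularTract φ α x C T₁) (y : ℝ) :
    ‖deriv φ ((1 : ℝ) + y * Complex.I)‖ ≤
      Real.exp (koebeConst * x) * ‖deriv φ (x + y * Complex.I)‖ := by
  have hx := h.one_le_x
  have := norm_deriv_le_exp_mul_of_le_re h.holo h.inj one_pos
    (w := (1 : ℝ) + y * Complex.I) (z := x + y * Complex.I) (by simpa using hx) (by simp)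
  refine this.trans (mul_le_mul_of_nonneg_right (Real.exp_le_exp.2 ?_) (norm_nonneg _))
  rw [div_one, add_sub_add_right_eq_sub, ← Complex.ofReal_sub, Complex.norm_real,
    Real.norm_eq_abs, abs_sub_comm, abs_of_nonneg (by linarith)]
  exact mul_le_mul_of_nonneg_left (by linarith) koebeConst_pos.le

/-- The image of the segment `1 + i[T, 2T]` is not short. -/
theorem exists_le_integral (h : RegularTract φ α x C T₁) :
    ∃ c > 0, ∀ T ≥ T₁, c * ‖φ (T : ℂ)‖ ≤
      ∫ y in T..(2 * T), ‖deriv φ ((1 : ℝ) + y * Complex.I)‖ := by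
  have hx := h.one_le_x
  have hC := h.one_le_C
  have hK := koebeConst_pos
  -- With this choice `ηT` is at most `Re ξ / (8 koebeConst)` at the center `ξ` below, so the linear
  -- approximation of `φ` applies.
  set η : ℝ := 1 / (32 * koebeConst) with hη
  have hη0 : 0 < η := by positivity
  have hη1 : η ≤ 1 / 2 := by norm_num [hη, koebeConst]
  set E := Real.exp (koebeConst / (1 / 4) * 4) with hE
  have hE0 : 0 < E := Real.exp_pos _
  set F := Real.exp (koebeConst * x) with hF
  have hF0 : 0 < F := Real.exp_pos _
  set c₁ : ℝ := η / (2 * C * E) with hc₁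
  have hc₁0 : 0 < c₁ := by positivity
  refine ⟨c₁ ^ 4 / ((2 * C) ^ 3 * F), by positivity, fun T hT => ?_⟩
  have hTx : 16 * x ≤ T := h.le_T₁.trans hT
  have hT0 : 0 < T := by linarith
  set l := ∫ y in T..(2 * T), ‖deriv φ (x + y * Complex.I)‖ with hl
  have hx0 : 0 < x := by linarith
  have hlF : l ≤ F * ∫ y in T..(2 * T), ‖deriv φ ((1 : ℝ) + y * Complex.I)‖ := by
    rw [hl, ← intervalIntegral.integral_const_mul]
    refine intervalIntegral.integral_mono_on (by linarith)
      ((continuous_deriv_line h.holo hx0).norm.intervalIntegrable _ _)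
      (((continuous_deriv_line h.holo one_pos).norm.const_mul F).intervalIntegrable _ _)
      fun y _ => h.norm_deriv_x_le y
  set ξ : ℂ := ((x + T / 4 : ℝ) : ℂ) + ((5 * T / 4 : ℝ) : ℂ) * Complex.I with hξ
  have hξre : ξ.re = x + T / 4 := by simp [hξ]
  have hξim : ξ.im = 5 * T / 4 := by simp [hξ]
  -- The two constants bound is applied to this increment. On the left side of the square, which
  -- lies on `Re ξ = x`, it is at most the length `l`; elsewhere it is at most `2C|φ(T)|`; at the
  -- center distortion makes it at least `c₁|φ(T)|`.
  set k : ℂ → ℂ := fun z => φ (z + ((η * T : ℝ) : ℂ) * Complex.I) - φ z with hk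
  have hηT : η * T ≤ T / 2 := by nlinarith
  have hηT0 : 0 < η * T := by positivity
  have hsq := norm_pow_four_le_of_square (k := k) (c := ξ) (a := T / 4)
    (B := 2 * C * ‖φ T‖) (l := l) (by linarith)
    (fun u h1 h2 => by
      have h1' := abs_le.1 h1
      have m1 : ξ + u + ((η * T : ℝ) : ℂ) * Complex.I ∈ halfPlane := by
        show 0 < Complex.re _
        simp [-Complex.ofReal_mul, hξre]; linarith
      have m2 : ξ + u ∈ halfPlane := by
        show 0 < Complex.re _
        simp [hξre]; linarith
      exact ((h.holo.differentiableAt (isOpen_halfPlane.mem_nhds m1)).comp (ξ + u)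
        (by fun_prop : DifferentiableAt ℂ (fun z => z + ((η * T : ℝ) : ℂ) * Complex.I) _)).sub
        (h.holo.differentiableAt (isOpen_halfPlane.mem_nhds m2)))
    (fun u h1 h2 => by
      have h1' := abs_le.1 h1
      have h2' := abs_le.1 h2
      have b1 := (h.osc T hT (ξ + u + ((η * T : ℝ) : ℂ) * Complex.I)
        (by simp [-Complex.ofReal_mul, hξre]; linarith)
        (by simp [-Complex.ofReal_mul, hξre]; linarith)
        (by simp only [Complex.add_im, hξim, Complex.mul_im, Complex.ofReal_re, Complex.I_im,
              Complex.ofReal_im, Complex.I_re]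
            rw [abs_le]; constructor <;> linarith)
        (Or.inr (by
            simp only [Complex.add_im, hξim, Complex.mul_im, Complex.ofReal_re, Complex.I_im,
              Complex.ofReal_im, Complex.I_re]
            rw [le_abs]; left; linarith))).1
      have b2 := (h.osc T hT (ξ + u)
        (by simp [hξre]; linarith)
        (by simp [hξre]; linarith)
        (by simp only [Complex.add_im, hξim]
            rw [abs_le]; constructor <;> linarith)
        (Or.inr (by
            simp only [Complex.add_im, hξim]
            rw [le_abs]; left; linarith))).1
      refine (norm_sub_le _ _).trans ?_
      linarith)
    (fun u h1 h2 => by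
      have h2' := abs_le.1 h2
      have e1 : ξ + u = (x : ℂ) + ((5 * T / 4 + u.im : ℝ) : ℂ) * Complex.I := by
        apply Complex.ext <;> simp [hξ, h1]
      have e2 : ξ + u + ((η * T : ℝ) : ℂ) * Complex.I =
          (x : ℂ) + ((5 * T / 4 + u.im + η * T : ℝ) : ℂ) * Complex.I := by
        rw [e1]; push_cast; ring
      simp only [hk]
      rw [e2, e1]
      refine (norm_sub_le_integral_line h.holo hx0 (by linarith)).trans ?_
      refine intervalIntegral.integral_mono_interval (by linarith) (by linarith) (by linarith)
        (Eventually.of_forall fun y => norm_nonneg _)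
        ((continuous_deriv_line h.holo hx0).norm.intervalIntegrable _ _))
  have hlow : c₁ * ‖φ T‖ ≤ ‖k ξ‖ := by
    have hsub : ball ξ ξ.re ⊆ halfPlane := ball_subset_halfPlane le_rfl
    have hre0 : 0 < ξ.re := by rw [hξre]; linarith
    have hball : η * T ≤ ξ.re / (8 * koebeConst) := by
      rw [hξre, hη, le_div_iff₀ (by positivity)]
      field_simp
      linarith
    have h1 := le_norm_sub_of_injOn_ball hre0 (h.holo.mono hsub) (h.inj.mono hsub)
      (z := ξ + ((η * T : ℝ) : ℂ) * Complex.I) (w := ξ)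
      (by
        rw [mem_closedBall, dist_self_add_left, norm_mul, Complex.norm_I, mul_one,
          Complex.norm_real, Real.norm_eq_abs, abs_of_pos hηT0]
        exact hball)
      (mem_closedBall_self (by positivity))
    rw [add_sub_cancel_left, norm_mul, Complex.norm_I, mul_one, Complex.norm_real,
      Real.norm_eq_abs, abs_of_pos hηT0] at h1
    have h2 := norm_deriv_le_exp_mul_of_le_re h.holo h.inj (z := ξ) (w := T) (m := T / 4)
      (by linarith) (by rw [hξre]; linarith) (by simp; linarith)
    have h3 : Real.exp (koebeConst / (T / 4) * ‖(T : ℂ) - ξ‖) ≤ E := by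
      refine Real.exp_le_exp.2 ?_
      have h4 : ‖(T : ℂ) - ξ‖ ≤ 4 * T := by
        refine (Complex.norm_le_abs_re_add_abs_im _).trans ?_
        simp only [Complex.sub_re, Complex.sub_im, Complex.ofReal_re, Complex.ofReal_im, hξre,
          hξim, zero_sub, abs_neg]
        rw [abs_of_nonneg (by linarith : 0 ≤ 5 * T / 4)]
        have : |T - (x + T / 4)| ≤ T := by rw [abs_le]; constructor <;> linarith
        linarith
      calc koebeConst / (T / 4) * ‖(T : ℂ) - ξ‖ ≤ koebeConst / (T / 4) * (4 * T) := by gcongr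
        _ = koebeConst / (1 / 4) * 4 := by field_simp
    have h5 := h.le_deriv T hT
    have h6 : ‖deriv φ T‖ ≤ E * ‖deriv φ ξ‖ :=
      h2.trans (mul_le_mul_of_nonneg_right h3 (norm_nonneg _))
    have h7 : ‖φ T‖ ≤ C * (T * (E * ‖deriv φ ξ‖)) := h5.trans (by gcongr)
    calc c₁ * ‖φ T‖ ≤ c₁ * (C * (T * (E * ‖deriv φ ξ‖))) := by gcongr
      _ = ‖deriv φ ξ‖ / 2 * (η * T) := by rw [hc₁]; field_simp
      _ ≤ ‖k ξ‖ := h1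
  have hφT := h.norm_pos T hT
  have hfin : (c₁ * ‖φ T‖) ^ 4 ≤ l * (2 * C * ‖φ T‖) ^ 3 :=
    (pow_le_pow_left₀ (by positivity) hlow 4).trans hsq
  have h9 : c₁ ^ 4 * ‖φ T‖ ≤ l * (2 * C) ^ 3 := by
    have : 0 < ‖φ T‖ ^ 3 := by positivity
    refine le_of_mul_le_mul_right ?_ this
    calc c₁ ^ 4 * ‖φ T‖ * ‖φ T‖ ^ 3 = (c₁ * ‖φ T‖) ^ 4 := by ring
      _ ≤ _ := hfin
      _ = _ := by ring
  rw [div_mul_eq_mul_div, div_le_iff₀ (by positivity)]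
  calc c₁ ^ 4 * ‖φ T‖ ≤ l * (2 * C) ^ 3 := h9
    _ ≤ (F * ∫ y in T..(2 * T), ‖deriv φ ((1 : ℝ) + y * Complex.I)‖) * (2 * C) ^ 3 := by gcongr
    _ = _ := by ring

end RegularTract

end Tract
end
noncomputable section
namespace Tract
open Filter Topology Set Metric MeasureTheory

/-! ### The spectrum of a Hölder tract -/

/-- The set over which integral means are taken. -/
abbrev meansDomain : Set ℝ := Icc (-2 : ℝ) (-1) ∪ Icc (1 : ℝ) 2

theorem isCompact_meansDomain : IsCompact meansDomain := isCompact_Icc.union isCompact_Icc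

theorem measurableSet_meansDomain : MeasurableSet meansDomain :=
  measurableSet_Icc.union measurableSet_Icc

theorem volume_meansDomain : volume meansDomain = 2 := by
  rw [measure_union _ measurableSet_Icc, Real.volume_Icc, Real.volume_Icc, ← ENNReal.ofReal_add]
  · norm_num
  · norm_num
  · norm_num
  · refine Set.disjoint_left.2 fun y h1 h2 => ?_
    linarith [h1.2, h2.1]

theorem volume_real_meansDomain : volume.real meansDomain = 2 := by
  rw [Measure.real, volume_meansDomain]
  simp

/-- A family of positive functions on `meansDomain` with the growth of the derivatives of the
rescaled conformal maps of a Hölder tract. -/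
structure SpectralFamily (D : ℝ → ℝ → ℝ) (α A c T₂ : ℝ) : Prop where
  one_lt : 1 < T₂
  A_pos : 0 < A
  c_pos : 0 < c
  cont : ∀ T ≥ T₂, Continuous (D T)
  pos : ∀ T ≥ T₂, ∀ y, 0 < D T y
  le : ∀ T ≥ T₂, ∀ y ∈ meansDomain, D T y ≤ A * T ^ (1 - α)
  le_integral : ∀ T ≥ T₂, c ≤ ∫ y in meansDomain, D T y

namespace SpectralFamily

variable {D : ℝ → ℝ → ℝ} {α A c T₂ : ℝ}

theorem continuous_rpow (h : SpectralFamily D α A c T₂) {T : ℝ} (hT : T ≥ T₂) (t : ℝ) :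
    Continuous fun y => D T y ^ t :=
  (h.cont T hT).rpow_const fun y => Or.inl (h.pos T hT y).ne'

theorem integrableOn (h : SpectralFamily D α A c T₂) {T : ℝ} (hT : T ≥ T₂) (t : ℝ) :
    IntegrableOn (fun y => D T y ^ t) meansDomain :=
  (h.continuous_rpow hT t).continuousOn.integrableOn_compact isCompact_meansDomain

theorem integral_pos (h : SpectralFamily D α A c T₂) {T : ℝ} (hT : T ≥ T₂) (t : ℝ) :
    0 < ∫ y in meansDomain, D T y ^ t := by
  have hp : ∀ y, 0 < D T y ^ t := fun y => Real.rpow_pos_of_pos (h.pos T hT y) t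
  rw [integral_pos_iff_support_of_nonneg (fun y => (hp y).le) (h.integrableOn hT t)]
  have : Function.support (fun y => D T y ^ t) = univ := by
    ext y
    simp [(hp y).ne']
  rw [this, Measure.restrict_apply_univ, volume_meansDomain]
  norm_num

/-- Convexity of `t ↦ log ∫ D ^ t`. -/
theorem log_integral_le (h : SpectralFamily D α A c T₂) {T : ℝ} (hT : T ≥ T₂) {a b p q : ℝ}
    (hp : 0 ≤ p) (hq : 0 ≤ q) (hpq : p + q = 1) :
    Real.log (∫ y in meansDomain, D T y ^ (p * a + q * b)) ≤
      p * Real.log (∫ y in meansDomain, D T y ^ a) +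
        q * Real.log (∫ y in meansDomain, D T y ^ b) := by
  set Ja := ∫ y in meansDomain, D T y ^ a with hJa
  set Jb := ∫ y in meansDomain, D T y ^ b with hJb
  have ha : 0 < Ja := h.integral_pos hT a
  have hb : 0 < Jb := h.integral_pos hT b
  -- Hölder's inequality, obtained by integrating the weighted mean inequality for the normalized
  -- functions `D^a / Ja` and `D^b / Jb`.
  have hpt : ∀ y, D T y ^ (p * a + q * b) ≤
      Ja ^ p * Jb ^ q * (p / Ja * D T y ^ a + q / Jb * D T y ^ b) := by
    intro y
    have hy := h.pos T hT y
    have h1 := Real.geom_mean_le_arith_mean2_weighted hp hq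
      (div_nonneg (Real.rpow_pos_of_pos hy a).le ha.le)
      (div_nonneg (Real.rpow_pos_of_pos hy b).le hb.le) hpq
    rw [Real.div_rpow (Real.rpow_pos_of_pos hy a).le ha.le,
      Real.div_rpow (Real.rpow_pos_of_pos hy b).le hb.le, ← Real.rpow_mul hy.le,
      ← Real.rpow_mul hy.le] at h1
    have hap := Real.rpow_pos_of_pos ha p
    have hbq := Real.rpow_pos_of_pos hb q
    calc D T y ^ (p * a + q * b)
        = Ja ^ p * Jb ^ q * (D T y ^ (a * p) / Ja ^ p * (D T y ^ (b * q) / Jb ^ q)) := by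
          rw [Real.rpow_add hy, mul_comm a p, mul_comm b q]
          field_simp
      _ ≤ Ja ^ p * Jb ^ q * (p * (D T y ^ a / Ja) + q * (D T y ^ b / Jb)) := by gcongr
      _ = _ := by ring
  have hint := setIntegral_mono (h.integrableOn hT (p * a + q * b))
    ((((h.integrableOn hT a).const_mul (p / Ja)).add
      ((h.integrableOn hT b).const_mul (q / Jb))).const_mul (Ja ^ p * Jb ^ q)) hpt
  simp only [Pi.add_apply] at hint
  rw [integral_const_mul, integral_add ((h.integrableOn hT a).const_mul (p / Ja))
      ((h.integrableOn hT b).const_mul (q / Jb)), integral_const_mul, integral_const_mul,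
    ← hJa, ← hJb, div_mul_cancel₀ _ ha.ne', div_mul_cancel₀ _ hb.ne', hpq, mul_one] at hint
  have := Real.log_le_log (h.integral_pos hT _) hint
  rwa [Real.log_mul (Real.rpow_pos_of_pos ha p).ne' (Real.rpow_pos_of_pos hb q).ne',
    Real.log_rpow ha, Real.log_rpow hb] at this

/-- The integral means of the family. -/
def means (D : ℝ → ℝ → ℝ) (t T : ℝ) : ℝ :=
  Real.log (∫ y in meansDomain, D T y ^ t) / Real.log T

theorem means_le (h : SpectralFamily D α A c T₂) {t : ℝ} (ht : 0 < t) {T : ℝ} (hT : T ≥ T₂) :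
    means D t T ≤ t * (1 - α) + (Real.log 2 + t * Real.log A) / Real.log T := by
  have hT0 : 0 < T := by linarith [h.one_lt]
  have hlog : 0 < Real.log T := Real.log_pos (by linarith [h.one_lt])
  have hA := h.A_pos
  have hTp := Real.rpow_pos_of_pos hT0 (1 - α)
  have h1 : ∫ y in meansDomain, D T y ^ t ≤ 2 * (A * T ^ (1 - α)) ^ t := by
    have := setIntegral_mono_on (h.integrableOn hT t)
      (integrableOn_const (C := (A * T ^ (1 - α)) ^ t) (by rw [volume_meansDomain]; simp))
      measurableSet_meansDomain
      (fun y hy => Real.rpow_le_rpow (h.pos T hT y).le (h.le T hT y hy) ht.le)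
    rw [setIntegral_const, volume_real_meansDomain, smul_eq_mul] at this
    exact this
  have h2 := Real.log_le_log (h.integral_pos hT t) h1
  rw [Real.log_mul two_ne_zero (by positivity), Real.log_rpow (by positivity),
    Real.log_mul hA.ne' hTp.ne', Real.log_rpow hT0] at h2
  rw [means, div_le_iff₀ hlog, add_mul, div_mul_cancel₀ _ hlog.ne']
  linarith

/-- Write `D^t = D · D^(t-1)`. As `t - 1 ≤ 0`, the upper bound for `D` bounds the second factor from
below, and `∫ D ≥ c` does the rest. -/
theorem le_means_of_le_one (h : SpectralFamily D α A c T₂) {t : ℝ} (ht : t ≤ 1) {T : ℝ}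
    (hT : T ≥ T₂) :
    -((1 - α) * (1 - t)) + (Real.log c - (1 - t) * Real.log A) / Real.log T ≤ means D t T := by
  have hT0 : 0 < T := by linarith [h.one_lt]
  have hlog : 0 < Real.log T := Real.log_pos (by linarith [h.one_lt])
  have hA := h.A_pos
  have hTp := Real.rpow_pos_of_pos hT0 (1 - α)
  set E := A * T ^ (1 - α) with hE
  have hE0 : 0 < E := by positivity
  have h1 : ∀ y ∈ meansDomain, D T y * E ^ (t - 1) ≤ D T y ^ t := by
    intro y hy
    have hp := h.pos T hT y
    calc D T y * E ^ (t - 1) ≤ D T y * D T y ^ (t - 1) :=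
          mul_le_mul_of_nonneg_left
            (Real.rpow_le_rpow_of_nonpos hp (h.le T hT y hy) (by linarith)) hp.le
      _ = D T y ^ t := by
          rw [mul_comm, ← Real.rpow_add_one hp.ne']
          ring_nf
  have hi1 : IntegrableOn (D T) meansDomain :=
    (h.cont T hT).continuousOn.integrableOn_compact isCompact_meansDomain
  have h2 := setIntegral_mono_on (hi1.mul_const (E ^ (t - 1))) (h.integrableOn hT t)
    measurableSet_meansDomain h1
  rw [integral_mul_const] at h2
  have h3 : c * E ^ (t - 1) ≤ ∫ y in meansDomain, D T y ^ t :=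
    (mul_le_mul_of_nonneg_right (h.le_integral T hT) (by positivity)).trans h2
  have h4 := Real.log_le_log (mul_pos h.c_pos (by positivity)) h3
  rw [Real.log_mul h.c_pos.ne' (by positivity), Real.log_rpow hE0, hE,
    Real.log_mul hA.ne' hTp.ne', Real.log_rpow hT0] at h4
  rw [means, le_div_iff₀ hlog, add_mul, div_mul_cancel₀ _ hlog.ne']
  linarith

/-- Log-convexity between the exponents `0` and `t`, evaluated at `1`. It serves to keep the means
bounded below, as a real `limsup` requires. -/
theorem le_means_of_one_le (h : SpectralFamily D α A c T₂) {t : ℝ} (ht : 1 ≤ t) {T : ℝ}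
    (hT : T ≥ T₂) :
    (t * Real.log c - (t - 1) * Real.log 2) / Real.log T ≤ means D t T := by
  have hlog : 0 < Real.log T := Real.log_pos (by linarith [h.one_lt])
  have ht0 : 0 < t := by linarith
  have h1 := h.log_integral_le hT (a := 0) (b := t) (p := 1 - 1 / t) (q := 1 / t)
    (by rw [sub_nonneg, div_le_one ht0]; exact ht) (by positivity) (by ring)
  have e : (1 - 1 / t) * 0 + 1 / t * t = 1 := by field_simp; ring
  rw [e] at h1
  simp only [Real.rpow_one, Real.rpow_zero, setIntegral_const, volume_real_meansDomain,
    smul_eq_mul, mul_one] at h1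
  have h2 := Real.log_le_log h.c_pos (h.le_integral T hT)
  have h3 := h2.trans h1
  have h4 : t * Real.log c ≤ (t - 1) * Real.log 2 +
      Real.log (∫ y in meansDomain, D T y ^ t) := by
    have := mul_le_mul_of_nonneg_left h3 ht0.le
    calc t * Real.log c ≤ _ := this
      _ = _ := by field_simp
  rw [means]
  gcongr
  linarith

theorem tendsto_div_log (a b : ℝ) : Tendsto (fun T : ℝ => a + b / Real.log T) atTop (𝓝 a) := by
  simpa using (tendsto_const_nhds (x := a)).add
    ((tendsto_const_nhds (x := b)).div_atTop Real.tendsto_log_atTop)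

theorem isBoundedUnder_le (h : SpectralFamily D α A c T₂) {t : ℝ} (ht : 0 < t) :
    IsBoundedUnder (· ≤ ·) atTop (means D t) :=
  (tendsto_div_log _ _).isBoundedUnder_le.mono_le
    (eventually_atTop.2 ⟨T₂, fun _ hT => h.means_le ht hT⟩)

theorem isBoundedUnder_ge (h : SpectralFamily D α A c T₂) (t : ℝ) :
    IsBoundedUnder (· ≥ ·) atTop (means D t) := by
  rcases le_total t 1 with ht | ht
  · exact (tendsto_div_log _ _).isBoundedUnder_ge.mono_ge
      (eventually_atTop.2 ⟨T₂, fun _ hT => h.le_means_of_le_one ht hT⟩)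
  · have := (tendsto_div_log 0 (t * Real.log c - (t - 1) * Real.log 2)).isBoundedUnder_ge
    simp only [zero_add] at this
    exact this.mono_ge (eventually_atTop.2 ⟨T₂, fun _ hT => h.le_means_of_one_le ht hT⟩)

theorem limsup_means_le (h : SpectralFamily D α A c T₂) {t : ℝ} (ht : 0 < t) :
    limsup (means D t) atTop ≤ t * (1 - α) := by
  rw [← (tendsto_div_log (t * (1 - α)) (Real.log 2 + t * Real.log A)).limsup_eq]
  exact limsup_le_limsup (eventually_atTop.2 ⟨T₂, fun _ hT => h.means_le ht hT⟩)
    (h.isBoundedUnder_ge t).isCoboundedUnder_le (tendsto_div_log _ _).isBoundedUnder_le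

theorem le_limsup_means (h : SpectralFamily D α A c T₂) {t : ℝ} (ht : 0 < t) (ht1 : t ≤ 1) :
    -((1 - α) * (1 - t)) ≤ limsup (means D t) atTop := by
  rw [← (tendsto_div_log (-((1 - α) * (1 - t)))
    (Real.log c - (1 - t) * Real.log A)).limsup_eq]
  exact limsup_le_limsup (eventually_atTop.2 ⟨T₂, fun _ hT => h.le_means_of_le_one ht1 hT⟩)
    (tendsto_div_log _ _).isBoundedUnder_ge.isCoboundedUnder_le (h.isBoundedUnder_le ht)

theorem limsup_const_mul_means (h : SpectralFamily D α A c T₂) {t p : ℝ} (ht : 0 < t)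
    (hp : 0 ≤ p) :
    limsup (fun T => p * means D t T) atTop = p * limsup (means D t) atTop :=
  ((monotone_mul_left_of_nonneg hp).map_limsup_of_continuousAt (means D t)
    (by fun_prop) (h.isBoundedUnder_le ht) (h.isBoundedUnder_ge t).isCoboundedUnder_le).symm

/-- The means are convex in `t` for each large `T`, and `limsup` is subadditive and positively
homogeneous. -/
theorem convexOn_limsup_means (h : SpectralFamily D α A c T₂) :
    ConvexOn ℝ (Ioi 0) fun t => limsup (means D t) atTop := by
  refine ⟨convex_Ioi 0, fun a ha b hb p q hp hq hpq => ?_⟩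
  simp only [smul_eq_mul]
  have ha' : 0 < a := ha
  have hb' : 0 < b := hb
  rw [← h.limsup_const_mul_means ha' hp, ← h.limsup_const_mul_means hb' hq]
  have bd : ∀ {t r : ℝ}, 0 < t → 0 ≤ r →
      IsBoundedUnder (· ≤ ·) atTop (fun T => r * means D t T) ∧
      IsBoundedUnder (· ≥ ·) atTop (fun T => r * means D t T) := by
    intro t r ht hr
    obtain ⟨M, hM⟩ := h.isBoundedUnder_le ht
    obtain ⟨m, hm⟩ := h.isBoundedUnder_ge t
    rw [eventually_map] at hM hm
    exact ⟨⟨r * M, eventually_map.2 (hM.mono fun T hT => mul_le_mul_of_nonneg_left hT hr)⟩,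
      ⟨r * m, eventually_map.2 (hm.mono fun T hT => mul_le_mul_of_nonneg_left hT hr)⟩⟩
  have hadd := limsup_add_le (bd ha' hp).2 (bd ha' hp).1 (bd hb' hq).2.isCoboundedUnder_le
    (bd hb' hq).1
  refine le_trans ?_ hadd
  refine limsup_le_limsup ?_ (h.isBoundedUnder_ge _).isCoboundedUnder_le
    (isBoundedUnder_le_add (bd ha' hp).1 (bd hb' hq).1)
  refine eventually_atTop.2 ⟨T₂, fun T hT => ?_⟩
  have hlog : 0 < Real.log T := Real.log_pos (by linarith [h.one_lt])
  have := h.log_integral_le hT (a := a) (b := b) hp hq hpq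
  simp only [Pi.add_apply, means]
  rw [div_le_iff₀ hlog]
  calc _ ≤ _ := this
    _ = _ := by field_simp

end SpectralFamily

/-- The zero of the function `b(t) = β(t) - t + 1` of a convex spectrum. -/
theorem spectrum_zero {β : ℝ → ℝ} {α : ℝ} (hα : 0 < α) (hα1 : α ≤ 1)
    (hconv : ConvexOn ℝ (Ioi 0) β) (hle : ∀ t, 0 < t → β t ≤ t * (1 - α))
    (hge : ∀ t, 0 < t → t ≤ 1 → -((1 - α) * (1 - t)) ≤ β t) :
    1 ≤ sInf {t : ℝ | 0 < t ∧ β t - t + 1 = 0} ∧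
      sInf {t : ℝ | 0 < t ∧ β t - t + 1 = 0} ≤ 1 / α ∧
      (∀ t > sInf {t : ℝ | 0 < t ∧ β t - t + 1 = 0}, β t - t + 1 < 0) ∧
      ∀ t, 0 < t → t < sInf {t : ℝ | 0 < t ∧ β t - t + 1 = 0} → 0 < β t - t + 1 := by
  set Z := {t : ℝ | 0 < t ∧ β t - t + 1 = 0} with hZ
  have hcont : ContinuousOn (fun t => β t - t + 1) (Ioi 0) :=
    ((hconv.continuousOn isOpen_Ioi).sub continuousOn_id).add continuousOn_const
  -- Here `b(t) ≥ α(1 - t)`.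
  have hpos : ∀ t, 0 < t → t < 1 → 0 < β t - t + 1 := by
    intro t h0 h1
    have := hge t h0 h1.le
    have := mul_pos hα (sub_pos.2 h1)
    nlinarith
  have hZ1 : ∀ t ∈ Z, 1 ≤ t := by
    intro t ht
    by_contra! hlt
    exact (hpos t ht.1 hlt).ne' ht.2
  have hbdd : BddBelow Z := ⟨1, hZ1⟩
  have hα' : 1 ≤ 1 / α := by rw [le_div_iff₀ hα]; linarith
  have hneg : ∀ t, 1 / α < t → β t - t + 1 < 0 := by
    intro t ht
    have ht0 : 0 < t := by linarith
    rw [div_lt_iff₀ hα] at ht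
    linarith [hle t ht0]
  obtain ⟨z, hz, hzZ⟩ : ∃ z ∈ Icc 1 (1 / α), z ∈ Z := by
    have h1 : 0 ≤ β 1 - 1 + 1 := by simpa using hge 1 one_pos le_rfl
    have h2 : β (1 / α) - 1 / α + 1 ≤ 0 := by
      have := hle (1 / α) (by positivity)
      have e : 1 / α * (1 - α) = 1 / α - 1 := by field_simp
      linarith
    obtain ⟨z, hz, hz0⟩ := intermediate_value_Icc' hα'
      (hcont.mono fun t ht => lt_of_lt_of_le one_pos ht.1) ⟨h2, h1⟩
    exact ⟨z, hz, lt_of_lt_of_le one_pos hz.1, hz0⟩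
  have hne : Z.Nonempty := ⟨z, hzZ⟩
  -- Zeros stay in `[1, ∞)`, away from the endpoint `0` where continuity of `β` is not known, so the
  -- infimum is attained.
  have hclosed : IsClosed Z := by
    have : Z = Ici 1 ∩ (fun t => β t - t + 1) ⁻¹' {0} := by
      ext t
      exact ⟨fun ht => ⟨hZ1 t ht, ht.2⟩, fun ht => ⟨lt_of_lt_of_le one_pos ht.1, ht.2⟩⟩
    rw [this]
    have hsub : Ici (1 : ℝ) ⊆ Ioi 0 := Ici_subset_Ioi.2 one_pos
    exact (hcont.mono hsub).preimage_isClosed_of_isClosed isClosed_Ici isClosed_singleton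
  have hmem : sInf Z ∈ Z := hclosed.csInf_mem hne hbdd
  have hΘ1 : 1 ≤ sInf Z := hZ1 _ hmem
  refine ⟨hΘ1, (csInf_le hbdd hzZ).trans hz.2, fun t ht => ?_, fun t ht0 ht => ?_⟩
  · by_contra! hcon
    -- Since `b(u) < 0` and `b(Θ) = 0`, convexity makes `b` negative at `t`, which lies strictly
    -- between.
    set u := max (1 / α) t + 1 with hu
    have hut : t < u := by linarith [le_max_right (1 / α) t]
    have huneg := hneg u (by linarith [le_max_left (1 / α) t])
    have hd : 0 < u - sInf Z := by linarith
    have hp : 0 ≤ (u - t) / (u - sInf Z) := div_nonneg (by linarith) hd.le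
    have hq : 0 ≤ (t - sInf Z) / (u - sInf Z) := div_nonneg (by linarith) hd.le
    have hpq : (u - t) / (u - sInf Z) + (t - sInf Z) / (u - sInf Z) = 1 := by
      field_simp
      ring
    have hc := hconv.2 (show sInf Z ∈ Ioi 0 from hmem.1)
      (show u ∈ Ioi 0 from hmem.1.trans (by linarith)) hp hq hpq
    simp only [smul_eq_mul] at hc
    have e : (u - t) / (u - sInf Z) * sInf Z + (t - sInf Z) / (u - sInf Z) * u = t := by
      field_simp
      ring
    rw [e] at hc
    have h0 := hmem.2
    have h3 : β t * (u - sInf Z) ≤ (u - t) * β (sInf Z) + (t - sInf Z) * β u := by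
      have := mul_le_mul_of_nonneg_right hc hd.le
      calc _ ≤ _ := this
        _ = _ := by field_simp
    have h4 : β (sInf Z) = sInf Z - 1 := by linarith
    rw [h4] at h3
    have h5 : 0 < t - sInf Z := by linarith
    nlinarith [mul_pos h5 (neg_pos.2 huneg), mul_nonneg hcon hd.le]
  · by_contra! hcon
    have ht1 : 1 ≤ t := by
      by_contra! hlt
      exact (hpos t ht0 hlt).not_ge hcon
    -- A sign change between `1/2` and `t` would produce a zero before the first one.
    obtain ⟨v, hv, hv0⟩ := intermediate_value_Icc' (show (1 / 2 : ℝ) ≤ t by linarith)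
      (hcont.mono fun s hs => lt_of_lt_of_le (by norm_num) hs.1)
      ⟨hcon, (hpos (1 / 2) (by norm_num) (by norm_num)).le⟩
    have : sInf Z ≤ v := csInf_le hbdd ⟨lt_of_lt_of_le (by norm_num) hv.1, hv0⟩
    linarith [hv.2]

/-! ### The spectrum of a regular tract. -/

theorem norm_deriv_rescale {φ : ℂ → ℂ} {T : ℝ} (hT : 0 < T) (y : ℝ) :
    ‖deriv (rescale φ T) (((1 / T : ℝ) : ℂ) + y * Complex.I)‖ =
      T / ‖φ (T : ℂ)‖ * ‖deriv φ ((1 : ℝ) + (T * y : ℝ) * Complex.I)‖ := by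
  have hTc : (T : ℂ) ≠ 0 := by exact_mod_cast hT.ne'
  have h1 : (T : ℂ) * (((1 / T : ℝ) : ℂ) + y * Complex.I) =
      (1 : ℝ) + (T * y : ℝ) * Complex.I := by
    push_cast
    field_simp
  have h2 : rescale φ T = fun z => φ ((T : ℂ) * z) / (‖φ (T : ℂ)‖ : ℂ) := rfl
  rw [h2, deriv_div_const, deriv_comp_mul_left, h1, norm_div, norm_smul, Complex.norm_real,
    Complex.norm_real, norm_norm, Real.norm_eq_abs, abs_of_pos hT]
  ring

theorem betaInf_eq (φ : ℂ → ℂ) (t : ℝ) :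
    betaInf φ t = limsup (SpectralFamily.means (fun T y =>
      ‖deriv (rescale φ T) (((1 / T : ℝ) : ℂ) + y * Complex.I)‖) t) atTop := by
  unfold betaInf SpectralFamily.means integralMeans
  simp only [one_div_one_div]

namespace RegularTract

variable {φ : ℂ → ℂ} {α x C T₁ : ℝ}

/-- The upper bound is `deriv_le`, moved from `Re ξ = x` to `Re ξ = 1`. For the lower bound the half
`[1, 2]` of the domain already suffices. -/
theorem spectralFamily (h : RegularTract φ α x C T₁) :
    ∃ A c, SpectralFamily (fun T y =>
      ‖deriv (rescale φ T) (((1 / T : ℝ) : ℂ) + y * Complex.I)‖) α A c T₁ := by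
  obtain ⟨c, hc, hint⟩ := h.exists_le_integral
  have hC := h.one_le_C
  have hx := h.one_le_x
  have hT0 : ∀ T ≥ T₁, 0 < T := fun T hT => by linarith [h.le_T₁]
  have hcont : ∀ T ≥ T₁, Continuous fun y : ℝ =>
      ‖deriv (rescale φ T) (((1 / T : ℝ) : ℂ) + y * Complex.I)‖ := by
    intro T hT
    simp only [norm_deriv_rescale (hT0 T hT)]
    exact (((continuous_deriv_line h.holo one_pos).comp
      (continuous_const_mul T)).norm).const_mul _
  refine ⟨Real.exp (koebeConst * x) * C, c, by linarith [h.le_T₁], by positivity, hc, hcont,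
    fun T hT y => ?_, fun T hT y hy => ?_, fun T hT => ?_⟩
  · rw [norm_deriv_rescale (hT0 T hT)]
    exact mul_pos (div_pos (hT0 T hT) (h.norm_pos T hT)) (norm_pos_iff.2
      (deriv_ne_zero_of_injOn isOpen_halfPlane h.holo h.inj (line_mem_halfPlane one_pos _)))
  · rw [norm_deriv_rescale (hT0 T hT)]
    have hT' := hT0 T hT
    have hφ := h.norm_pos T hT
    have hy1 : 1 ≤ |y| ∧ |y| ≤ 2 := by
      rcases hy with hy | hy
      · rw [abs_of_neg (by linarith [hy.2])]
        exact ⟨by linarith [hy.2], by linarith [hy.1]⟩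
      · rw [abs_of_pos (by linarith [hy.1])]
        exact hy
    have h1 := h.norm_deriv_one_le (T * y)
    have h2 := h.deriv_le T hT (T * y)
      (by rw [abs_mul, abs_of_pos hT']; nlinarith) (by rw [abs_mul, abs_of_pos hT']; nlinarith)
    have hTα := Real.rpow_pos_of_pos hT' α
    rw [← le_div_iff₀ hTα] at h2
    calc T / ‖φ T‖ * ‖deriv φ ((1 : ℝ) + (T * y : ℝ) * Complex.I)‖
        ≤ T / ‖φ T‖ * (Real.exp (koebeConst * x) * (C * ‖φ T‖ / T ^ α)) := by
          gcongr
          exact h1.trans (by gcongr)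
      _ = Real.exp (koebeConst * x) * C * T ^ (1 - α) := by
        rw [Real.rpow_sub hT', Real.rpow_one]
        field_simp
  · have hT' := hT0 T hT
    have hφ := h.norm_pos T hT
    have h1 : ∫ y in Icc (1 : ℝ) 2,
        ‖deriv (rescale φ T) (((1 / T : ℝ) : ℂ) + y * Complex.I)‖ ≤
        ∫ y in meansDomain, ‖deriv (rescale φ T) (((1 / T : ℝ) : ℂ) + y * Complex.I)‖ :=
      setIntegral_mono_set
        ((hcont T hT).continuousOn.integrableOn_compact isCompact_meansDomain)
        (Eventually.of_forall fun y => norm_nonneg _) (LE.le.eventuallyLE subset_union_right)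
    refine le_trans ?_ h1
    rw [integral_Icc_eq_integral_Ioc, ← intervalIntegral.integral_of_le one_le_two]
    simp only [norm_deriv_rescale hT']
    rw [intervalIntegral.integral_const_mul, intervalIntegral.integral_comp_mul_left
      (f := fun y : ℝ => ‖deriv φ ((1 : ℝ) + y * Complex.I)‖) hT'.ne', smul_eq_mul, mul_one,
      mul_comm T 2]
    have := hint T hT
    calc c = T / ‖φ T‖ * (T⁻¹ * (c * ‖φ T‖)) := by field_simp
      _ ≤ _ := by gcongr

theorem spectrum (h : RegularTract φ α x C T₁) (hα : 0 < α) (hα1 : α ≤ 1) :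
    1 ≤ theta φ ∧ theta φ ≤ 1 / α ∧ (∀ t > theta φ, bInf φ t < 0) ∧
      ∀ t, 0 < t → t < theta φ → 0 < bInf φ t := by
  obtain ⟨A, c, hS⟩ := h.spectralFamily
  have hβ := funext (betaInf_eq φ)
  refine spectrum_zero (β := betaInf φ) hα hα1 ?_ ?_ ?_
  · rw [hβ]; exact hS.convexOn_limsup_means
  · intro t ht; rw [hβ]; exact hS.limsup_means_le ht
  · intro t ht ht1; rw [hβ]; exact hS.le_limsup_means ht ht1

/-- If `b(t) > 0`, then the integral means are large on a sequence of scales. -/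
theorem frequently_integral_ge (h : RegularTract φ α x C T₁) {t : ℝ} (hb : 0 < bInf φ t) :
    ∃ ε > (0 : ℝ), ∃ᶠ T : ℝ in atTop, T ^ ε ≤
      ‖φ (T : ℂ)‖ ^ (-t) * ((∫ y in T..(2 * T), ‖deriv φ ((1 : ℝ) + y * Complex.I)‖ ^ t) +
        ∫ y in (-(2 * T))..(-T), ‖deriv φ ((1 : ℝ) + y * Complex.I)‖ ^ t) := by
  obtain ⟨A, c, hS⟩ := h.spectralFamily
  refine ⟨bInf φ t / 2, by linarith, ?_⟩
  have hlt : t - 1 + bInf φ t / 2 < betaInf φ t := by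
    have : bInf φ t = betaInf φ t - t + 1 := rfl
    linarith
  rw [betaInf_eq] at hlt
  have hfr := frequently_lt_of_lt_limsup (hS.isBoundedUnder_ge t).isCoboundedUnder_le hlt
  refine (hfr.and_eventually (eventually_ge_atTop T₁)).mono ?_
  rintro T ⟨hT, hT1⟩
  have hT0 : 0 < T := by linarith [h.le_T₁, h.one_le_x]
  have hφ := h.norm_pos T hT1
  have hlog : 0 < Real.log T := Real.log_pos (by linarith [h.le_T₁, h.one_le_x])
  rw [SpectralFamily.means, lt_div_iff₀ hlog, ← Real.log_rpow hT0,
    Real.log_lt_log_iff (Real.rpow_pos_of_pos hT0 _) (hS.integral_pos hT1 t)] at hT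
  have hcont : Continuous fun y : ℝ => ‖deriv φ ((1 : ℝ) + y * Complex.I)‖ ^ t :=
    (continuous_deriv_line h.holo one_pos).norm.rpow_const fun y => Or.inl (norm_ne_zero_iff.2
      (deriv_ne_zero_of_injOn isOpen_halfPlane h.holo h.inj (line_mem_halfPlane one_pos _)))
  have hscale : ∀ a b : ℝ, a ≤ b → ∫ y in Icc a b,
      ‖deriv (rescale φ T) (((1 / T : ℝ) : ℂ) + y * Complex.I)‖ ^ t =
      (T / ‖φ T‖) ^ t * (T⁻¹ * ∫ y in (T * a)..(T * b),
        ‖deriv φ ((1 : ℝ) + y * Complex.I)‖ ^ t) := by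
    intro a b hab
    rw [integral_Icc_eq_integral_Ioc, ← intervalIntegral.integral_of_le hab]
    simp only [norm_deriv_rescale hT0]
    simp only [Real.mul_rpow (div_pos hT0 hφ).le (norm_nonneg _)]
    rw [intervalIntegral.integral_const_mul, intervalIntegral.integral_comp_mul_left
      (f := fun y : ℝ => ‖deriv φ ((1 : ℝ) + y * Complex.I)‖ ^ t) hT0.ne', smul_eq_mul]
  have hu : ∫ y in meansDomain, ‖deriv (rescale φ T) (((1 / T : ℝ) : ℂ) + y * Complex.I)‖ ^ t =
      (∫ y in Icc (-2 : ℝ) (-1),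
        ‖deriv (rescale φ T) (((1 / T : ℝ) : ℂ) + y * Complex.I)‖ ^ t) +
      ∫ y in Icc (1 : ℝ) 2, ‖deriv (rescale φ T) (((1 / T : ℝ) : ℂ) + y * Complex.I)‖ ^ t :=
    setIntegral_union (Set.disjoint_left.2 fun y h1 h2 => by linarith [h1.2, h2.1])
      measurableSet_Icc ((hS.integrableOn hT1 t).mono_set subset_union_left)
      ((hS.integrableOn hT1 t).mono_set subset_union_right)
  rw [hu, hscale _ _ (by norm_num), hscale _ _ (by norm_num)] at hT
  rw [mul_one, mul_comm T 2, mul_neg, mul_neg, mul_one, mul_comm T 2] at hT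
  set I₁ := ∫ y in T..(2 * T), ‖deriv φ ((1 : ℝ) + y * Complex.I)‖ ^ t
  set I₂ := ∫ y in (-(2 * T))..(-T), ‖deriv φ ((1 : ℝ) + y * Complex.I)‖ ^ t
  -- The substitution `y ↦ Ty` produces the factor `T^(t-1)`; what exceeds it is `T^(b/2)`.
  have e1 : T ^ (bInf φ t / 2) = T ^ (1 - t) * T ^ (t - 1 + bInf φ t / 2) := by
    rw [← Real.rpow_add hT0]; congr 1; ring
  rw [e1]
  have hTp := Real.rpow_pos_of_pos hT0 (1 - t)
  calc T ^ (1 - t) * T ^ (t - 1 + bInf φ t / 2) ≤ T ^ (1 - t) *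
        ((T / ‖φ T‖) ^ t * (T⁻¹ * I₂) + (T / ‖φ T‖) ^ t * (T⁻¹ * I₁)) := by gcongr
    _ = ‖φ T‖ ^ (-t) * (I₁ + I₂) := by
      have := Real.rpow_pos_of_pos hT0 t
      rw [Real.div_rpow hT0.le hφ.le, Real.rpow_neg hφ.le, Real.rpow_sub hT0, Real.rpow_one]
      have := Real.rpow_pos_of_pos hφ t
      field_simp
      ring

end RegularTract

end Tract
end
noncomputable section
namespace Tract
open Filter Topology Set Metric

/-! ### Hausdorff dimension of self-conformal sets -/

/-- A lower bound for the dimension of the image of a full shift: the expansion in base `N` maps it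
onto the unit interval, and is Hölder continuous. -/
theorem le_dimH_range_of_separated {N : ℕ} (hN : 1 < N) {p : (ℕ → Fin N) → ℂ} {a c t : ℝ}
    (ha : 0 < a) (hc : 0 < c) (ht : 0 < t) (hNa : 1 ≤ N * a ^ t)
    (hsep : ∀ (i j : ℕ → Fin N) (n : ℕ), (∀ m < n, i m = j m) → i n ≠ j n →
      c * a ^ n ≤ dist (p i) (p j)) :
    ENNReal.ofReal t ≤ dimH (range p) := by
  have hdiff : ∀ i j : ℕ → Fin N, i ≠ j → ∃ n, (∀ m < n, i m = j m) ∧ i n ≠ j n := by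
    intro i j hij
    obtain ⟨m, hm⟩ := Function.ne_iff.1 hij
    classical
    have hex : ∃ n, i n ≠ j n := ⟨m, hm⟩
    exact ⟨Nat.find hex, fun k hk => not_not.1 (Nat.find_min hex hk), Nat.find_spec hex⟩
  have hinj : Function.Injective p := by
    intro i j hij
    by_contra hne
    obtain ⟨n, h1, h2⟩ := hdiff i j hne
    have := hsep i j n h1 h2
    rw [hij, dist_self] at this
    have : 0 < c * a ^ n := by positivity
    linarith
  -- Needed for `Function.invFun`, whose values off the range of `p` play no role.
  have : Nonempty (ℕ → Fin N) := ⟨fun _ => ⟨0, by omega⟩⟩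
  set F : ℂ → ℝ := fun z => Real.ofDigits (Function.invFun p z) with hF
  have hFp : ∀ i, F (p i) = Real.ofDigits i := fun i => by
    simp only [hF, Function.leftInverse_invFun hinj i]
  have hdist : ∀ i j, dist (F (p i)) (F (p j)) ≤ c ^ (-t) * dist (p i) (p j) ^ t := by
    intro i j
    by_cases hij : i = j
    · rw [hij, dist_self, dist_self]
      positivity
    obtain ⟨n, h1, h2⟩ := hdiff i j hij
    rw [hFp, hFp, Real.dist_eq]
    refine (Real.abs_ofDigits_sub_ofDigits_le h1).trans ?_
    have h3 : (c * a ^ n) ^ t ≤ dist (p i) (p j) ^ t :=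
      Real.rpow_le_rpow (by positivity) (hsep i j n h1 h2) ht.le
    have hNpos : (0 : ℝ) < N := by exact_mod_cast (by omega : 0 < N)
    have h4 : ((N : ℝ) ^ n)⁻¹ ≤ (a ^ n) ^ t := by
      rw [inv_le_iff_one_le_mul₀ (by positivity), ← Real.rpow_natCast a n, ← Real.rpow_mul ha.le,
        mul_comm (n : ℝ) t, Real.rpow_mul ha.le, Real.rpow_natCast, ← mul_pow, mul_comm]
      exact one_le_pow₀ hNa
    calc ((N : ℝ) ^ n)⁻¹ ≤ (a ^ n) ^ t := h4
      _ = c ^ (-t) * (c * a ^ n) ^ t := by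
        rw [Real.mul_rpow hc.le (by positivity), ← mul_assoc, ← Real.rpow_add hc]
        simp
      _ ≤ _ := by gcongr
  have hhol : HolderOnWith (c ^ (-t)).toNNReal t.toNNReal F (range p) := by
    rintro _ ⟨i, rfl⟩ _ ⟨j, rfl⟩
    have hct : 0 ≤ c ^ (-t) := by positivity
    rw [edist_dist, edist_dist, Real.coe_toNNReal t ht.le,
      ENNReal.ofReal_rpow_of_nonneg dist_nonneg ht.le, ENNReal.ofNNReal_toNNReal,
      ← ENNReal.ofReal_mul hct]
    exact ENNReal.ofReal_le_ofReal (hdist i j)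
  have hdim := hhol.dimH_image_le (Real.toNNReal_pos.2 ht)
  have hsub : Icc (0 : ℝ) 1 ⊆ F '' range p := by
    intro s hs
    obtain ⟨i, -, hi⟩ := Real.ofDigits_SurjOn hN hs
    exact ⟨p i, mem_range_self i, (hFp i).trans hi⟩
  -- A `t`-Hölder map divides dimension by at least `t` and here reaches an interval, so `1 ≤ dimH
  -- (range p) / t`.
  have hone : (1 : ENNReal) ≤ dimH (F '' range p) := by
    refine le_trans (le_of_eq ?_) (dimH_mono hsub)
    rw [Real.dimH_of_nonempty_interior (by rw [interior_Icc]; exact nonempty_Ioo.2 one_pos)]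
    simp
  have h5 := hone.trans hdim
  rw [ENNReal.le_div_iff_mul_le (Or.inl (by simpa using ht)) (Or.inl (by simp)), one_mul] at h5
  exact h5

/-- A finite iterated function system of contractions of a bounded closed set with uniformly
separated images. -/
structure SeparatedIFS {N : ℕ} (D : Set ℂ) (G : Fin N → ℂ → ℂ) (a d L δ : ℝ) : Prop where
  isClosed : IsClosed D
  nonempty : D.Nonempty
  dist_le : ∀ x ∈ D, ∀ y ∈ D, dist x y ≤ δ
  a_pos : 0 < a
  d_pos : 0 < d
  L_nonneg : 0 ≤ L
  L_lt_one : L < 1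
  mapsTo : ∀ k, MapsTo (G k) D D
  lip : ∀ k, ∀ x ∈ D, ∀ y ∈ D, dist (G k x) (G k y) ≤ L * dist x y
  antilip : ∀ k, ∀ x ∈ D, ∀ y ∈ D, a * dist x y ≤ dist (G k x) (G k y)
  sep : ∀ k l, k ≠ l → ∀ x ∈ D, ∀ y ∈ D, d ≤ dist (G k x) (G l y)

namespace SeparatedIFS

variable {N : ℕ} {D : Set ℂ} {G : Fin N → ℂ → ℂ} {a d L δ : ℝ}

/-- The finite approximations of the coding map. -/
def approx (G : Fin N → ℂ → ℂ) (x₀ : ℂ) : ℕ → (ℕ → Fin N) → ℂ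
  | 0, _ => x₀
  | n + 1, i => G (i 0) (approx G x₀ n fun m => i (m + 1))

/-- Successive approximations differ by at most `δ Lⁿ`, so they converge, and closedness keeps the
limits in `D`. -/
theorem exists_coding (h : SeparatedIFS D G a d L δ) :
    ∃ p : (ℕ → Fin N) → ℂ, (∀ i, p i ∈ D) ∧ ∀ i, p i = G (i 0) (p fun m => i (m + 1)) := by
  obtain ⟨x₀, hx₀⟩ := h.nonempty
  have hmem : ∀ n i, approx G x₀ n i ∈ D := by
    intro n
    induction n with
    | zero => exact fun i => hx₀
    | succ n ih => exact fun i => h.mapsTo _ (ih _)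
  have hstep : ∀ n i, dist (approx G x₀ n i) (approx G x₀ (n + 1) i) ≤ δ * L ^ n := by
    intro n
    induction n with
    | zero => exact fun i => by simpa using h.dist_le _ (hmem 0 i) _ (hmem 1 i)
    | succ n ih =>
      intro i
      calc _ ≤ L * dist (approx G x₀ n fun m => i (m + 1))
            (approx G x₀ (n + 1) fun m => i (m + 1)) := h.lip _ _ (hmem _ _) _ (hmem _ _)
        _ ≤ L * (δ * L ^ n) := mul_le_mul_of_nonneg_left (ih _) h.L_nonneg
        _ = δ * L ^ (n + 1) := by ring
  have hlim : ∀ i, ∃ z, Tendsto (fun n => approx G x₀ n i) atTop (𝓝 z) := fun i =>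
    cauchySeq_tendsto_of_complete
      (cauchySeq_of_le_geometric L δ h.L_lt_one fun n => hstep n i)
  choose p hp using hlim
  have hpD : ∀ i, p i ∈ D := fun i =>
    h.isClosed.mem_of_tendsto (hp i) (Eventually.of_forall fun n => hmem n i)
  refine ⟨p, hpD, fun i => ?_⟩
  refine tendsto_nhds_unique ((tendsto_add_atTop_iff_nat 1).2 (hp i)) ?_
  rw [tendsto_iff_dist_tendsto_zero]
  have h0 := (tendsto_iff_dist_tendsto_zero.1 (hp fun m => i (m + 1))).const_mul L
  rw [mul_zero] at h0
  exact squeeze_zero (fun _ => dist_nonneg) (fun n => h.lip _ _ (hmem _ _) _ (hpD _)) h0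

variable {p : (ℕ → Fin N) → ℂ}

/-- Each common leading digit costs at most a factor `a`; at the first different digit the images
are `d` apart. -/
theorem le_dist_coding (h : SeparatedIFS D G a d L δ) (hpD : ∀ i, p i ∈ D)
    (hp : ∀ i, p i = G (i 0) (p fun m => i (m + 1))) (n : ℕ) :
    ∀ i j : ℕ → Fin N, (∀ m < n, i m = j m) → i n ≠ j n → d * a ^ n ≤ dist (p i) (p j) := by
  induction n with
  | zero =>
    intro i j _ hne
    rw [hp i, hp j, pow_zero, mul_one]
    exact h.sep _ _ hne _ (hpD _) _ (hpD _)
  | succ n ih =>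
    intro i j heq hne
    rw [hp i, hp j, heq 0 n.succ_pos]
    calc d * a ^ (n + 1) = a * (d * a ^ n) := by ring
      _ ≤ a * dist (p fun m => i (m + 1)) (p fun m => j (m + 1)) :=
        mul_le_mul_of_nonneg_left (ih _ _ (fun m hm => heq _ (by omega)) hne) h.a_pos.le
      _ ≤ _ := h.antilip _ _ (hpD _) _ (hpD _)

theorem dist_coding_le (h : SeparatedIFS D G a d L δ) (hpD : ∀ i, p i ∈ D)
    (hp : ∀ i, p i = G (i 0) (p fun m => i (m + 1))) (n : ℕ) :
    ∀ i j : ℕ → Fin N, (∀ m < n, i m = j m) → dist (p i) (p j) ≤ δ * L ^ n := by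
  induction n with
  | zero =>
    intro i j _
    simpa using h.dist_le _ (hpD _) _ (hpD _)
  | succ n ih =>
    intro i j heq
    rw [hp i, hp j, heq 0 n.succ_pos]
    calc _ ≤ L * dist (p fun m => i (m + 1)) (p fun m => j (m + 1)) :=
        h.lip _ _ (hpD _) _ (hpD _)
      _ ≤ L * (δ * L ^ n) :=
        mul_le_mul_of_nonneg_left (ih _ _ fun m hm => heq _ (by omega)) h.L_nonneg
      _ = δ * L ^ (n + 1) := by ring

end SeparatedIFS

/-- For `|u| ≤ 1/2` the bound `|e^u - 1 - u| ≤ |u|²` leaves `|e^u - 1| ≥ |u|/2`. -/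
theorem le_dist_exp {x y : ℂ} (h : dist x y ≤ 1 / 2) :
    Real.exp y.re / 2 * dist x y ≤ dist (Complex.exp x) (Complex.exp y) := by
  rw [dist_eq_norm] at h
  have h1 := Complex.norm_exp_sub_one_sub_id_le (x := x - y) (by linarith)
  have h2 : Complex.exp x - Complex.exp y = Complex.exp y * (Complex.exp (x - y) - 1) := by
    rw [mul_sub, ← Complex.exp_add, add_sub_cancel, mul_one]
  have h3 := norm_sub_norm_le (x - y) (x - y - (Complex.exp (x - y) - 1))
  rw [sub_sub_cancel, norm_sub_rev (x - y) (Complex.exp (x - y) - 1)] at h3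
  rw [dist_eq_norm, dist_eq_norm, h2, norm_mul, Complex.norm_exp]
  have h4 : ‖x - y‖ / 2 ≤ ‖Complex.exp (x - y) - 1‖ := by
    nlinarith [norm_nonneg (x - y)]
  calc Real.exp y.re / 2 * ‖x - y‖ = Real.exp y.re * (‖x - y‖ / 2) := by ring
    _ ≤ _ := by gcongr

/-- An iterated function system of inverse branches of `f` in logarithmic coordinates yields a set
of large dimension on which all orbits are bounded and expanded. -/
theorem SeparatedIFS.exists_invariant {N : ℕ} {D : Set ℂ} {G : Fin N → ℂ → ℂ} {a d L δ t : ℝ}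
    (h : SeparatedIFS D G a d L δ) (hN : 1 < N) (ht : 0 < t) (hNa : 1 ≤ N * a ^ t)
    (hsmall : L * δ ≤ 1 / 2) {f : ℂ → ℂ}
    (hconj : ∀ k, ∀ η ∈ D, f (Complex.exp (G k η)) = Complex.exp η) :
    ∃ E : Set ℂ, ENNReal.ofReal t ≤ dimH E ∧
      (∀ z ∈ E, ∀ n, f^[n] z ∈ Complex.exp '' D) ∧ (Continuous f → E ⊆ julia f) := by
  obtain ⟨p, hpD, hp⟩ := h.exists_coding
  obtain ⟨x₀, hx₀⟩ := h.nonempty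
  have hreD : ∀ x ∈ D, x₀.re - δ ≤ x.re ∧ x.re ≤ x₀.re + δ := by
    intro x hx
    have h1 := h.dist_le x hx x₀ hx₀
    rw [dist_eq_norm] at h1
    have h2 := abs_le.1 ((Complex.abs_re_le_norm (x - x₀)).trans h1)
    rw [Complex.sub_re] at h2
    constructor <;> linarith
  have hiter : ∀ n i, f^[n] (Complex.exp (p i)) = Complex.exp (p fun m => i (m + n)) := by
    intro n
    induction n with
    | zero => intro i; simp
    | succ n ih =>
      intro i
      rw [Function.iterate_succ_apply, hp i, hconj _ _ (hpD _), ih]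
      congr 2
  set k₀ : Fin N := ⟨0, by omega⟩ with hk₀
  set k₁ : Fin N := ⟨1, hN⟩ with hk₁
  -- Prefixing one fixed digit confines all points to `G k₀ '' D`, of diameter at most `Lδ ≤ 1/2`,
  -- where `le_dist_exp` shows that the exponential preserves separation up to a constant.
  set pre : (ℕ → Fin N) → (ℕ → Fin N) := fun i m => if m = 0 then k₀ else i (m - 1) with hpre
  set c := Real.exp (x₀.re - δ) / 2 * (a * d) with hc
  have hc0 : 0 < c := by
    have := h.a_pos
    have := h.d_pos
    positivity
  have hppre : ∀ i, p (pre i) = G k₀ (p i) := fun i => by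
    rw [hp (pre i)]
    rfl
  have hsep : ∀ (i j : ℕ → Fin N) (n : ℕ), (∀ m < n, i m = j m) → i n ≠ j n →
      c * a ^ n ≤ dist (Complex.exp (p (pre i))) (Complex.exp (p (pre j))) := by
    intro i j n h1 h2
    have h3 := h.le_dist_coding hpD hp n i j h1 h2
    have h4 := h.antilip k₀ _ (hpD i) _ (hpD j)
    have h5 : dist (p (pre i)) (p (pre j)) ≤ 1 / 2 := by
      rw [hppre, hppre]
      exact ((h.lip k₀ _ (hpD i) _ (hpD j)).trans (mul_le_mul_of_nonneg_left
        (h.dist_le _ (hpD i) _ (hpD j)) h.L_nonneg)).trans hsmall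
    refine le_trans ?_ (le_dist_exp h5)
    have ha := h.a_pos
    calc c * a ^ n = Real.exp (x₀.re - δ) / 2 * (a * (d * a ^ n)) := by rw [hc]; ring
      _ ≤ Real.exp (p (pre j)).re / 2 * dist (p (pre i)) (p (pre j)) := by
        have hd := h.d_pos
        gcongr
        · exact (hreD _ (hpD _)).1
        · rw [hppre, hppre]
          exact le_trans (by gcongr) h4
  refine ⟨range fun i => Complex.exp (p (pre i)),
    le_dimH_range_of_separated hN h.a_pos hc0 ht hNa hsep, ?_, ?_⟩
  · rintro _ ⟨i, rfl⟩ n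
    rw [hiter]
    exact mem_image_of_mem _ (hpD _)
  rintro hf _ ⟨i', rfl⟩ ⟨ε, hε, hnorm⟩
  set i := pre i'
  set z := Complex.exp (p i) with hz
  have hzb : z ∈ ball z ε := mem_ball_self hε
  obtain ⟨v, hv, hcase⟩ := hnorm id strictMono_id
  simp only [id] at hcase
  rcases hcase with ⟨g, hg⟩ | hinf
  -- Agree with the code of `z` for `v k` digits, then continue with `u₁` or `u₂`: both points tend
  -- to `z`, yet their images under the iterate `v k` stay at distance `δ₀`. Four errors below
  -- `δ₀/4` contradict this.
  · set u₁ : ℕ → Fin N := pre fun _ => k₀ with hu₁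
    set u₂ : ℕ → Fin N := pre fun _ => k₁ with hu₂
    set δ₀ := dist (Complex.exp (p u₁)) (Complex.exp (p u₂)) with hδ₀
    have hδ₀0 : 0 < δ₀ := by
      have := hsep (fun _ => k₀) (fun _ => k₁) 0 (by simp) (by simp [hk₀, hk₁])
      rw [pow_zero, mul_one] at this
      exact lt_of_lt_of_le hc0 this
    have hgc : ContinuousOn g (ball z ε) :=
      hg.continuousOn (Eventually.of_forall fun n => (hf.iterate _).continuousOn).frequently
    have hgz : ∀ᶠ w in 𝓝 z, dist (g w) (g z) < δ₀ / 4 :=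
      (hgc.continuousAt (isOpen_ball.mem_nhds hzb)).eventually (ball_mem_nhds _ (by linarith))
    obtain ⟨s, hs, hsn⟩ := Metric.tendstoLocallyUniformlyOn_iff.1 hg (δ₀ / 4) (by linarith) z hzb
    rw [isOpen_ball.nhdsWithin_eq hzb] at hs
    set cat : ℕ → (ℕ → Fin N) → (ℕ → Fin N) := fun n u m => if m < n then i m else u (m - n)
      with hcat
    have hlim : ∀ u, Tendsto (fun k => Complex.exp (p (cat (v k) u))) atTop (𝓝 z) := by
      intro u
      refine (Complex.continuous_exp.tendsto _).comp ?_
      rw [tendsto_iff_dist_tendsto_zero]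
      refine squeeze_zero (fun _ => dist_nonneg) (fun k => h.dist_coding_le hpD hp (v k) _ _
        fun m hm => by simp [hcat, hm]) ?_
      have := ((tendsto_pow_atTop_nhds_zero_of_lt_one h.L_nonneg h.L_lt_one).const_mul δ).comp
        hv.tendsto_atTop
      rw [mul_zero] at this
      exact this
    have hval : ∀ u n, f^[n] (Complex.exp (p (cat n u))) = Complex.exp (p u) := by
      intro u n
      rw [hiter]
      congr 2
      ext m
      simp [hcat]
    obtain ⟨k, hk, hk1, hk2, hk3, hk4⟩ := (hsn.and (((hlim u₁).eventually hs).and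
      (((hlim u₁).eventually hgz).and (((hlim u₂).eventually hs).and
      ((hlim u₂).eventually hgz))))).exists
    have e1 := hk _ hk1
    have e2 := hk _ hk3
    rw [hval] at e1 e2
    have t1 := dist_triangle4 (Complex.exp (p u₁)) (g (Complex.exp (p (cat (v k) u₁))))
      (g (Complex.exp (p (cat (v k) u₂)))) (Complex.exp (p u₂))
    have t2 := dist_triangle_right (g (Complex.exp (p (cat (v k) u₁))))
      (g (Complex.exp (p (cat (v k) u₂)))) (g z)
    rw [dist_comm] at e1
    linarith
  -- Locally uniform escape fails already at `z`, whose orbit is bounded.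
  · obtain ⟨k, hk⟩ := (hinf {z} (singleton_subset_iff.2 hzb) isCompact_singleton
      (Real.exp (x₀.re + δ))).exists
    have := hk z rfl
    rw [hz, hiter, Complex.norm_exp, Real.exp_lt_exp] at this
    linarith [(hreD _ (hpD fun m => i (m + v k))).2]

end Tract
end
noncomputable section
namespace Tract
open Filter Topology Set Metric MeasureTheory

/-! ### Inverse branches -/

/-- A weak-type bound controls the sum up to a logarithm: the smallest of `n` values is at most
`A/n`; remove it and induct. -/
theorem sum_le_mul_harmonic {ι : Type*} {X : ι → ℝ} {A : ℝ} (n : ℕ) :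
    ∀ K : Finset ι, K.card = n → (∀ k ∈ K, ((K.filter fun j => X k ≤ X j).card : ℝ) * X k ≤ A) →
      (∀ k ∈ K, 0 ≤ X k) → ∑ k ∈ K, X k ≤ A * (harmonic n : ℝ) := by
  classical
  induction n with
  | zero =>
    intro K hK _ _
    rw [Finset.card_eq_zero] at hK
    simp [hK]
  | succ n ih =>
    intro K hK hA hX
    have hne : K.Nonempty := Finset.card_pos.1 (by omega)
    obtain ⟨k₀, hk₀, hmin⟩ := K.exists_min_image X hne
    have h1 : (K.filter fun j => X k₀ ≤ X j) = K := Finset.filter_true_of_mem hmin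
    have h2 := hA k₀ hk₀
    rw [h1, hK] at h2
    have h3 := ih (K.erase k₀) (by rw [Finset.card_erase_of_mem hk₀, hK]; rfl)
      (fun k hk => by
        refine le_trans ?_ (hA k (Finset.mem_of_mem_erase hk))
        refine mul_le_mul_of_nonneg_right ?_ (hX k (Finset.mem_of_mem_erase hk))
        exact_mod_cast Finset.card_le_card (Finset.filter_subset_filter _ (Finset.erase_subset _ _)))
      (fun k hk => hX k (Finset.mem_of_mem_erase hk))
    rw [← Finset.add_sum_erase K X hk₀, harmonic_succ]
    have hn : (0 : ℝ) < ((n + 1 : ℕ) : ℝ) := by positivity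
    have h4 : X k₀ ≤ A * (((n + 1 : ℕ) : ℝ))⁻¹ := by
      rw [← div_eq_mul_inv, le_div_iff₀ hn]
      linarith
    push_cast at h4 ⊢
    linarith

/-- A sum is dominated, up to a logarithm, by one of its level sets. -/
theorem exists_sum_le_card_mul {ι : Type*} {K : Finset ι} (hK : K.Nonempty) {X : ι → ℝ}
    (hX : ∀ k ∈ K, 0 ≤ X k) :
    ∃ k ∈ K, ∑ j ∈ K, X j ≤
      (1 + Real.log K.card) * (((K.filter fun j => X k ≤ X j).card : ℝ) * X k) := by
  obtain ⟨k, hk, hmax⟩ := K.exists_max_image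
    (fun k => ((K.filter fun j => X k ≤ X j).card : ℝ) * X k) hK
  refine ⟨k, hk, (sum_le_mul_harmonic K.card K rfl hmax hX).trans ?_⟩
  rw [mul_comm]
  exact mul_le_mul_of_nonneg_right (harmonic_le_one_add_log _)
    (mul_nonneg (Nat.cast_nonneg _) (hX k hk))

/-- Comparison of an integral with a sum over a lattice. -/
theorem exists_integral_le_sum {g : ℝ → ℝ} (hg : Continuous g) (hg0 : ∀ y, 0 ≤ g y) {w E : ℝ}
    (hw : 0 < w) (hE : ∀ y u, |y - u| ≤ w → g y ≤ E * g u) {a b : ℝ} (hab : a ≤ b) :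
    ∃ (m : ℤ) (n : ℕ), (n : ℝ) ≤ (b - a) / w + 2 ∧
      (∀ k < n, a - w ≤ w * (m + k) ∧ w * (m + k) ≤ b) ∧
      ∫ y in a..b, g y ≤ w * E * ∑ k ∈ Finset.range n, g (w * (m + k)) := by
  -- The first lattice point may lie below `a`, by at most `w`; the cells starting at the `n` points
  -- cover `[a, b]`.
  set m : ℤ := ⌊a / w⌋ with hm
  set n : ℕ := (⌊b / w⌋ - m + 1).toNat with hn
  have hmle : m ≤ ⌊b / w⌋ := Int.floor_le_floor (by gcongr)
  have hnz : (n : ℤ) = ⌊b / w⌋ - m + 1 := by rw [hn, Int.toNat_of_nonneg (by omega)]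
  have hnr : (n : ℝ) = (⌊b / w⌋ : ℝ) - m + 1 := by exact_mod_cast hnz
  have f1 : (m : ℝ) ≤ a / w := Int.floor_le _
  have f2 : a / w < m + 1 := Int.lt_floor_add_one _
  have f3 : (⌊b / w⌋ : ℝ) ≤ b / w := Int.floor_le _
  have f4 : b / w < ⌊b / w⌋ + 1 := Int.lt_floor_add_one _
  rw [le_div_iff₀ hw] at f1 f3
  rw [div_lt_iff₀ hw] at f2 f4
  refine ⟨m, n, ?_, fun k hk => ?_, ?_⟩
  · have h1 : (n : ℝ) - 2 ≤ (b - a) / w := by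
      rw [le_div_iff₀ hw, hnr]
      nlinarith
    linarith
  · have hk1 : (k : ℝ) + 1 ≤ n := by exact_mod_cast hk
    have hk0 : (0 : ℝ) ≤ k := Nat.cast_nonneg k
    have h2 : w * ((k : ℝ) + 1) ≤ w * n := by gcongr
    have h3 : 0 ≤ w * k := by positivity
    rw [hnr] at h2
    constructor <;> nlinarith
  · have hint : ∀ u v : ℝ, IntervalIntegrable g volume u v := fun u v => hg.intervalIntegrable u v
    have h1 : ∫ y in a..b, g y ≤ ∫ y in (w * (m + (0 : ℕ)))..(w * (m + n)), g y := by
      refine intervalIntegral.integral_mono_interval ?_ hab ?_ (Eventually.of_forall hg0) (hint _ _)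
      · push_cast; linarith
      · rw [hnr]; linarith
    refine h1.trans ?_
    rw [← intervalIntegral.sum_integral_adjacent_intervals
      (a := fun k : ℕ => w * ((m : ℝ) + k)) fun k _ => hint _ _, Finset.mul_sum]
    refine Finset.sum_le_sum fun k _ => ?_
    have hstep : w * ((m : ℝ) + (k + 1 : ℕ)) = w * (m + k) + w := by push_cast; ring
    have h2 := intervalIntegral.integral_mono_on (a := w * ((m : ℝ) + k))
      (b := w * ((m : ℝ) + (k + 1 : ℕ))) (by rw [hstep]; linarith) (hint _ _)
      (intervalIntegrable_const (c := E * g (w * (m + k))))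
      (fun y hy => hE y _ (by
        rw [hstep] at hy
        rw [abs_le]
        constructor <;> linarith [hy.1, hy.2]))
    rw [intervalIntegral.integral_const, hstep, smul_eq_mul] at h2
    rw [hstep]
    linarith

namespace RegularTract

variable {φ : ℂ → ℂ} {α x C T₁ : ℝ}

/-- Logarithms of `φ` on disks at distance about `T`. -/
theorem exists_branch (h : RegularTract φ α x C T₁) {r : ℝ} (hr : 0 < r) :
    ∃ S₀ : ℝ, ∀ T ≥ T₁, ∀ s : ℝ, s = Real.log ‖φ (T : ℂ)‖ → S₀ ≤ s → s ≤ T / 8 →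
      ∀ y : ℝ, 7 * T / 8 ≤ |y| → |y| ≤ 5 * T / 2 → ∃ Λ : ℂ → ℂ,
        (∀ ξ ∈ closedBall (s + y * Complex.I : ℂ) r, ξ ∈ halfPlane ∧ Complex.exp (Λ ξ) = φ ξ ∧
          Λ ξ ∈ closedBall (s : ℂ) (Real.log C + 8)) ∧
        ∀ ξ ∈ closedBall (s + y * Complex.I : ℂ) r, ∀ ξ' ∈ closedBall (s + y * Complex.I : ℂ) r,
          ‖Λ ξ - Λ ξ'‖ ≤ 8 * C ^ 2 / s * ‖ξ - ξ'‖ ∧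
          Real.exp (-(koebeConst * Real.log s)) / (2 * C) *
            (‖deriv φ ((1 : ℝ) + y * Complex.I)‖ / ‖φ (T : ℂ)‖) * ‖ξ - ξ'‖ ≤ ‖Λ ξ - Λ ξ'‖ := by
  have hC := h.one_le_C
  have hx := h.one_le_x
  have hK := koebeConst_pos
  have hC2 : 0 < 8 * C ^ 2 * r := by positivity
  -- The three terms ensure, in order: `Re ξ ≥ x` on the disk of radius `s/2`, validity of the
  -- linear approximation on the disk of radius `r`, and oscillation of `Λ` at most `1` there.
  refine ⟨max (max (2 * x) (16 * koebeConst * r)) (8 * C ^ 2 * r),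
    fun T hT s hs hS hsT y hy1 hy2 => ?_⟩
  have s1 : 2 * x ≤ s := (le_max_left _ _).trans ((le_max_left _ _).trans hS)
  have s2 : 16 * koebeConst * r ≤ s := (le_max_right _ _).trans ((le_max_left _ _).trans hS)
  have s3 : 8 * C ^ 2 * r ≤ s := (le_max_right _ _).trans hS
  have hs0 : 0 < s := by linarith
  have hT0 : 0 < T := by linarith
  have hφT := h.norm_pos T hT
  set ξ₀ : ℂ := s + y * Complex.I with hξ₀
  have hre : ξ₀.re = s := by simp [hξ₀]
  have him : ξ₀.im = y := by simp [hξ₀]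
  have hosc : ∀ ξ ∈ ball ξ₀ (s / 2), ‖φ ξ‖ ≤ C * ‖φ T‖ ∧ ‖φ T‖ ≤ C * ‖φ ξ‖ := by
    intro ξ hξ
    rw [mem_ball, dist_eq_norm] at hξ
    have h1 := abs_le.1 ((Complex.abs_re_le_norm (ξ - ξ₀)).trans hξ.le)
    have h2 := (Complex.abs_im_le_norm (ξ - ξ₀)).trans hξ.le
    rw [Complex.sub_re, hre] at h1
    rw [Complex.sub_im, him] at h2
    have h3 := abs_sub_abs_le_abs_sub ξ.im y
    have h4 := abs_sub_abs_le_abs_sub y ξ.im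
    rw [abs_sub_comm] at h4
    exact h.osc T hT ξ (by linarith) (by linarith) (by linarith) (Or.inr (by linarith))
  have hne : ∀ ξ ∈ ball ξ₀ (s / 2), φ ξ ≠ 0 := by
    intro ξ hξ h0
    have := (hosc ξ hξ).2
    rw [h0, norm_zero, mul_zero] at this
    linarith
  have hsub : ball ξ₀ (s / 2) ⊆ halfPlane := ball_subset_halfPlane (by rw [hre]; linarith)
  have hd := h.holo.mono hsub
  have hs2 : 0 < s / 2 := by linarith
  have hξ₀b : ξ₀ ∈ ball ξ₀ (s / 2) := mem_ball_self hs2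
  obtain ⟨Λ, hΛ0, hΛ⟩ := exists_log_on_ball hs2 hd hne
  have hΛd : DifferentiableOn ℂ Λ (ball ξ₀ (s / 2)) := fun ξ hξ =>
    (hΛ ξ hξ).1.differentiableAt.differentiableWithinAt
  have hΛi : InjOn Λ (ball ξ₀ (s / 2)) := by
    intro ξ hξ ξ' hξ' heq
    refine h.inj (hsub hξ) (hsub hξ') ?_
    rw [← (hΛ ξ hξ).2, ← (hΛ ξ' hξ').2, heq]
  have hsmall : closedBall ξ₀ r ⊆ closedBall ξ₀ (s / 2 / (8 * koebeConst)) := by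
    refine closedBall_subset_closedBall ?_
    rw [le_div_iff₀ (by positivity)]
    linarith
  have hsmall2 : closedBall ξ₀ r ⊆ ball ξ₀ (s / 2) := by
    refine closedBall_subset_ball ?_
    have : (1 : ℝ) ≤ koebeConst := by norm_num [koebeConst]
    nlinarith
  have hderiv : deriv Λ ξ₀ = deriv φ ξ₀ / φ ξ₀ := (hΛ ξ₀ hξ₀b).1.deriv
  have hφ0 : 0 < ‖φ ξ₀‖ := norm_pos_iff.2 (hne ξ₀ hξ₀b)
  have hup : ‖deriv Λ ξ₀‖ ≤ 4 * C ^ 2 / s := by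
    have hcl : closedBall ξ₀ (s / 4) ⊆ ball ξ₀ (s / 2) := closedBall_subset_ball (by linarith)
    have h1 := Complex.norm_deriv_le_of_forall_mem_sphere_norm_le (by linarith : 0 < s / 4)
      ((hd.mono hcl).diffContOnCl_ball Subset.rfl)
      (fun ξ hξ => (hosc ξ (hcl (sphere_subset_closedBall hξ))).1)
    have h2 := (hosc ξ₀ hξ₀b).2
    rw [hderiv, norm_div, div_le_iff₀ hφ0]
    calc ‖deriv φ ξ₀‖ ≤ C * ‖φ T‖ / (s / 4) := h1
      _ ≤ C * (C * ‖φ ξ₀‖) / (s / 4) := by gcongr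
      _ = 4 * C ^ 2 / s * ‖φ ξ₀‖ := by field_simp
  -- Passing from `Re ξ = 1` to `Re ξ = s` costs the factor `s^koebeConst`.
  have hlow : Real.exp (-(koebeConst * Real.log s)) / C *
      (‖deriv φ ((1 : ℝ) + y * Complex.I)‖ / ‖φ (T : ℂ)‖) ≤ ‖deriv Λ ξ₀‖ := by
    have h1 := norm_deriv_le_rpow_mul h.holo h.inj (x := 1) (s := s) (y := y) one_pos hs0
    have h2 := (hosc ξ₀ hξ₀b).1
    rw [one_div, Real.log_inv, abs_neg, abs_of_nonneg (Real.log_nonneg (by linarith))] at h1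
    rw [hderiv, norm_div, Real.exp_neg]
    have he := Real.exp_pos (koebeConst * Real.log s)
    rw [le_div_iff₀ hφ0]
    calc (Real.exp (koebeConst * Real.log s))⁻¹ / C *
          (‖deriv φ ((1 : ℝ) + y * Complex.I)‖ / ‖φ (T : ℂ)‖) * ‖φ ξ₀‖
        ≤ (Real.exp (koebeConst * Real.log s))⁻¹ / C *
          (Real.exp (koebeConst * Real.log s) * ‖deriv φ ξ₀‖ / ‖φ (T : ℂ)‖) * (C * ‖φ T‖) := by
          gcongr
      _ = ‖deriv φ ξ₀‖ := by field_simp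
  have hlip : ∀ ξ ∈ closedBall ξ₀ r, ∀ ξ' ∈ closedBall ξ₀ r,
      ‖Λ ξ - Λ ξ'‖ ≤ 8 * C ^ 2 / s * ‖ξ - ξ'‖ := by
    intro ξ hξ ξ' hξ'
    refine (norm_sub_le_of_injOn_ball hs2 hΛd hΛi (hsmall hξ) (hsmall hξ')).trans ?_
    refine mul_le_mul_of_nonneg_right ?_ (norm_nonneg _)
    calc 2 * ‖deriv Λ ξ₀‖ ≤ 2 * (4 * C ^ 2 / s) := by gcongr
      _ = 8 * C ^ 2 / s := by ring
  refine ⟨Λ, fun ξ hξ => ⟨hsub (hsmall2 hξ), (hΛ ξ (hsmall2 hξ)).2, ?_⟩, fun ξ hξ ξ' hξ' =>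
    ⟨hlip ξ hξ ξ' hξ', ?_⟩⟩
  · have hξ2 := hsmall2 hξ
    have hφξ : 0 < ‖φ ξ‖ := norm_pos_iff.2 (hne ξ hξ2)
    have hreΛ : (Λ ξ).re = Real.log ‖φ ξ‖ := by
      rw [← (hΛ ξ hξ2).2, Complex.norm_exp, Real.log_exp]
    have b1 : Real.log ‖φ ξ‖ ≤ Real.log C + s := by
      rw [hs, ← Real.log_mul (by positivity) hφT.ne']
      exact Real.log_le_log hφξ (hosc ξ hξ2).1
    have b2 : s ≤ Real.log C + Real.log ‖φ ξ‖ := by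
      rw [hs, ← Real.log_mul (by positivity) hφξ.ne']
      exact Real.log_le_log hφT (hosc ξ hξ2).2
    -- The real part of `Λ` is within `log C` of `s`; the imaginary part is at most `π + 1`, as `Λ
    -- ξ₀` is the principal logarithm. Hence the radius `log C + 8`.
    have b3 : ‖Λ ξ - Λ ξ₀‖ ≤ 1 := by
      refine (hlip ξ hξ ξ₀ (mem_closedBall_self hr.le)).trans ?_
      rw [mem_closedBall, dist_eq_norm] at hξ
      calc 8 * C ^ 2 / s * ‖ξ - ξ₀‖ ≤ 8 * C ^ 2 / s * r := by gcongr
        _ = 8 * C ^ 2 * r / s := by ring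
        _ ≤ 1 := by rw [div_le_one hs0]; exact s3
    have b4 := (Complex.abs_im_le_norm (Λ ξ - Λ ξ₀)).trans b3
    have b5 : |(Λ ξ₀).im| ≤ Real.pi := by
      rw [hΛ0, Complex.log_im]
      exact Complex.abs_arg_le_pi _
    have b6 := Real.pi_le_four
    rw [mem_closedBall, dist_eq_norm]
    refine (Complex.norm_le_abs_re_add_abs_im _).trans ?_
    rw [Complex.sub_re, Complex.sub_im, Complex.ofReal_re, Complex.ofReal_im, sub_zero, hreΛ]
    rw [Complex.sub_im] at b4
    have b7 : |Real.log ‖φ ξ‖ - s| ≤ Real.log C := by rw [abs_le]; constructor <;> linarith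
    have b8 := abs_sub_abs_le_abs_sub (Λ ξ).im (Λ ξ₀).im
    linarith
  · refine le_trans ?_ (le_norm_sub_of_injOn_ball hs2 hΛd hΛi (hsmall hξ) (hsmall hξ'))
    refine mul_le_mul_of_nonneg_right ?_ (norm_nonneg _)
    rw [le_div_iff₀ two_pos]
    refine le_trans (le_of_eq ?_) hlow
    field_simp

/-- Logarithmic growth of `log |φ(T)|`. -/
theorem exists_log_norm_le (h : RegularTract φ α x C T₁) :
    ∃ B ≥ 1, ∀ᶠ T : ℝ in atTop, Real.log ‖φ (T : ℂ)‖ ≤ B * Real.log T := by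
  have hC := h.one_le_C
  have hK := koebeConst_pos
  have h1ne : deriv φ 1 ≠ 0 :=
    deriv_ne_zero_of_injOn isOpen_halfPlane h.holo h.inj (by show 0 < Complex.re 1; simp)
  have h1 : 0 < ‖deriv φ 1‖ := norm_pos_iff.2 h1ne
  refine ⟨|Real.log (C * ‖deriv φ 1‖)| + 1 + koebeConst, by
    have := abs_nonneg (Real.log (C * ‖deriv φ 1‖)); linarith, ?_⟩
  filter_upwards [eventually_ge_atTop T₁, eventually_ge_atTop 1,
    Real.tendsto_log_atTop.eventually_ge_atTop 1] with T hT hT1 hlog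
  have hT0 : 0 < T := by linarith
  have h2 := norm_deriv_le_rpow_mul h.holo h.inj (x := T) (s := 1) (y := 0) hT0 one_pos
  simp only [Complex.ofReal_zero, zero_mul, add_zero, div_one, Complex.ofReal_one] at h2
  rw [abs_of_nonneg (by linarith)] at h2
  have h3 : ‖φ T‖ ≤ C * ‖deriv φ 1‖ * (T * Real.exp (koebeConst * Real.log T)) := by
    calc ‖φ T‖ ≤ C * (T * ‖deriv φ T‖) := h.le_deriv T hT
      _ ≤ C * (T * (Real.exp (koebeConst * Real.log T) * ‖deriv φ 1‖)) := by gcongr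
      _ = _ := by ring
  have h4 := Real.log_le_log (h.norm_pos T hT) h3
  rw [Real.log_mul (by positivity) (by positivity), Real.log_mul hT0.ne' (Real.exp_pos _).ne',
    Real.log_exp] at h4
  have h5 := le_abs_self (Real.log (C * ‖deriv φ 1‖))
  nlinarith [abs_nonneg (Real.log (C * ‖deriv φ 1‖))]

end RegularTract

end Tract
end
noncomputable section
namespace Tract
open Filter Topology Set Metric MeasureTheory

/-! ### The hyperbolic dimension is at least `Θ` -/

/-- Polynomial growth beats the logarithmic losses. -/
theorem eventually_log_mul_le_rpow {ε t A B C K : ℝ} (hε : 0 < ε) (ht : 0 < t) (hA : 0 ≤ A)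
    (hB : 1 ≤ B) (hC : 1 ≤ C) (hK : 0 < K) :
    ∀ᶠ T : ℝ in atTop, ∀ s : ℝ, 1 ≤ s → s ≤ B * Real.log T →
      A * (1 + Real.log (T + 2)) * (2 * C * Real.exp (K * Real.log s)) ^ t ≤ T ^ ε := by
  set M : ℝ := A * 3 * (2 * C * B ^ K) ^ t + 1 with hM
  have hBK : 0 < B ^ K := Real.rpow_pos_of_pos (by linarith) K
  have hM0 : 0 < M := by positivity
  have ho := (isLittleO_log_rpow_rpow_atTop (1 + K * t) hε).bound (inv_pos.2 hM0)
  filter_upwards [ho, eventually_ge_atTop 2, Real.tendsto_log_atTop.eventually_ge_atTop 1]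
    with T h1 hT hlog s hs1 hs2
  have hT0 : 0 < T := by linarith
  have hlog0 : 0 < Real.log T := by linarith
  rw [Real.norm_of_nonneg (by positivity), Real.norm_of_nonneg (by positivity)] at h1
  have h2 : 1 + Real.log (T + 2) ≤ 3 * Real.log T := by
    have : Real.log (T + 2) ≤ Real.log (T * T) := Real.log_le_log (by linarith) (by nlinarith)
    rw [Real.log_mul hT0.ne' hT0.ne'] at this
    linarith
  have h2' : 0 ≤ 1 + Real.log (T + 2) := by
    have := Real.log_nonneg (by linarith : (1 : ℝ) ≤ T + 2)
    linarith
  have h3 : Real.exp (K * Real.log s) ≤ B ^ K * Real.log T ^ K := by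
    rw [mul_comm K, ← Real.rpow_def_of_pos (by linarith), ← Real.mul_rpow (by linarith) hlog0.le]
    exact Real.rpow_le_rpow (by linarith) hs2 hK.le
  calc A * (1 + Real.log (T + 2)) * (2 * C * Real.exp (K * Real.log s)) ^ t
      ≤ A * (3 * Real.log T) * (2 * C * (B ^ K * Real.log T ^ K)) ^ t := by gcongr
    _ = A * 3 * (2 * C * B ^ K) ^ t * (Real.log T * (Real.log T ^ K) ^ t) := by
      rw [← mul_assoc (2 * C), Real.mul_rpow (by positivity) (by positivity)]
      ring
    _ = A * 3 * (2 * C * B ^ K) ^ t * Real.log T ^ (1 + K * t) := by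
      rw [Real.rpow_add hlog0, Real.rpow_one, Real.rpow_mul hlog0.le]
    _ ≤ M * Real.log T ^ (1 + K * t) := by
      gcongr
      linarith
    _ ≤ M * (M⁻¹ * T ^ ε) := by gcongr
    _ = T ^ ε := by field_simp

namespace RegularTract

variable {φ : ℂ → ℂ} {α x C T₁ : ℝ}

/-- Many lattice points at which the derivative of `φ` is large. -/
theorem exists_large_deriv (h : RegularTract φ α x C T₁) {t w : ℝ} (ht : 0 < t)
    (hw : 1 ≤ w) (hb : 0 < bInf φ t) (S₀ : ℝ) :
    ∃ T ≥ T₁, ∃ s : ℝ, s = Real.log ‖φ (T : ℂ)‖ ∧ S₀ ≤ s ∧ s ≤ T / 8 ∧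
      ∃ (a : ℝ) (K : Finset ℕ) (m : ℤ), 0 < a ∧
        1 ≤ K.card * (Real.exp (-(koebeConst * Real.log s)) / (2 * C) * a) ^ t ∧
        ∀ k ∈ K, 7 * T / 8 ≤ |w * (m + k)| ∧ |w * (m + k)| ≤ 5 * T / 2 ∧
          a ≤ ‖deriv φ ((1 : ℝ) + (w * (m + k) : ℝ) * Complex.I)‖ / ‖φ (T : ℂ)‖ := by
  have hK := koebeConst_pos
  have hC := h.one_le_C
  have hw0 : 0 < w := by linarith
  obtain ⟨ε, hε, hfr⟩ := h.frequently_integral_ge hb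
  obtain ⟨B, hB, hlogle⟩ := h.exists_log_norm_le
  set E : ℝ := Real.exp (koebeConst * w) ^ t with hE
  have hE0 : 0 < E := by positivity
  have hgrow := eventually_log_mul_le_rpow (A := 2 * (w * E)) (C := C) (K := koebeConst) hε ht
    (by positivity) hB hC hK
  have hlo : ∀ᶠ T : ℝ in atTop, B * Real.log T ≤ T / 8 := by
    have := Real.isLittleO_log_id_atTop.bound (show (0 : ℝ) < 1 / (8 * B) by positivity)
    filter_upwards [this, eventually_ge_atTop 1] with T hT hT1
    rw [Real.norm_of_nonneg (Real.log_nonneg hT1), id, Real.norm_of_nonneg (by linarith)] at hT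
    calc B * Real.log T ≤ B * (1 / (8 * B) * T) := by gcongr
      _ = T / 8 := by field_simp
  have hslarge : ∀ᶠ T : ℝ in atTop, max S₀ 1 ≤ Real.log ‖φ (T : ℂ)‖ :=
    (Real.tendsto_log_atTop.comp h.tendsto).eventually_ge_atTop _
  obtain ⟨T, hTint, hT, hTlog, hTgrow, hTlo, hTs, hTw⟩ := (hfr.and_eventually
    ((eventually_ge_atTop T₁).and (hlogle.and (hgrow.and (hlo.and (hslarge.and
      (eventually_ge_atTop (8 * w)))))))).exists
  set s := Real.log ‖φ (T : ℂ)‖ with hs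
  have hs1 : 1 ≤ s := (le_max_right _ _).trans hTs
  have hT0 : 0 < T := by linarith
  have hφT := h.norm_pos T hT
  refine ⟨T, hT, s, rfl, (le_max_left _ _).trans hTs, hTlog.trans hTlo, ?_⟩
  set g : ℝ → ℝ := fun y => ‖deriv φ ((1 : ℝ) + y * Complex.I)‖ ^ t with hg
  have hdpos : ∀ y : ℝ, 0 < ‖deriv φ ((1 : ℝ) + y * Complex.I)‖ := fun y => norm_pos_iff.2
    (deriv_ne_zero_of_injOn isOpen_halfPlane h.holo h.inj (line_mem_halfPlane one_pos _))
  have hgc : Continuous g := (continuous_deriv_line h.holo one_pos).norm.rpow_const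
    fun y => Or.inl (hdpos y).ne'
  have hg0 : ∀ y, 0 ≤ g y := fun y => by positivity
  have hgE : ∀ y u, |y - u| ≤ w → g y ≤ E * g u := by
    intro y u hyu
    have h1 := norm_deriv_le_exp_mul_of_le_re h.holo h.inj one_pos
      (z := (1 : ℝ) + u * Complex.I) (w := (1 : ℝ) + y * Complex.I) (by simp) (by simp)
    rw [add_sub_add_left_eq_sub, ← sub_mul, norm_mul, Complex.norm_I, mul_one,
      ← Complex.ofReal_sub, Complex.norm_real, Real.norm_eq_abs, div_one] at h1
    rw [hE, hg, ← Real.mul_rpow (Real.exp_pos _).le (norm_nonneg _)]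
    refine Real.rpow_le_rpow (norm_nonneg _) (h1.trans ?_) ht.le
    gcongr
  -- One of the intervals `[T, 2T]` and `[-2T, -T]` carries at least half of the integral.
  obtain ⟨a₀, b₀, hab, hlen, hrange, hI⟩ : ∃ a₀ b₀ : ℝ, a₀ ≤ b₀ ∧ b₀ - a₀ = T ∧
      (∀ y, a₀ - w ≤ y → y ≤ b₀ → 7 * T / 8 ≤ |y| ∧ |y| ≤ 5 * T / 2) ∧
      T ^ ε ≤ 2 * (‖φ T‖ ^ (-t) * ∫ y in a₀..b₀, g y) := by
    have hφt : 0 < ‖φ T‖ ^ (-t) := Real.rpow_pos_of_pos hφT _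
    rcases le_total (∫ y in (-(2 * T))..(-T), g y) (∫ y in T..(2 * T), g y) with hle | hle
    · refine ⟨T, 2 * T, by linarith, by ring, fun y h1 h2 => ?_, hTint.trans ?_⟩
      · rw [abs_of_nonneg (by linarith)]
        constructor <;> linarith
      · nlinarith
    · refine ⟨-(2 * T), -T, by linarith, by ring, fun y h1 h2 => ?_, hTint.trans ?_⟩
      · rw [abs_of_nonpos (by linarith)]
        constructor <;> linarith
      · nlinarith
  obtain ⟨m, n, hn, hmem, hsum⟩ := exists_integral_le_sum hgc hg0 hw0 hgE hab
  set b : ℕ → ℝ := fun k => ‖deriv φ ((1 : ℝ) + (w * (m + k) : ℝ) * Complex.I)‖ / ‖φ (T : ℂ)‖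
    with hbdef
  have hbpos : ∀ k, 0 < b k := fun k => div_pos (hdpos _) hφT
  have hbt : ∀ k : ℕ, b k ^ t = ‖φ T‖ ^ (-t) * g (w * (m + k)) := by
    intro k
    rw [hbdef, Real.div_rpow (norm_nonneg _) hφT.le, Real.rpow_neg hφT.le, div_eq_inv_mul]
  have hTsum : T ^ ε ≤ 2 * (w * E) * ∑ k ∈ Finset.range n, b k ^ t := by
    refine hI.trans ?_
    simp only [hbt, ← Finset.mul_sum]
    have hφt : 0 < ‖φ T‖ ^ (-t) := Real.rpow_pos_of_pos hφT _
    calc 2 * (‖φ T‖ ^ (-t) * ∫ y in a₀..b₀, g y)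
        ≤ 2 * (‖φ T‖ ^ (-t) * (w * E * ∑ k ∈ Finset.range n, g (w * (m + k)))) := by gcongr
      _ = _ := by ring
  have hTε : 0 < T ^ ε := Real.rpow_pos_of_pos hT0 ε
  have hn0 : (Finset.range n).Nonempty := by
    by_contra hemp
    rw [Finset.not_nonempty_iff_eq_empty] at hemp
    rw [hemp, Finset.sum_empty, mul_zero] at hTsum
    linarith
  -- One level set carries the sum up to the factor `1 + log n`, which `T^ε` absorbs together with
  -- the powers of `log T`.
  obtain ⟨k₀, -, hk₀⟩ := exists_sum_le_card_mul hn0 (X := fun k => b k ^ t)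
    (fun k _ => (Real.rpow_pos_of_pos (hbpos k) t).le)
  set K := (Finset.range n).filter fun j => b k₀ ^ t ≤ b j ^ t with hKdef
  have hn1 : 1 ≤ n := by
    have := Finset.card_pos.2 hn0
    rwa [Finset.card_range] at this
  have hlogn : Real.log n ≤ Real.log (T + 2) := by
    refine Real.log_le_log (by exact_mod_cast hn1) (hn.trans ?_)
    rw [hlen]
    have : T / w ≤ T := div_le_self hT0.le hw
    linarith
  refine ⟨b k₀, K, m, hbpos k₀, ?_, fun k hk => ?_⟩
  · rw [Finset.card_range] at hk₀
    set P := (K.card : ℝ) * b k₀ ^ t with hP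
    have hP0 : 0 ≤ P := mul_nonneg (Nat.cast_nonneg _) (Real.rpow_pos_of_pos (hbpos k₀) t).le
    set q := 2 * C * Real.exp (koebeConst * Real.log s) with hq
    have hq0 : 0 < q := by positivity
    have hl2 : 0 < 1 + Real.log (T + 2) := by
      have := Real.log_nonneg (by linarith : (1 : ℝ) ≤ T + 2)
      linarith
    have h1 : T ^ ε ≤ 2 * (w * E) * ((1 + Real.log (T + 2)) * P) := by
      refine hTsum.trans ?_
      gcongr
      exact hk₀.trans (by gcongr)
    have h2 := (hTgrow s hs1 hTlog).trans h1
    have h3 : q ^ t ≤ P := by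
      have hpos : 0 < 2 * (w * E) * (1 + Real.log (T + 2)) := by positivity
      refine le_of_mul_le_mul_left ?_ hpos
      linarith
    have h4 : Real.exp (-(koebeConst * Real.log s)) / (2 * C) * b k₀ = b k₀ / q := by
      rw [Real.exp_neg, hq]
      field_simp
    rw [h4, Real.div_rpow (hbpos k₀).le hq0.le, ← mul_div_assoc, le_div_iff₀ (by positivity),
      one_mul]
    exact h3
  · rw [hKdef, Finset.mem_filter, Finset.mem_range] at hk
    have h1 := hmem k hk.1
    have h2 := hrange _ h1.1 h1.2
    exact ⟨h2.1, h2.2, (Real.rpow_le_rpow_iff (hbpos k₀).le (hbpos k).le ht).1 hk.2⟩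

/-- If `b(t) > 0`, there is a set of dimension at least `t` of points with bounded orbits in
`{|z| > 1}`. -/
theorem exists_invariant (h : RegularTract φ α x C T₁) {f : ℂ → ℂ} {R : ℝ} (hR : 1 ≤ R)
    (hf : ∀ ξ ∈ halfPlane, f (φ ξ) = R * Complex.exp ξ) {t : ℝ} (ht : 0 < t)
    (hb : 0 < bInf φ t) :
    ∃ E : Set ℂ, ENNReal.ofReal t ≤ dimH E ∧
      (∃ B : ℝ, ∀ z ∈ E, ∀ n, 1 < ‖f^[n] z‖ ∧ ‖f^[n] z‖ ≤ B) ∧ (Continuous f → E ⊆ julia f) := by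
  have hC := h.one_le_C
  have hlogC : 0 ≤ Real.log C := Real.log_nonneg hC
  have hρ : 0 ≤ Real.log R := Real.log_nonneg hR
  set ρ := Real.log R with hρdef
  set r₀ := Real.log C + 8 with hr₀
  have hr₀8 : 8 ≤ r₀ := by linarith
  set q : ℕ := ⌈2 * r₀⌉₊ + 1 with hq
  have hqr : 2 * r₀ < q := by
    have := Nat.le_ceil (2 * r₀)
    rw [hq]
    push_cast
    linarith
  -- Multiples of `2π` keep the translations invisible to the exponential, and `w > 2r₀` makes the
  -- translates of the disk disjoint.
  set w : ℝ := 2 * Real.pi * q with hw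
  have hwr : 2 * r₀ < w := by
    have := Real.pi_gt_three
    nlinarith
  obtain ⟨S₀, hS₀⟩ := h.exists_branch (r := r₀ + ρ) (by linarith)
  -- The threshold `32 C² r₀` gives contraction `L = 8C²/s` with `L · 2r₀ ≤ 1/2`.
  obtain ⟨T, hT, s, hs, hsS, hsT, a, K, m, ha, hcard, hKm⟩ := h.exists_large_deriv ht
    (by linarith : 1 ≤ w) hb (max S₀ (32 * C ^ 2 * r₀))
  have hs1 : S₀ ≤ s := (le_max_left _ _).trans hsS
  have hs2 : 32 * C ^ 2 * r₀ ≤ s := (le_max_right _ _).trans hsS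
  have hC2 : 1 ≤ C ^ 2 := one_le_pow₀ hC
  have hs3 : r₀ < s := by nlinarith
  have hs0 : 0 < s := by linarith
  set y : Fin K.card → ℝ := fun k => w * (m + (K.equivFin.symm k : ℕ)) with hy
  have hyK : ∀ k, (K.equivFin.symm k : ℕ) ∈ K := fun k => (K.equivFin.symm k).2
  have hbr := fun k : Fin K.card => hS₀ T hT s hs hs1 hsT (y k) (hKm _ (hyK k)).1
    (hKm _ (hyK k)).2.1
  choose Λ hΛ1 hΛ2 using hbr
  set D : Set ℂ := closedBall (s : ℂ) r₀ with hD
  have hshift : ∀ k, ∀ η ∈ D, η - ρ + y k * Complex.I ∈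
      closedBall (s + y k * Complex.I : ℂ) (r₀ + ρ) := by
    intro k η hη
    rw [hD, mem_closedBall, dist_eq_norm] at hη
    rw [mem_closedBall, dist_eq_norm]
    have : η - ρ + y k * Complex.I - (s + y k * Complex.I) = (η - s) - ρ := by ring
    rw [this]
    refine (norm_sub_le _ _).trans ?_
    rw [Complex.norm_real, Real.norm_eq_abs, abs_of_nonneg hρ]
    linarith
  set G : Fin K.card → ℂ → ℂ := fun k η => Λ k (η - ρ + y k * Complex.I) with hG
  set a' := Real.exp (-(koebeConst * Real.log s)) / (2 * C) * a with ha'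
  have ha'0 : 0 < a' := by positivity
  set L := 8 * C ^ 2 / s with hL
  have hL0 : 0 ≤ L := by positivity
  have hLr : L * (2 * r₀) ≤ 1 / 2 := by
    rw [hL, div_mul_eq_mul_div, div_le_iff₀ hs0]
    linarith
  have hL1 : L < 1 := by nlinarith
  have hmaps : ∀ k, MapsTo (G k) D D := fun k η hη => (hΛ1 k _ (hshift k η hη)).2.2
  have hlip : ∀ k, ∀ η ∈ D, ∀ η' ∈ D, dist (G k η) (G k η') ≤ L * dist η η' := by
    intro k η hη η' hη'
    have := (hΛ2 k _ (hshift k η hη) _ (hshift k η' hη')).1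
    rw [add_sub_add_right_eq_sub, sub_sub_sub_cancel_right] at this
    rw [dist_eq_norm, dist_eq_norm]
    exact this
  have hanti : ∀ k, ∀ η ∈ D, ∀ η' ∈ D, a' * dist η η' ≤ dist (G k η) (G k η') := by
    intro k η hη η' hη'
    have := (hΛ2 k _ (hshift k η hη) _ (hshift k η' hη')).2
    rw [add_sub_add_right_eq_sub, sub_sub_sub_cancel_right] at this
    rw [dist_eq_norm, dist_eq_norm]
    refine le_trans ?_ this
    rw [ha']
    gcongr
    exact (hKm _ (hyK k)).2.2
  -- Equal logarithms give equal values of `φ`, so by injectivity two points of `D` would differ by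
  -- a nonzero multiple of `iw`.
  have hdisj : ∀ k l, k ≠ l → Disjoint (G k '' D) (G l '' D) := by
    intro k l hkl
    rw [Set.disjoint_left]
    rintro _ ⟨η, hη, rfl⟩ ⟨η', hη', heq⟩
    obtain ⟨hp1, he1, -⟩ := hΛ1 k _ (hshift k η hη)
    obtain ⟨hp2, he2, -⟩ := hΛ1 l _ (hshift l η' hη')
    have h1 : η' - ρ + y l * Complex.I = η - ρ + y k * Complex.I := by
      refine h.inj hp2 hp1 ?_
      rw [← he1, ← he2]
      exact congrArg _ heq
    have h2 : η' - η = ((y k - y l : ℝ) : ℂ) * Complex.I := by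
      push_cast
      linear_combination h1
    have h3 : |y k - y l| ≤ 2 * r₀ := by
      have h4 := congrArg norm h2
      rw [norm_mul, Complex.norm_I, mul_one, Complex.norm_real, Real.norm_eq_abs] at h4
      rw [← h4, ← dist_eq_norm]
      have := dist_triangle_right η' η s
      rw [hD, mem_closedBall] at hη hη'
      linarith
    have h5 : y k - y l =
        w * (((K.equivFin.symm k : ℕ) : ℤ) - ((K.equivFin.symm l : ℕ) : ℤ) : ℤ) := by
      simp only [hy]
      push_cast
      ring
    have h6 : ((K.equivFin.symm k : ℕ) : ℤ) - ((K.equivFin.symm l : ℕ) : ℤ) ≠ 0 := by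
      intro h0
      apply hkl
      have : (K.equivFin.symm k : ℕ) = (K.equivFin.symm l : ℕ) := by omega
      exact K.equivFin.symm.injective (Subtype.ext this)
    have h7 : (1 : ℝ) ≤
        |((((K.equivFin.symm k : ℕ) : ℤ) - ((K.equivFin.symm l : ℕ) : ℤ) : ℤ) : ℝ)| := by
      rw [← Int.cast_abs]
      exact_mod_cast Int.one_le_abs h6
    rw [h5, abs_mul, abs_of_pos (by linarith)] at h3
    nlinarith
  have hcomp : ∀ k, IsCompact (G k '' D) := by
    intro k
    have hDc : IsCompact D := isCompact_closedBall _ _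
    refine hDc.image_of_continuousOn ?_
    have : LipschitzOnWith L.toNNReal (G k) D := LipschitzOnWith.of_dist_le_mul
      fun η hη η' hη' => by rw [Real.coe_toNNReal L hL0]; exact hlip k η hη η' hη'
    exact this.continuousOn
  have hsep : ∃ d > (0 : ℝ), ∀ k l, k ≠ l → ∀ η ∈ D, ∀ η' ∈ D, d ≤ dist (G k η) (G l η') := by
    have hev : ∀ᶠ d in 𝓝[>] (0 : ℝ), ∀ k l : Fin K.card, k ≠ l → ∀ η ∈ D, ∀ η' ∈ D,
        d ≤ dist (G k η) (G l η') := by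
      rw [eventually_all]
      intro k
      rw [eventually_all]
      intro l
      by_cases hkl : k = l
      · exact Eventually.of_forall fun d hne => absurd hkl hne
      obtain ⟨δ, hδ, hdj⟩ := (hdisj k l hkl).exists_thickenings (hcomp k) (hcomp l).isClosed
      filter_upwards [Ioo_mem_nhdsGT hδ] with d hd _ η hη η' hη'
      by_contra! hlt
      have hmem : G l η' ∈ thickening δ (G k '' D) := mem_thickening_iff.2
        ⟨G k η, mem_image_of_mem _ hη, by rw [dist_comm]; exact hlt.trans hd.2⟩
      exact Set.disjoint_left.1 hdj hmem
        (self_subset_thickening hδ _ (mem_image_of_mem _ hη'))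
    obtain ⟨d, hd, hd0⟩ := (hev.and self_mem_nhdsWithin).exists
    exact ⟨d, hd0, hd⟩
  obtain ⟨d, hd0, hd⟩ := hsep
  have hIFS : SeparatedIFS D G a' d L (2 * r₀) :=
    { isClosed := isClosed_closedBall
      nonempty := ⟨s, mem_closedBall_self (by linarith)⟩
      dist_le := fun η hη η' hη' => by
        have := dist_triangle_right η η' s
        rw [hD, mem_closedBall] at hη hη'
        linarith
      a_pos := ha'0
      d_pos := hd0
      L_nonneg := hL0
      L_lt_one := hL1
      mapsTo := hmaps
      lip := hlip
      antilip := hanti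
      sep := hd }
  -- Comparing the Lipschitz bounds at two points gives `a' ≤ L < 1`, so `K.card * a' ^ t ≥ 1`
  -- requires more than one branch.
  have hN : 1 < K.card := by
    have hpos : 0 < K.card := by
      rw [Nat.pos_iff_ne_zero]
      intro h0
      rw [h0, Nat.cast_zero, zero_mul] at hcard
      linarith
    have h1 : (s : ℂ) ∈ D := mem_closedBall_self (by linarith)
    have h2 : (s : ℂ) + 1 ∈ D := by
      rw [hD, mem_closedBall, dist_self_add_left, norm_one]
      linarith
    have h3 := (hanti ⟨0, hpos⟩ _ h2 _ h1).trans (hlip ⟨0, hpos⟩ _ h2 _ h1)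
    rw [dist_self_add_left, norm_one, mul_one, mul_one] at h3
    have h4 : a' ^ t < 1 := Real.rpow_lt_one ha'0.le (by linarith) ht
    have h5 : 0 < a' ^ t := Real.rpow_pos_of_pos ha'0 t
    by_contra! hle
    have h6 : (K.card : ℝ) ≤ 1 := by exact_mod_cast hle
    nlinarith
  have hconj : ∀ k, ∀ η ∈ D, f (Complex.exp (G k η)) = Complex.exp η := by
    intro k η hη
    obtain ⟨hp1, he1, -⟩ := hΛ1 k _ (hshift k η hη)
    simp only [hG]
    rw [he1, hf _ hp1]
    have h1 : Complex.exp (y k * Complex.I) = 1 := by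
      rw [Complex.exp_eq_one_iff]
      refine ⟨q * (m + (K.equivFin.symm k : ℕ)), ?_⟩
      simp only [hy, hw]
      push_cast
      ring
    have h2 : Complex.exp (ρ : ℂ) = R := by
      rw [← Complex.ofReal_exp, hρdef, Real.exp_log (by linarith)]
    rw [Complex.exp_add, h1, Complex.exp_sub, h2, mul_one]
    have : (R : ℂ) ≠ 0 := by exact_mod_cast (by linarith : R ≠ 0)
    field_simp
  obtain ⟨E, hE1, hE2, hE3⟩ := hIFS.exists_invariant hN ht hcard hLr hconj
  refine ⟨E, hE1, ⟨Real.exp (s + r₀), fun z hz n => ?_⟩, hE3⟩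
  obtain ⟨η, hη, hηz⟩ := hE2 z hz n
  rw [hD, mem_closedBall, dist_eq_norm] at hη
  have h1 := abs_le.1 ((Complex.abs_re_le_norm (η - s)).trans hη)
  rw [Complex.sub_re, Complex.ofReal_re] at h1
  rw [← hηz, Complex.norm_exp]
  exact ⟨Real.one_lt_exp_iff.2 (by linarith), Real.exp_le_exp.2 (by linarith)⟩

end RegularTract

end Tract
end
noncomputable section
namespace Tract
open Filter Topology Set Metric

/-! ### Tracts at different levels -/

theorem convex_halfPlane : Convex ℝ halfPlane := convex_halfSpace_re_gt 0

theorem IsTractMap.norm_eq {f : ℂ → ℂ} {R : ℝ} {Ω : Set ℂ} {φ : ℂ → ℂ} (h : IsTractMap f R Ω φ)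
    (hR : 0 < R) {ξ : ℂ} (hξ : ξ ∈ halfPlane) : ‖f (φ ξ)‖ = R * Real.exp ξ.re := by
  rw [h.eq_exp ξ hξ, norm_mul, Complex.norm_exp, Complex.norm_real, Real.norm_eq_abs,
    abs_of_pos hR]

theorem lt_mul_exp_iff {R R' x : ℝ} (hR : 0 < R) (hR' : 0 < R') :
    R' < R * Real.exp x ↔ Real.log (R' / R) < x := by
  rw [Real.log_lt_iff_lt_exp (div_pos hR' hR), div_lt_iff₀ hR, mul_comm]

/-- The tracts at a higher level inside a tract. -/
theorem IsTractMap.connectedComponentIn_eq {f : ℂ → ℂ} {R R' : ℝ} {Ω : Set ℂ} {φ : ℂ → ℂ}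
    (h : IsTractMap f R Ω φ) (hΩ : Ω ∈ tracts f R) (hR : 0 < R) (hRR' : R ≤ R') {z : ℂ}
    (hz : z ∈ Ω) (hfz : R' < ‖f z‖) :
    connectedComponentIn {w | R' < ‖f w‖} z = φ '' {ξ | Real.log (R' / R) < ξ.re} := by
  have hR' : 0 < R' := hR.trans_le hRR'
  have hlog : 0 ≤ Real.log (R' / R) := Real.log_nonneg ((one_le_div hR).2 hRR')
  have hsub : {ξ : ℂ | Real.log (R' / R) < ξ.re} ⊆ halfPlane := fun ξ hξ =>
    lt_of_le_of_lt hlog hξ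
  have hsurj : ∀ w ∈ Ω, R' < ‖f w‖ → w ∈ φ '' {ξ | Real.log (R' / R) < ξ.re} := by
    intro w hw hfw
    obtain ⟨ξ, hξ, rfl⟩ := h.bij.surjOn hw
    rw [h.norm_eq hR hξ, lt_mul_exp_iff hR hR'] at hfw
    exact ⟨ξ, hfw, rfl⟩
  obtain ⟨z₀, hz₀, rfl⟩ := hΩ
  refine Subset.antisymm (fun w hw => ?_) ?_
  · have hfw : w ∈ {w | R' < ‖f w‖} := connectedComponentIn_subset _ _ hw
    refine hsurj w ?_ hfw
    rw [_root_.connectedComponentIn_eq hz]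
    exact connectedComponentIn_mono z (fun v hv => hRR'.trans_lt hv) hw
  · refine IsPreconnected.subset_connectedComponentIn ?_ (hsurj z hz hfz) ?_
    · exact (convex_halfSpace_re_gt _).isPreconnected.image φ (h.holo.continuousOn.mono hsub)
    · rintro _ ⟨ξ, hξ, rfl⟩
      show R' < ‖f (φ ξ)‖
      rw [h.norm_eq hR (hsub hξ), lt_mul_exp_iff hR hR']
      exact hξ

/-- Conformal maps associated with nested tracts differ by a translation. -/
theorem IsTractMap.exists_shift {f : ℂ → ℂ} {R₁ R₂ : ℝ} {Ω₁ Ω₂ : Set ℂ} {φ₁ φ₂ : ℂ → ℂ}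
    (h₁ : IsTractMap f R₁ Ω₁ φ₁) (h₂ : IsTractMap f R₂ Ω₂ φ₂) (hR₁ : 0 < R₁) (hR₂ : 0 < R₂)
    (hΩ : Ω₂ ⊆ Ω₁) :
    ∃ c : ℂ, c.re = Real.log (R₂ / R₁) ∧
      ∀ ξ ∈ halfPlane, 0 < (ξ + c).re ∧ φ₂ ξ = φ₁ (ξ + c) := by
  have hinv := h₁.bij.injOn.leftInvOn_invFunOn
  set ψ := Function.invFunOn φ₁ halfPlane
  have himg : φ₁ '' halfPlane = Ω₁ := h₁.bij.image_eq
  have hψd : DifferentiableOn ℂ ψ Ω₁ := by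
    rw [← himg]
    exact differentiableOn_of_leftInvOn isOpen_halfPlane h₁.holo hinv
  have hmem : ∀ ξ ∈ halfPlane, φ₂ ξ ∈ Ω₁ := fun ξ hξ => hΩ (h₂.bij.mapsTo hξ)
  have hψ : ∀ ξ ∈ halfPlane, ψ (φ₂ ξ) ∈ halfPlane ∧ φ₁ (ψ (φ₂ ξ)) = φ₂ ξ := by
    intro ξ hξ
    obtain ⟨η, hη, hηξ⟩ := h₁.bij.surjOn (hmem ξ hξ)
    rw [← hηξ, hinv hη]
    exact ⟨hη, rfl⟩
  -- Comparing the two exponential formulas for `f` shows that `exp v = R₂ / R₁`, so `v' = 0`.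
  set v : ℂ → ℂ := fun ξ => ψ (φ₂ ξ) - ξ with hv
  have hvd : DifferentiableOn ℂ v halfPlane :=
    (hψd.comp h₂.holo hmem).sub differentiableOn_id
  have hR₁c : (R₁ : ℂ) ≠ 0 := by exact_mod_cast hR₁.ne'
  have hexp : ∀ ξ ∈ halfPlane, Complex.exp (v ξ) = R₂ / R₁ := by
    intro ξ hξ
    obtain ⟨h3, h4⟩ := hψ ξ hξ
    have h5 := h₁.eq_exp _ h3
    rw [h4, h₂.eq_exp ξ hξ] at h5
    rw [hv, Complex.exp_sub, div_eq_div_iff (Complex.exp_ne_zero _) hR₁c, h5, mul_comm]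
  have hder : ∀ ξ ∈ halfPlane, deriv v ξ = 0 := by
    intro ξ hξ
    have hd := (hvd.differentiableAt (isOpen_halfPlane.mem_nhds hξ)).hasDerivAt.cexp
    have hc : HasDerivAt (fun ξ => Complex.exp (v ξ)) 0 ξ :=
      (hasDerivAt_const ξ ((R₂ : ℂ) / R₁)).congr_of_eventuallyEq (by
        filter_upwards [isOpen_halfPlane.mem_nhds hξ] with η hη using hexp η hη)
    exact (mul_eq_zero.1 (hd.unique hc)).resolve_left (Complex.exp_ne_zero _)
  have h1mem : (1 : ℂ) ∈ halfPlane := by show 0 < Complex.re 1; simp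
  have hconst : ∀ ξ ∈ halfPlane, v ξ = v 1 := fun ξ hξ =>
    convex_halfPlane.is_const_of_fderivWithin_eq_zero (𝕜 := ℂ) hvd
      (fun η hη => by
        rw [fderivWithin_of_isOpen isOpen_halfPlane hη]
        ext
        simpa using hder η hη) hξ h1mem
  refine ⟨v 1, ?_, fun ξ hξ => ?_⟩
  · have := congrArg norm (hexp 1 h1mem)
    rw [Complex.norm_exp, norm_div, Complex.norm_real, Complex.norm_real, Real.norm_eq_abs,
      Real.norm_eq_abs, abs_of_pos hR₁, abs_of_pos hR₂] at this
    rw [← this, Real.log_exp]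
  · rw [← hconst ξ hξ, hv, add_sub_cancel]
    exact ⟨(hψ ξ hξ).1, (hψ ξ hξ).2.symm⟩

/-- The Hölder condition does not depend on the level, up to a translation. -/
theorem IsTractMap.exists_regularTract {f : ℂ → ℂ} {R α : ℝ} {Ω : Set ℂ} {φ : ℂ → ℂ}
    (h : IsTractMap f R Ω φ) (hΩ : Ω ∈ tracts f R) (hR : 1 ≤ R) (hα : 0 < α) (hα1 : α ≤ 1)
    (hH : HasHolderTracts f α) (htend : Tendsto (fun T : ℝ => ‖φ T‖) atTop atTop) :
    ∃ x C T₁, RegularTract φ α x C T₁ := by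
  obtain ⟨R', hR', -, htr⟩ := hH
  have hR0 : 0 < R := by linarith
  have hR'0 : 0 < R' := by linarith
  rcases le_total R R' with hle | hle
  · have hlog : 0 ≤ Real.log (R' / R) := Real.log_nonneg ((one_le_div hR0).2 hle)
    -- A point whose image has level above `R'`; it selects the Hölder tract at level `R'` inside
    -- `Ω`. In the other case `Ω` itself lies inside such a tract.
    set ξ₀ : ℂ := ((Real.log (R' / R) + 1 : ℝ) : ℂ) with hξ₀
    have hre : ξ₀.re = Real.log (R' / R) + 1 := Complex.ofReal_re _
    have hξ₀m : ξ₀ ∈ halfPlane := by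
      show 0 < ξ₀.re
      rw [hre]
      linarith
    have hf : R' < ‖f (φ ξ₀)‖ := by
      rw [h.norm_eq hR0 hξ₀m, lt_mul_exp_iff hR0 hR'0, hre]
      linarith
    obtain ⟨ψ, hψ, H, hψH⟩ := htr _ ⟨φ ξ₀, hf, rfl⟩
    have hcomp := h.connectedComponentIn_eq hΩ hR0 hle (h.bij.mapsTo hξ₀m) hf
    obtain ⟨c, hc, hshift⟩ := h.exists_shift hψ hR0 hR'0 (by
      rw [hcomp]
      rintro _ ⟨ξ, hξ, rfl⟩
      exact h.bij.mapsTo (lt_of_le_of_lt hlog hξ))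
    have hpos : ∀ ξ : ℂ, c.re + 1 ≤ ξ.re → 0 < (ξ + -c).re := by
      intro ξ hξ
      rw [Complex.add_re, Complex.neg_re]
      linarith
    refine Tract.exists_regularTract (ψ := ψ) (c := -c) (x₀ := c.re + 1) hα hα1 h.holo h.bij.injOn
      hψ.holo htend hpos (fun ξ hξ => ?_) hψH
    rw [(hshift _ (hpos ξ hξ)).2, neg_add_cancel_right]
  · obtain ⟨z₀, hz₀, hΩz⟩ := hΩ
    have hz₀' : R' < ‖f z₀‖ := hle.trans_lt hz₀
    have hΩ' : connectedComponentIn {w | R' < ‖f w‖} z₀ ∈ tracts f R' := ⟨z₀, hz₀', rfl⟩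
    obtain ⟨ψ, hψ, H, hψH⟩ := htr _ hΩ'
    have hsub : Ω ⊆ connectedComponentIn {w | R' < ‖f w‖} z₀ := by
      rw [hΩz]
      exact connectedComponentIn_mono z₀ fun v hv => hle.trans_lt hv
    obtain ⟨c, hc, hshift⟩ := hψ.exists_shift h hR'0 hR0 hsub
    refine Tract.exists_regularTract (ψ := ψ) (c := c) (x₀ := 1) hα hα1 h.holo h.bij.injOn hψ.holo
      htend (fun ξ hξ => (hshift ξ (lt_of_lt_of_le one_pos hξ)).1)
      (fun ξ hξ => (hshift ξ (lt_of_lt_of_le one_pos hξ)).2) hψH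

/-! ### Systems of regular tracts -/

theorem subset_radial {f : ℂ → ℂ} {J E : Set ℂ} (hE : E ⊆ J) {B : ℝ}
    (hB : ∀ z ∈ E, ∀ n, ‖f^[n] z‖ ≤ B) : E ⊆ radial f J := by
  refine fun z hz => ⟨hE hz, ?_⟩
  refine lt_of_le_of_lt (liminf_le_of_frequently_le' (x := ENNReal.ofReal B)
    (Eventually.of_forall fun n => ?_).frequently) ENNReal.ofReal_lt_top
  rw [← ofReal_norm]
  exact ENNReal.ofReal_le_ofReal (hB z hz n)

theorem dimH_le_two (s : Set ℂ) : dimH s ≤ 2 := by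
  refine (dimH_mono (subset_univ s)).trans ?_
  rw [Real.dimH_univ_eq_finrank ℂ, Complex.finrank_real_complex]
  norm_num

/-- Common to models and entire functions. The hypothesis `hJ` isolates why the invariant set lies
in the Julia set: orbits in `{|z| > 1}` for models, failure of normality for entire functions. -/
theorem proposition_of_regularTract {f : ℂ → ℂ} {R α : ℝ} {N : ℕ} {φ : Fin N → ℂ → ℂ}
    {J : Set ℂ} (hN : 0 < N) (hR : 1 ≤ R) (hα : 0 < α) (hα1 : α ≤ 1)
    (hf : ∀ j, ∀ ξ ∈ halfPlane, f (φ j ξ) = R * Complex.exp ξ)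
    (hreg : ∀ j, ∃ x C T₁, RegularTract (φ j) α x C T₁)
    (hJ : ∀ E : Set ℂ, (∀ z ∈ E, ∀ n, 1 < ‖f^[n] z‖) → (Continuous f → E ⊆ julia f) → E ⊆ J) :
    HasNegativeSpectrum φ ∧ 1 ≤ thetaMax φ ∧
      ENNReal.ofReal (thetaMax φ) ≤ dimH (radial f J) ∧ dimH (radial f J) ≤ 2 ∧
      (1 / 2 < α → thetaMax φ < 2) := by
  have : Nonempty (Fin N) := ⟨⟨0, hN⟩⟩
  have hspec := fun j => (hreg j).choose_spec.choose_spec.choose_spec.spectrum hα hα1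
  have hbdd : ∀ u : Fin N → ℝ, BddAbove (range u) := fun u => (finite_range u).bddAbove
  obtain ⟨j₀, hj₀⟩ := exists_eq_ciSup_of_finite (f := fun j => theta (φ j))
  have hθ : thetaMax φ = theta (φ j₀) := hj₀.symm
  refine ⟨fun t ht => ?_, ?_, ?_, dimH_le_two _, fun hα2 => ?_⟩
  · obtain ⟨j, hj⟩ := exists_eq_ciSup_of_finite (f := fun j => betaInf (φ j) t)
    have hlt : theta (φ j) < t := lt_of_le_of_lt (le_ciSup (hbdd fun j => theta (φ j)) j) ht
    have := (hspec j).2.2.1 t hlt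
    rw [bInfMax, betaInfMax, ← hj]
    exact this
  · rw [hθ]
    exact (hspec j₀).1
  · by_contra! hlt
    rw [hθ] at hlt
    have hfin : dimH (radial f J) ≠ ⊤ := hlt.ne_top
    set d := (dimH (radial f J)).toReal with hd
    have hd0 : 0 ≤ d := ENNReal.toReal_nonneg
    have hdθ : d < theta (φ j₀) := (ENNReal.lt_ofReal_iff_toReal_lt hfin).1 hlt
    -- Strictly between the dimension and `Θ` one has `b(t) > 0`, which yields a subset of dimension
    -- at least `t`.
    set t := (d + theta (φ j₀)) / 2 with ht
    have ht0 : 0 < t := by linarith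
    obtain ⟨x, C, T₁, hr⟩ := hreg j₀
    obtain ⟨E, hE, ⟨B, hB⟩, hEJ⟩ := hr.exists_invariant hR (hf j₀) ht0
      ((hspec j₀).2.2.2 t ht0 (by linarith))
    have hsub : E ⊆ radial f J :=
      subset_radial (hJ E (fun z hz n => (hB z hz n).1) hEJ) fun z hz n => (hB z hz n).2
    have h1 := hE.trans (dimH_mono hsub)
    rw [ENNReal.ofReal_le_iff_le_toReal hfin] at h1
    linarith
  · rw [hθ]
    refine lt_of_le_of_lt (hspec j₀).2.1 ?_
    rw [div_lt_iff₀ hα]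
    linarith

/-! ### Models -/

namespace Model

variable (m : Model)

theorem toFun_eq {j : Fin m.N} {z : ℂ} (hz : z ∈ m.Ω j) :
    m.toFun z = Complex.exp (m.τ j z) := by
  have hex : ∃ j, z ∈ m.Ω j := ⟨j, hz⟩
  have hj : hex.choose = j := by
    by_contra hne
    exact Set.disjoint_left.1 (m.disjoint hne) hex.choose_spec hz
  rw [toFun, dif_pos hex, hj]

theorem one_lt_norm_toFun_iff {z : ℂ} : 1 < ‖m.toFun z‖ ↔ ∃ j, z ∈ m.Ω j := by
  refine ⟨fun h => ?_, fun ⟨j, hj⟩ => ?_⟩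
  · by_contra hex
    rw [toFun, dif_neg hex, norm_zero] at h
    linarith
  · rw [m.toFun_eq hj, Complex.norm_exp]
    exact Real.one_lt_exp_iff.2 ((m.bij j).mapsTo hj)

/-- The set `{|f| > 1}` is the disjoint union of the open connected sets `Ω_i`, so these are the
tracts at level 1. -/
theorem connectedComponentIn_eq {j : Fin m.N} {z : ℂ} (hz : z ∈ m.Ω j) :
    connectedComponentIn {w | 1 < ‖m.toFun w‖} z = m.Ω j := by
  refine Subset.antisymm ?_ ?_
  · refine isPreconnected_connectedComponentIn.subset_left_of_subset_union (m.isOpen j)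
      (v := ⋃ i ∈ {i | i ≠ j}, m.Ω i) (isOpen_biUnion fun i _ => m.isOpen i) ?_ ?_
      ⟨z, mem_connectedComponentIn (m.one_lt_norm_toFun_iff.2 ⟨j, hz⟩), hz⟩
    · exact Set.disjoint_iUnion₂_right.2 fun i hi => m.disjoint (Ne.symm hi)
    · intro w hw
      have hfw : w ∈ {w | 1 < ‖m.toFun w‖} := connectedComponentIn_subset _ _ hw
      obtain ⟨i, hi⟩ := m.one_lt_norm_toFun_iff.1 hfw
      by_cases hij : i = j
      · exact Or.inl (hij ▸ hi)
      · exact Or.inr (mem_biUnion hij hi)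
  · have := m.simplyConnected j
    have hpre : IsPreconnected (m.Ω j) := isPreconnected_iff_preconnectedSpace.2 inferInstance
    exact hpre.subset_connectedComponentIn hz fun w hw => m.one_lt_norm_toFun_iff.2 ⟨j, hw⟩

theorem nonempty (j : Fin m.N) : (m.Ω j).Nonempty := by
  rw [nonempty_iff_ne_empty]
  intro h
  exact m.unbounded j (h ▸ Bornology.isBounded_empty)

theorem mem_tracts (j : Fin m.N) : m.Ω j ∈ tracts m.toFun 1 := by
  obtain ⟨z, hz⟩ := m.nonempty j
  exact ⟨z, m.one_lt_norm_toFun_iff.2 ⟨j, hz⟩, (m.connectedComponentIn_eq hz).symm⟩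

theorem isTractMap (j : Fin m.N) : IsTractMap m.toFun 1 (m.Ω j) (m.φ j) := by
  have hinv := (m.bij j).invOn_invFunOn
  have hbij : BijOn (m.φ j) halfPlane (m.Ω j) := (m.bij j).symm hinv.symm
  refine ⟨?_, hbij, fun ξ hξ => ?_⟩
  · rw [← (m.bij j).image_eq]
    exact differentiableOn_of_leftInvOn (m.isOpen j) (m.holo j) hinv.1
  · rw [m.toFun_eq (hbij.mapsTo hξ), Complex.ofReal_one, one_mul]
    exact congrArg _ (hinv.2 hξ)

theorem tendsto_norm (j : Fin m.N) : Tendsto (fun T : ℝ => ‖m.φ j T‖) atTop atTop := by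
  refine tendsto_norm_cobounded_atTop.comp ((m.tendsto_infty j).comp ?_)
  refine tendsto_inf.2 ⟨?_, tendsto_principal.2 ?_⟩
  · rw [← tendsto_norm_atTop_iff_cobounded]
    simpa using tendsto_abs_atTop_atTop
  · filter_upwards [eventually_gt_atTop 0] with T hT
    show 0 < Complex.re T
    simpa using hT

end Model

/-! ### Entire functions -/

/-- An entire function is bounded on disks, whereas `|f(φ(T))| = R e^T`. -/
theorem IsTractMap.tendsto_norm {f : ℂ → ℂ} {R : ℝ} {Ω : Set ℂ} {φ : ℂ → ℂ}
    (h : IsTractMap f R Ω φ) (hR : 1 ≤ R) (hf : Continuous f) :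
    Tendsto (fun T : ℝ => ‖φ T‖) atTop atTop := by
  rw [Filter.tendsto_atTop]
  intro B
  obtain ⟨M, hM⟩ := (isCompact_closedBall (0 : ℂ) B).exists_bound_of_continuousOn hf.continuousOn
  filter_upwards [eventually_gt_atTop 0, Real.tendsto_exp_atTop.eventually_gt_atTop M]
    with T hT hTM
  by_contra! hlt
  have h1 := hM (φ T) (by rw [mem_closedBall_zero_iff]; exact hlt.le)
  have h2 := h.norm_eq (by linarith) (ξ := (T : ℂ)) (by show 0 < Complex.re T; simpa using hT)
  rw [Complex.ofReal_re] at h2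
  nlinarith [Real.exp_pos T]

/-- Liouville. It provides a tract at every level, so that the maxima over the tracts range over a
nonempty set. -/
theorem ClassB.exists_lt_norm {f : ℂ → ℂ} (hf : ClassB f) (R : ℝ) : ∃ z, R < ‖f z‖ := by
  by_contra! hle
  obtain ⟨c, hc⟩ := hf.entire.exists_const_forall_eq_of_bounded
    (isBounded_iff_forall_norm_le.2 ⟨R, by rintro _ ⟨z, rfl⟩; exact hle z⟩)
  exact hf.transcendental ⟨Polynomial.C c, fun z => by rw [hc z, Polynomial.eval_C]⟩

end Tract
end

/-! ### The theorem for models and for class `B`. -/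

theorem mainTheorem2 :
    (∀ (m : Tract.Model) (α : ℝ), 0 < α → α ≤ 1 → Tract.HasHolderTracts m.toFun α →
      Tract.HasNegativeSpectrum m.φ ∧
      1 ≤ Tract.thetaMax m.φ ∧
      ENNReal.ofReal (Tract.thetaMax m.φ) ≤ m.hypDim ∧
      m.hypDim ≤ 2 ∧
      (1 / 2 < α → Tract.thetaMax m.φ < 2)) ∧
    (∀ (f : ℂ → ℂ) (α : ℝ), Tract.ClassB f → 0 < α → α ≤ 1 → Tract.HasHolderTracts f α →
      ∀ (R : ℝ) (N : ℕ) (Ω : Fin N → Set ℂ) (φ : Fin N → ℂ → ℂ), 1 ≤ R →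
        Tract.IsTractSystem f R Ω φ →
        Tract.HasNegativeSpectrum φ ∧
        1 ≤ Tract.thetaMax φ ∧
        ENNReal.ofReal (Tract.thetaMax φ) ≤ Tract.hypDim f ∧
        Tract.hypDim f ≤ 2 ∧
        (1 / 2 < α → Tract.thetaMax φ < 2)) := by

  refine ⟨fun m α hα hα1 hH => ?_, fun f α hf hα hα1 hH R N Ω φ hR hsys => ?_⟩
  · refine Tract.proposition_of_regularTract (R := 1) (J := m.julia) m.N_pos le_rfl hα hα1
      (fun j => (m.isTractMap j).eq_exp) (fun j => ?_) (fun E hE _ => fun z hz n => hE z hz n)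
    exact (m.isTractMap j).exists_regularTract (m.mem_tracts j) le_rfl hα hα1 hH (m.tendsto_norm j)
  · have hmem : ∀ j, Ω j ∈ Tract.tracts f R := fun j => hsys.range_eq ▸ Set.mem_range_self j
    have hN : 0 < N := by
      obtain ⟨z, hz⟩ := hf.exists_lt_norm R
      have htr : connectedComponentIn {w | R < ‖f w‖} z ∈ Tract.tracts f R := ⟨z, hz, rfl⟩
      rw [← hsys.range_eq] at htr
      obtain ⟨j, -⟩ := htr
      exact j.pos
    exact Tract.proposition_of_regularTract (J := Tract.julia f) hN hR hα hα1
      (fun j => (hsys.isTractMap j).eq_exp)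
      (fun j => (hsys.isTractMap j).exists_regularTract (hmem j) hR hα hα1 hH
        ((hsys.isTractMap j).tendsto_norm hR hf.entire.continuous))
      (fun E _ hE => hE hf.entire.continuous)
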